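/- Consider a rigid body with a fixed point and principal moments of inertia $I_1,I_2,I_3>0$. Its configuration space is $SO(3)$ with the left-invariant metric $\langle \dot Q_1,\dot Q_2\rangle=\sum_i I_i\,\omega_i(\dot Q_1)\,\omega_i(\dot Q_2)$, where $\omega(\dot Q)\in\mathbb R^3$ is the vector of the skew-symmetric matrix $Q^{-1}\dot Q$. Let the smooth potential $V:SO(3)\to\mathbb R$ be invariant under $Q\mapsto Q^\tau Q$, where $Q^\tau$ is the rotation by the angle $\tau$ about the first (vertical) axis, and let $v(Q)=\frac{d}{d\tau}\big|_{\tau=0}Q^\tau Q$. Let $p:SO(3)\to S^2$, $p(Q)=\gamma=(\gamma_1,\gamma_2,\gamma_3)$, be the first row of $Q$ (equivalently, $\gamma=\omega(v(Q))$). A mechanical system with gyroscopic forces is a quadruple $(M,m,V,\kappa)$ of a manifold, a Riemannian metric, a smooth function and a smooth closed 2-form on it. With $\theta_w(Y)=m(w,Tp_M Y)$, $p_M:T(M)\to M$ the projection and $K(w)=\frac12 m(w,w)$, its dynamical system is the unique vector field $X$ on $T(M)$ with $i_X(d\theta+p_M^*\kappa)=-d(K+V\circ p_M)$; a motion is the projection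 to $M$ of an integral curve of $X$, and its energy is $K+V\circ p_M$. A natural system is the case $\kappa=0$. (1) The map $p$ is onto, and its fibres are exactly the orbits of the group $\{Q^\tau\}$. There is a smooth function $\tilde V$ on $S^2$ with $V=\tilde V\circ p$. (2) Put $D(\gamma)=I_1\gamma_1^2+I_2\gamma_2^2+I_3\gamma_3^2$ and, on $S^2$, $$\tilde m(\dot\gamma,\dot\gamma)=\frac{I_1I_2I_3}{D(\gamma)}\sum_i\frac{\dot\gamma_i^2}{I_i},\qquad \tilde V_k(\gamma)=\tilde V(\gamma)+\frac{k^2}{2D(\gamma)},$$ $$\tilde\Phi=\frac{(I_2+I_3-I_1)I_1\gamma_1^2+(I_3+I_1-I_2)I_2\gamma_2^2+(I_1+I_2-I_3)I_3\gamma_3^2}{D(\gamma)^2}\,\bigl(\gamma_1\,d\gamma_2\wedge d\gamma_3+\gamma_2\,d\gamma_3\wedge d\gamma_1+\gamma_3\,d\gamma_1\wedge d\gamma_2\bigr),$$ the last factor being the volume form of $S^2$ induced from $\mathbb R^3$. Then at every $Q\in SO(3)$ the map $Tp$ restricts to a linear bijection of the horizontal space $\{w\in T_QSO(3):\langle v,w\rangle=0\}$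 onto $T_{p(Q)}S^2$ which carries $\langle\,,\rangle$ to $\tilde m$; $\tilde V_k\circ p=V+k^2/(2\langle v,v\rangle)$; and $p^*\tilde\Phi=d\hbar$, where $\hbar(w)=\langle v,w\rangle/\langle v,v\rangle$ is the connection form. (3) For every $k\in\mathbb R$, $(SO(3),\langle\,,\rangle,V,0)$ and $(S^2,\tilde m,\tilde V_k,k\tilde\Phi)$ are mechanical systems with gyroscopic forces, each with a unique dynamical system, $X$ and $\tilde X_k$ respectively. The tangent map $Tp$ maps $J_k=\{w\in T(SO(3)):\langle v,w\rangle=k\}$ onto $T(S^2)$, and with $\rho_k=Tp|_{J_k}$ one has $T\rho_k\circ X=\tilde X_k\circ\rho_k$ on $J_k$; that is, the reduced system for the momentum value $k$ is $(S^2,\tilde m,\tilde V_k,k\tilde\Phi)$. (4) Suppose that the triangle inequalities $I_1<I_2+I_3$, $I_2<I_3+I_1$, $I_3<I_1+I_2$ hold (strictly). Then the coefficient of the volume form in $\tilde\Phi$ is positive everywhere on $S^2$. If moreover $k\neq0$, then the trajectories of the reduced system with energy $h$ have no inflection points in the metric $\tilde m_h=2(h-\tilde V_k)\tilde m$ on the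 region $\tilde V_k<h$: wherever a motion with energy $h$ is in this region, its velocity is nonzero and its geodesic curvature in $\tilde m_h$ is nonzero. Seen from outside the sphere, the trajectory turns to the right of the geodesics of $\tilde m_h$ (negative geodesic curvature) if $k>0$ and to the left (positive geodesic curvature) if $k<0$. -/

import Mathlib

open Filter Topology
open scoped ContDiff Matrix

attribute [local instance] Matrix.normedAddCommGroup Matrix.normedSpace

noncomputable section

/-! ### Embedded submanifolds of a normed space

A submanifold is given by its underlying subset `N` of the ambient normed space. Vector-valued and
form-valued objects on `N` are given by functions on the ambient space of which only the values at
points of `N`, on vectors tangent to `N`, are relevant. -/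

section Submanifold

variable {E : Type*} [NormedAddCommGroup E] [NormedSpace ℝ E]

/-- `u` is tangent to `N` at `x`: it is the velocity of a smooth curve lying in `N`. -/
def IsTangent (N : Set E) (x u : E) : Prop :=
  ∃ c : ℝ → E, ContDiff ℝ ∞ c ∧ (∀ t, c t ∈ N) ∧ c 0 = x ∧ deriv c 0 = u

/-- The total space `T(N)` of the tangent bundle, as a subset of `E × E`. -/
def tangentBundle (N : Set E) : Set (E × E) :=
  {p | p.1 ∈ N ∧ IsTangent N p.1 p.2}

/-- The smooth ambient form `A`, defined on the open neighbourhood `U` of `x`, restricts on `N` to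
the `n`-form `α`. -/
def IsLocalExtension {n : ℕ} (N : Set E) (α : E → (Fin n → E) → ℝ) (x : E) (U : Set E)
    (A : E → E [⋀^Fin n]→L[ℝ] ℝ) : Prop :=
  IsOpen U ∧ x ∈ U ∧ ContDiffOn ℝ ∞ A U ∧
    ∀ y ∈ U ∩ N, ∀ v : Fin n → E, (∀ i, IsTangent N y (v i)) → A y v = α y v

/-- `α` is a smooth differential `n`-form on `N`; for `n = 0`, a smooth function on `N`. -/
def IsSmoothForm {n : ℕ} (N : Set E) (α : E → (Fin n → E) → ℝ) : Prop :=
  ∀ x ∈ N, ∃ U A, IsLocalExtension N α x U A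

/-- `η` is the value at `x` of the exterior derivative of the differential form `α` on `N`.
The exterior derivative commutes with restriction to `N`, so it is the restriction to the tangent
space of `N` of the exterior derivative of a smooth ambient extension of `α` near `x`.
For a `1`-form, `dα(u, v) = u(α v) - v(α u)` for constant ambient fields `u`, `v`. -/
def HasExtDerivAt {n : ℕ} (N : Set E) (α : E → (Fin n → E) → ℝ) (x : E)
    (η : (Fin (n + 1) → E) → ℝ) : Prop :=
  ∃ U A, IsLocalExtension N α x U A ∧
    ∀ v : Fin (n + 1) → E, (∀ i, IsTangent N x (v i)) → η v = extDeriv A x v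

/-- `m` is a smooth Riemannian metric on `N`. -/
def IsRiemannianMetricOn (N : Set E) (m : E → E → E → ℝ) : Prop :=
  (∀ x ∈ N, ∃ (U : Set E) (A : E → E →L[ℝ] E →L[ℝ] ℝ),
    IsOpen U ∧ x ∈ U ∧ ContDiffOn ℝ ∞ A U ∧
      ∀ y ∈ U ∩ N, ∀ u v, IsTangent N y u → IsTangent N y v → A y u v = m y u v) ∧
  (∀ x ∈ N, ∀ u v, IsTangent N x u → IsTangent N x v → m x u v = m x v u) ∧
  (∀ x ∈ N, ∀ u, IsTangent N x u → u ≠ 0 → 0 < m x u u)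

end Submanifold

/-! ### Mechanical systems with gyroscopic forces -/

/-- The data `(M, m, V, κ)`: configuration space, metric, potential, form of gyroscopic forces. -/
structure GyroSystem (E : Type*) where
  M : Set E
  m : E → E → E → ℝ
  V : E → ℝ
  κ : E → (Fin 2 → E) → ℝ

namespace GyroSystem

variable {E : Type*} [NormedAddCommGroup E] [NormedSpace ℝ E]

/-- `(M, m, V, κ)` is a mechanical system with gyroscopic forces: `m` is a Riemannian metric, `V` a
smooth function and `κ` a smooth closed `2`-form on `M`. -/
def IsMechanical (S : GyroSystem E) : Prop :=
  IsRiemannianMetricOn S.M S.m ∧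
  IsSmoothForm S.M (fun x (_ : Fin 0 → E) => S.V x) ∧
  ∀ x ∈ S.M, HasExtDerivAt S.M S.κ x 0

/-- The total energy, a function on `T(M)`. -/
def energy (S : GyroSystem E) (p : E × E) : ℝ :=
  S.m p.1 p.2 p.2 / 2 + S.V p.1

/-- The Lagrange `1`-form `θ_w(Y) = ⟨w, Tp_M(Y)⟩` on `T(M)`. -/
def lagrangeForm (S : GyroSystem E) (p : E × E) (Y : Fin 1 → E × E) : ℝ :=
  S.m p.1 p.2 (Y 0).1

/-- `X` is the value at `p ∈ T(M)` of the vector field of the dynamical system of `(M, m, V, κ)`: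
`i_X (dθ + p_M^* κ) = - d(K + V ∘ p_M)` on `T_p(T(M))`. -/
def IsDynamicalVector (S : GyroSystem E) (p X : E × E) : Prop :=
  IsTangent (tangentBundle S.M) p X ∧
  ∃ (σ : (Fin 2 → E × E) → ℝ) (dH : (Fin 1 → E × E) → ℝ),
    HasExtDerivAt (tangentBundle S.M) S.lagrangeForm p σ ∧
    HasExtDerivAt (tangentBundle S.M) (fun q (_ : Fin 0 → E × E) => S.energy q) p dH ∧
    ∀ Y, IsTangent (tangentBundle S.M) p Y →
      σ ![X, Y] + S.κ p.1 ![X.1, Y.1] = - dH ![Y]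

/-- `x` is a motion on the time set `J`: the projection to `M` of an integral curve of the
dynamical system. -/
def IsMotionOn (S : GyroSystem E) (x : ℝ → E) (J : Set ℝ) : Prop :=
  ∃ w : ℝ → E × E, ∀ t ∈ J, w t ∈ tangentBundle S.M ∧ (w t).1 = x t ∧
    ∃ X, S.IsDynamicalVector (w t) X ∧ HasDerivAt w X t

/-- The metric `m_h = 2 (h - V) m` on the region `V < h`. -/
def jacobiMetric (S : GyroSystem E) (h : ℝ) (x u v : E) : ℝ :=
  2 * (h - S.V x) * S.m x u v

end GyroSystem

/-! ### Covariant acceleration on an embedded surface -/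

section Surface

variable {E : Type*} [NormedAddCommGroup E] [NormedSpace ℝ E]

/-- `φ`, defined on the open set `U ⊆ ℝ²`, is a local parametrization of the surface `N`. -/
structure IsLocalParametrization (N : Set E) (U : Set (Fin 2 → ℝ)) (φ : (Fin 2 → ℝ) → E) :
    Prop where
  isOpen : IsOpen U
  smooth : ContDiffOn ℝ ∞ φ U
  immersion : ∀ q ∈ U, Function.Injective (fderiv ℝ φ q)
  injOn : Set.InjOn φ U
  open_image : ∀ W ⊆ U, IsOpen W → ∃ O : Set E, IsOpen O ∧ φ '' W = O ∩ N

/-- The `i`-th coordinate vector of the parameter plane. -/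
def coordVec (i : Fin 2) : Fin 2 → ℝ := Pi.single i 1

/-- The matrix `g_{ij} = g(∂_i φ, ∂_j φ)` of the metric `g` in the coordinates given by `φ`. -/
def metricMatrix (g : E → E → E → ℝ) (φ : (Fin 2 → ℝ) → E) (q : Fin 2 → ℝ) :
    Matrix (Fin 2) (Fin 2) ℝ :=
  Matrix.of fun i j => g (φ q) (fderiv ℝ φ q (coordVec i)) (fderiv ℝ φ q (coordVec j))

/-- The Christoffel symbols `Γ^a_{ij} = ½ g^{al} (∂_i g_{jl} + ∂_j g_{il} - ∂_l g_{ij})`. -/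
def christoffel (G : (Fin 2 → ℝ) → Matrix (Fin 2) (Fin 2) ℝ) (q : Fin 2 → ℝ)
    (a i j : Fin 2) : ℝ :=
  (1 / 2) * ∑ l, (G q)⁻¹ a l *
    (fderiv ℝ (fun r => G r j l) q (coordVec i) + fderiv ℝ (fun r => G r i l) q (coordVec j)
      - fderiv ℝ (fun r => G r i j) q (coordVec l))

/-- Coordinates `q̈^a + Γ^a_{ij} q̇^i q̇^j` of the covariant derivative of the velocity of a curve. -/
def coordCovAccel (G : (Fin 2 → ℝ) → Matrix (Fin 2) (Fin 2) ℝ) (q : ℝ → Fin 2 → ℝ) (t : ℝ) :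
    Fin 2 → ℝ :=
  fun a => deriv (deriv q) t a + ∑ i, ∑ j, christoffel G (q t) a i j * deriv q t i * deriv q t j

/-- The tangent vector `a` is the covariant derivative (Levi-Civita connection of the metric `g` on
the surface `N`) of the velocity of the curve `x` at the time `t`, computed in local coordinates. -/
def IsCovAccel (N : Set E) (g : E → E → E → ℝ) (x : ℝ → E) (t : ℝ) (a : E) : Prop :=
  ∃ (U : Set (Fin 2 → ℝ)) (φ : (Fin 2 → ℝ) → E) (q : ℝ → Fin 2 → ℝ),
    IsLocalParametrization N U φ ∧ q t ∈ U ∧ (∀ᶠ s in 𝓝 t, φ (q s) = x s) ∧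
    (∀ᶠ s in 𝓝 t, DifferentiableAt ℝ q s) ∧ DifferentiableAt ℝ (deriv q) t ∧
    a = fderiv ℝ φ (q t) (coordCovAccel (metricMatrix g φ) q t)

end Surface

/-! ### The rigid body with a fixed point -/

/-- Real `3 × 3` matrices. -/
abbrev Mat3 : Type := Matrix (Fin 3) (Fin 3) ℝ

/-- The configuration space `SO(3)` as a submanifold of the space of matrices. -/
def SO3 : Set Mat3 := (Matrix.specialOrthogonalGroup (Fin 3) ℝ : Set Mat3)

/-- The vector of a skew-symmetric matrix. -/
def vee (Ω : Mat3) : Fin 3 → ℝ := ![Ω 2 1, Ω 0 2, Ω 1 0]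

/-- The spin (angular velocity in the body) `f(Q⁻¹ Q̇)`; here `Q⁻¹ = Qᵀ`. -/
def spin (Q A : Mat3) : Fin 3 → ℝ := vee (Qᵀ * A)

/-- The left invariant metric `⟨A, B⟩ = I ω_A · ω_B` with principal moments of inertia `I`. -/
def bodyMetric (I : Fin 3 → ℝ) (Q A B : Mat3) : ℝ :=
  ∑ i, I i * spin Q A i * spin Q B i

/-- The natural system of the rigid body with the potential `V`; there are no gyroscopic forces. -/
def bodySystem (I : Fin 3 → ℝ) (V : Mat3 → ℝ) : GyroSystem Mat3 where
  M := SO3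
  m := bodyMetric I
  V := V
  κ := 0

/-- Rotation by the angle `τ` about the first (vertical) axis of the inertial space. -/
def rot (τ : ℝ) : Mat3 :=
  !![1, 0, 0; 0, Real.cos τ, -Real.sin τ; 0, Real.sin τ, Real.cos τ]

/-- The generating vector field of the action `Q ↦ rot τ * Q`. -/
def genField (Q : Mat3) : Mat3 := deriv (fun τ : ℝ => rot τ * Q) 0

/-- The momentum integral `J(w) = ⟨v, w⟩`. -/
def momentum (I : Fin 3 → ℝ) (p : Mat3 × Mat3) : ℝ :=
  bodyMetric I p.1 (genField p.1) p.2

/-- The level set `J_k ⊆ T(SO(3))` of the momentum. -/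
def momentumLevel (I : Fin 3 → ℝ) (k : ℝ) : Set (Mat3 × Mat3) :=
  {p | p ∈ tangentBundle SO3 ∧ momentum I p = k}

/-- The form `ħ(w) = ⟨v, w⟩ / ⟨v, v⟩` of the connection whose horizontal subspaces are the
orthogonal complements of the orbits. -/
def connectionForm (I : Fin 3 → ℝ) (Q : Mat3) (w : Fin 1 → Mat3) : ℝ :=
  bodyMetric I Q (genField Q) (w 0) / bodyMetric I Q (genField Q) (genField Q)

/-! ### The Poisson sphere and the reduced system -/

/-- The unit sphere in `ℝ³`. -/
def poissonSphere : Set (Fin 3 → ℝ) := {ν | ν ⬝ᵥ ν = 1}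

/-- The projection `p : SO(3) → S²`: the first row of `Q`, that is, the components of the vertical
vector in the axes of the body. As it is linear on matrices, it is also its own tangent map. -/
def poissonMap (Q : Mat3) : Fin 3 → ℝ := Q 0

/-- The map `Tp`, and, restricted to `J_k`, the projection `ρ_k : J_k → T(S²)`. As it is linear, it
is also its own tangent map. -/
def rho (p : Mat3 × Mat3) : (Fin 3 → ℝ) × (Fin 3 → ℝ) := (poissonMap p.1, poissonMap p.2)

/-- `I₁γ₁² + I₂γ₂² + I₃γ₃²`. -/
def inertiaForm (I ν : Fin 3 → ℝ) : ℝ := I 0 * ν 0 ^ 2 + I 1 * ν 1 ^ 2 + I 2 * ν 2 ^ 2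

/-- The explicit reduced metric on the sphere. -/
def reducedMetric (I : Fin 3 → ℝ) (ν a b : Fin 3 → ℝ) : ℝ :=
  I 0 * I 1 * I 2 * (a 0 * b 0 / I 0 + a 1 * b 1 / I 1 + a 2 * b 2 / I 2) / inertiaForm I ν

/-- The explicit amended potential. -/
def amendedPotential (I : Fin 3 → ℝ) (W : (Fin 3 → ℝ) → ℝ) (k : ℝ) (ν : Fin 3 → ℝ) : ℝ :=
  W ν + k ^ 2 / (2 * inertiaForm I ν)

/-- The volume form `γ₁ dγ₂ ∧ dγ₃ + γ₂ dγ₃ ∧ dγ₁ + γ₃ dγ₁ ∧ dγ₂` of the sphere, oriented by the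
outer normal. -/
def sphereVolume (ν : Fin 3 → ℝ) (v : Fin 2 → Fin 3 → ℝ) : ℝ :=
  ν 0 * (v 0 1 * v 1 2 - v 0 2 * v 1 1) + ν 1 * (v 0 2 * v 1 0 - v 0 0 * v 1 2)
    + ν 2 * (v 0 0 * v 1 1 - v 0 1 * v 1 0)

/-- The coefficient of the volume form in the form of gyroscopic forces. -/
def gyroCoeff (I ν : Fin 3 → ℝ) : ℝ :=
  ((I 1 + I 2 - I 0) * I 0 * ν 0 ^ 2 + (I 2 + I 0 - I 1) * I 1 * ν 1 ^ 2
    + (I 0 + I 1 - I 2) * I 2 * ν 2 ^ 2) / inertiaForm I ν ^ 2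

/-- The form `Φ̃` on the sphere. -/
def gyroForm (I : Fin 3 → ℝ) (ν : Fin 3 → ℝ) (v : Fin 2 → Fin 3 → ℝ) : ℝ :=
  gyroCoeff I ν * sphereVolume ν v

/-- The mechanical system with gyroscopic forces `(S², m̃, Ṽ_k, k Φ̃)`. -/
def reducedSystem (I : Fin 3 → ℝ) (W : (Fin 3 → ℝ) → ℝ) (k : ℝ) : GyroSystem (Fin 3 → ℝ) where
  M := poissonSphere
  m := reducedMetric I
  V := amendedPotential I W k
  κ := fun ν v => k * gyroForm I ν v

/-- The geodesic curvature, in the metric `g` on the sphere oriented by the outer normal, of a curve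
with velocity `u` and covariant acceleration `a` at the point `ν`: the oriented `g`-area of the
parallelogram `(u, a)` divided by the cube of the `g`-length of `u` (this does not depend on the
parameter on the oriented curve; it is positive if the curve turns to the left of the geodesic, as
seen from outside the sphere). -/
def geodesicCurvature (g : (Fin 3 → ℝ) → (Fin 3 → ℝ) → (Fin 3 → ℝ) → ℝ) (ν u a : Fin 3 → ℝ) : ℝ :=
  Real.sign (sphereVolume ν ![u, a]) * √(g ν u u * g ν a a - g ν u a ^ 2) / √(g ν u u) ^ 3

end

/-! Everything is computed in the body frame. A tangent vector at `Q` is `Q * hat Ω`, and `Tp` sends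
it to `γ ⨯₃ Ω` (`poissonMap_mul_hat`). The generating field has spin `γ` (`spin_genField`). Hence
the kernel of `Tp` is the vertical line, the momentum is `Iγ · Ω`, and `⟨v, v⟩ = D(γ)`, so a vector
with prescribed momentum is determined by its projection. The formula for the reduced metric is the
Binet–Cauchy identity for the cofactor matrix of `I` (`cofactorForm_cross`): the term subtracted in
it is a product of two momenta, which vanishes on horizontal vectors. The formula `p^*Φ̃ = dħ` is a
polynomial identity in the spins, once `|γ| = 1` has been used.

For the dynamics, both systems are put in weak Euler–Lagrange form (`isDynamicalVector_iff`): the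
base component of `X` is the velocity, and the acceleration satisfies an equation tested against
tangent vectors. On `SO(3)` this is Euler's equation with the torque of `V` (`eulerLagrange_body`).
A tangent vector `b` of the sphere is the projection of a horizontal `Q * hat ξ`; testing the body
equation against that vector and the reduced one against `b = γ ⨯₃ ξ`, the accelerations and the
potential cancel. What remains is `reduction_identity`, valid modulo `Iγ · ξ = 0`.

For the curvature, let `n` be the left normal of the velocity `u`. At energy `h` the conformal
factor `2(h - Ṽ_k)` absorbs the potential force in the normal direction, as in Maupertuis'
principle. The covariant acceleration `a` in the Jacobi metric therefore satisfies `m̃(a, n) = -k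
Φ̃(u, n)` (`sphereVolume_covAccel`). Here `Φ̃(u, n)` is a positive multiple of the coefficient of
`Φ̃`, which the triangle inequalities make positive, so the sign of the curvature is opposite to
that of `k`.

Differential geometry on subsets of a normed space rests on `IsRegularLevel`: an equation bounds the
tangent vectors from above, and a smooth map into `N` realizes them all. This makes the tangent sets
linear, passes to the tangent bundle, and makes exterior derivatives independent of the chosen
extension. -/

/-! ### Tangent vectors, tangent bundles and exterior derivatives on regular level sets -/

section RegularLevel

variable {E F G : Type*} [NormedAddCommGroup E] [NormedSpace ℝ E]
  [NormedAddCommGroup F] [NormedSpace ℝ F] [NormedAddCommGroup G] [NormedSpace ℝ G]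

/-- `N` lies in the zero set of the smooth map `g`, and through each of its points it contains the
image of a smooth map defined on `F` whose derivative covers the kernel of the derivative
of `g`. -/
structure IsRegularLevel (F : Type*) [NormedAddCommGroup F] [NormedSpace ℝ F]
    (g : E → G) (N : Set E) : Prop where
  smooth : ContDiff ℝ ∞ g
  zero : ∀ x ∈ N, g x = 0
  param : ∀ x ∈ N, ∃ φ : F → E, ContDiff ℝ ∞ φ ∧ φ 0 = x ∧ (∀ y, φ y ∈ N) ∧
    ∀ u, fderiv ℝ g x u = 0 → ∃ h, fderiv ℝ φ 0 h = u

theorem isTangent_of_param {N : Set E} {φ : F → E} (hφ : ContDiff ℝ ∞ φ) (hN : ∀ y, φ y ∈ N)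
    (y h : F) : IsTangent N (φ y) (fderiv ℝ φ y h) := by
  refine ⟨fun t : ℝ => φ (y + t • h), by fun_prop, fun t => hN _, by simp, ?_⟩
  have h1 : HasDerivAt (fun t : ℝ => y + t • h) h 0 := by
    simpa using ((hasDerivAt_id (0 : ℝ)).smul_const h).const_add y
  have h2 : HasFDerivAt φ (fderiv ℝ φ y) (y + (0 : ℝ) • h) := by
    simpa using (hφ.differentiable (by simp) y).hasFDerivAt
  exact (h2.comp_hasDerivAt (0 : ℝ) h1).deriv

namespace IsRegularLevel

variable {g : E → G} {N : Set E}

theorem fderiv_eq_zero (H : IsRegularLevel F g N) {x u : E} (hu : IsTangent N x u) :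
    fderiv ℝ g x u = 0 := by
  obtain ⟨c, hc, hcN, rfl, rfl⟩ := hu
  have h1 : HasDerivAt c (deriv c 0) 0 := (hc.differentiable (by simp) 0).hasDerivAt
  have h2 := ((H.smooth.differentiable (by simp) (c 0)).hasFDerivAt).comp_hasDerivAt (0 : ℝ) h1
  have h3 : g ∘ c = fun _ => 0 := funext fun t => H.zero _ (hcN t)
  rw [h3] at h2
  exact h2.unique (hasDerivAt_const _ _)

/-- The definition by curves does not show that tangent vectors form a linear space; as the kernel
of the derivative of `g` they do. -/
theorem isTangent_iff (H : IsRegularLevel F g N) {x u : E} (hx : x ∈ N) :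
    IsTangent N x u ↔ fderiv ℝ g x u = 0 := by
  refine ⟨H.fderiv_eq_zero, fun hu => ?_⟩
  obtain ⟨φ, hφ, rfl, hφN, hφs⟩ := H.param x hx
  obtain ⟨h, rfl⟩ := hφs u hu
  exact isTangent_of_param hφ hφN 0 h

theorem hasFDerivAt_tangent (H : IsRegularLevel F g N) (p : E × E) :
    HasFDerivAt (fun p : E × E => (g p.1, fderiv ℝ g p.1 p.2))
      (((fderiv ℝ g p.1).comp (.fst ℝ E E)).prod
        ((fderiv ℝ g p.1).comp (.snd ℝ E E) +
          ((fderiv ℝ (fderiv ℝ g) p.1).comp (.fst ℝ E E)).flip p.2)) p := by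
  have hg := H.smooth
  have h1 : HasFDerivAt (fun p : E × E => g p.1) ((fderiv ℝ g p.1).comp (.fst ℝ E E)) p :=
    (hg.differentiable (by simp) p.1).hasFDerivAt.comp p hasFDerivAt_fst
  have h2 : HasFDerivAt (fun p : E × E => fderiv ℝ g p.1)
      ((fderiv ℝ (fderiv ℝ g) p.1).comp (.fst ℝ E E)) p :=
    ((hg.fderiv_right (m := ∞) (by simp)).differentiable (by simp)
      p.1).hasFDerivAt.comp p hasFDerivAt_fst
  exact h1.prodMk (h2.clm_apply hasFDerivAt_snd)

/-- The structure is stable under passage to `T(N)`: the tangent map of `φ`, recentred at the fibre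
vector `k` over the given point, serves as the new parametrization. Since the Lagrange form lives on
`T(N)`, its exterior derivative needs this. -/
theorem tangentBundle (H : IsRegularLevel F g N) :
    IsRegularLevel (F × F) (fun p : E × E => (g p.1, fderiv ℝ g p.1 p.2)) (tangentBundle N) where
  smooth := by
    have hg := H.smooth
    have := hg.fderiv_right (m := ∞) (by simp)
    fun_prop
  zero p hp := by
    simp [H.zero _ hp.1, H.fderiv_eq_zero hp.2]
  param := by
    rintro ⟨x, w⟩ ⟨hx, hw⟩
    obtain ⟨φ, hφ, rfl, hφN, hφs⟩ := H.param x hx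
    obtain ⟨k, rfl⟩ := hφs w (H.fderiv_eq_zero hw)
    have hg := H.smooth
    have hdφ := hφ.fderiv_right (m := ∞) (by simp)
    have hdg := hg.fderiv_right (m := ∞) (by simp)
    refine ⟨fun q => (φ q.1, fderiv ℝ φ q.1 (q.2 + k)), by fun_prop, by simp,
      fun q => ⟨hφN _, isTangent_of_param hφ hφN _ _⟩, ?_⟩
    rintro ⟨u, u'⟩ hu
    rw [(H.hasFDerivAt_tangent _).fderiv] at hu
    simp only [ContinuousLinearMap.prod_apply, Prod.mk_eq_zero, ContinuousLinearMap.comp_apply,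
      _root_.add_apply, ContinuousLinearMap.flip_apply,
      ContinuousLinearMap.coe_fst', ContinuousLinearMap.coe_snd'] at hu
    obtain ⟨h, rfl⟩ := hφs u hu.1
    -- The vector `dφ_y k` is tangent at every `y`, so `dg(φ y)(dφ_y k)` vanishes identically; this
    -- is its derivative along `h`.
    have key : fderiv ℝ g (φ 0) (fderiv ℝ (fderiv ℝ φ) 0 h k) +
        fderiv ℝ (fderiv ℝ g) (φ 0) (fderiv ℝ φ 0 h) (fderiv ℝ φ 0 k) = 0 := by
      have h1 : HasFDerivAt (fun y => fderiv ℝ φ y k) ((fderiv ℝ (fderiv ℝ φ) 0).flip k) 0 := by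
        simpa using ((hdφ.differentiable (by simp) 0).hasFDerivAt).clm_apply
          (hasFDerivAt_const k 0)
      have h2 := ((hdg.differentiable (by simp) (φ 0)).hasFDerivAt).comp 0
        (hφ.differentiable (by simp) 0).hasFDerivAt
      have h3 := h2.clm_apply h1
      have h4 : (fun y => (fderiv ℝ g ∘ φ) y (fderiv ℝ φ y k)) = fun _ => 0 :=
        funext fun y => H.fderiv_eq_zero (isTangent_of_param hφ hφN y k)
      rw [h4] at h3
      have h5 := congrArg (fun L => L h) (h3.unique (hasFDerivAt_const _ _))
      simpa using h5
    -- By `key`, the second derivative of `φ` accounts for the Hessian of `g`; the rest of `u'` lies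
    -- in the kernel and is reached by varying the fibre coordinate.
    obtain ⟨l, hl⟩ := hφs (u' - fderiv ℝ (fderiv ℝ φ) 0 h k) (by
      rw [map_sub, sub_eq_zero, eq_neg_of_add_eq_zero_left hu.2, eq_neg_of_add_eq_zero_left key])
    refine ⟨(h, l), ?_⟩
    have h1 : HasFDerivAt (fun q : F × F => φ q.1) ((fderiv ℝ φ 0).comp (.fst ℝ F F)) (0, 0) :=
      (hφ.differentiable (by simp) 0).hasFDerivAt.comp ((0, 0) : F × F) hasFDerivAt_fst
    have h2 : HasFDerivAt (fun q : F × F => fderiv ℝ φ q.1)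
        ((fderiv ℝ (fderiv ℝ φ) 0).comp (.fst ℝ F F)) (0, 0) :=
      (hdφ.differentiable (by simp) 0).hasFDerivAt.comp ((0, 0) : F × F) hasFDerivAt_fst
    have h3 : HasFDerivAt (fun q : F × F => q.2 + k) (.snd ℝ F F) (0, 0) :=
      hasFDerivAt_snd.add_const k
    have h4 := (h1.prodMk (h2.clm_apply h3)).fderiv
    have h5 : (0 : F × F) = (0, 0) := rfl
    rw [h5, h4]
    simp [hl]

/-- Supplies test vectors in `T(T(N))` over every tangent vector of `N`, and a first admissible
acceleration. -/
theorem exists_isTangent_tangentBundle (H : IsRegularLevel F g N) {x w v : E} (hx : x ∈ N)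
    (hw : IsTangent N x w) (hv : IsTangent N x v) :
    ∃ v', IsTangent (_root_.tangentBundle N) (x, w) (v, v') := by
  obtain ⟨φ, hφ, rfl, hφN, hφs⟩ := H.param x hx
  obtain ⟨k, rfl⟩ := hφs w (H.fderiv_eq_zero hw)
  obtain ⟨l, rfl⟩ := hφs v (H.fderiv_eq_zero hv)
  have hdφ := hφ.fderiv_right (m := ∞) (by simp)
  have hΨ : ContDiff ℝ ∞ (fun q : F × F => fderiv ℝ φ q.1 q.2) := by fun_prop
  have h1 : HasFDerivAt (fun q : F × F => φ q.1) ((fderiv ℝ φ 0).comp (.fst ℝ F F)) (0, k) :=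
    (hφ.differentiable (by simp) 0).hasFDerivAt.comp ((0, k) : F × F) hasFDerivAt_fst
  have h2 := h1.prodMk (hΨ.differentiable (by simp) (0, k)).hasFDerivAt
  have h3 := isTangent_of_param (N := _root_.tangentBundle N)
    (φ := fun q : F × F => (φ q.1, fderiv ℝ φ q.1 q.2)) (by fun_prop)
    (fun q => ⟨hφN _, isTangent_of_param hφ hφN _ _⟩) (0, k) (l, 0)
  rw [h2.fderiv] at h3
  exact ⟨_, h3⟩

/-- The restriction to `N` of the exterior derivative of a local extension does not depend on the
extension. -/
theorem hasExtDerivAt_unique (H : IsRegularLevel F g N) {n : ℕ} {α : E → (Fin n → E) → ℝ} {x : E}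
    (hx : x ∈ N) {η η' : (Fin (n + 1) → E) → ℝ} (h : HasExtDerivAt N α x η)
    (h' : HasExtDerivAt N α x η') (v : Fin (n + 1) → E) (hv : ∀ i, IsTangent N x (v i)) :
    η v = η' v := by
  obtain ⟨U, A, ⟨hU, hxU, hA, hAα⟩, hη⟩ := h
  obtain ⟨U', A', ⟨hU', hxU', hA', hAα'⟩, hη'⟩ := h'
  rw [hη v hv, hη' v hv]
  obtain ⟨φ, hφ, rfl, hφN, hφs⟩ := H.param x hx
  choose k hk using fun i => hφs (v i) (H.fderiv_eq_zero (hv i))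
  have hd : DifferentiableAt ℝ A (φ 0) :=
    (hA.contDiffAt (hU.mem_nhds hxU)).differentiableAt (by simp)
  have hd' : DifferentiableAt ℝ A' (φ 0) :=
    (hA'.contDiffAt (hU'.mem_nhds hxU')).differentiableAt (by simp)
  have hr : minSmoothness ℝ 2 ≤ (∞ : WithTop ℕ∞) := by
    rw [minSmoothness_of_isRCLikeNormedField]; exact WithTop.coe_le_coe.2 le_top
  have e := extDeriv_pullback hd (hφ.contDiffAt (x := 0)) hr
  have e' := extDeriv_pullback hd' (hφ.contDiffAt (x := 0)) hr
  -- The extensions may differ off `N` and on non-tangent vectors, but `φ` stays in `N`, so their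
  -- pull-backs agree; the exterior derivative commutes with pull-back.
  have hev : (fun y => (A (φ y)).compContinuousLinearMap (fderiv ℝ φ y)) =ᶠ[𝓝 0]
      fun y => (A' (φ y)).compContinuousLinearMap (fderiv ℝ φ y) := by
    have hc := hφ.continuous.continuousAt (x := 0)
    filter_upwards [hc (hU.mem_nhds hxU), hc (hU'.mem_nhds hxU')] with y hy hy'
    ext l
    simp only [ContinuousAlternatingMap.compContinuousLinearMap_apply]
    have ht : ∀ i, IsTangent N (φ y) ((fderiv ℝ φ y ∘ l) i) :=
      fun i => isTangent_of_param hφ hφN y (l i)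
    rw [hAα _ ⟨hy, hφN y⟩ _ ht, hAα' _ ⟨hy', hφN y⟩ _ ht]
  have e2 := hev.extDeriv_eq
  rw [e, e'] at e2
  have e3 := congrArg (fun L => L k) e2
  simp only [ContinuousAlternatingMap.compContinuousLinearMap_apply] at e3
  have : (fderiv ℝ φ 0) ∘ k = v := funext hk
  rwa [this] at e3

end IsRegularLevel

end RegularLevel

/-! ### From the symplectic equation to the Euler–Lagrange equation -/

section EulerLagrange

variable {E F G : Type*} [NormedAddCommGroup E] [NormedSpace ℝ E]
  [NormedAddCommGroup F] [NormedSpace ℝ F] [NormedAddCommGroup G] [NormedSpace ℝ G]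

theorem HasFDerivAt.comp_fst {f : E → F} {f' : E →L[ℝ] F} {x : E} (h : HasFDerivAt f f' x)
    (w : G) : HasFDerivAt (fun p : E × G => f p.1) (f'.comp (.fst ℝ E G)) (x, w) :=
  HasFDerivAt.comp (x, w) h hasFDerivAt_fst

/-- The metric `m` on `N` is given by a field `A` of symmetric bilinear forms that is smooth on
the open neighbourhood `U` of `N`. -/
structure IsAmbientMetric (N : Set E) (m : E → E → E → ℝ) (A : E → E →L[ℝ] E →L[ℝ] ℝ)
    (U : Set E) : Prop where
  isOpen : IsOpen U
  subset : N ⊆ U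
  smooth : ContDiffOn ℝ ∞ A U
  eq : ∀ x u v, m x u v = A x u v
  symm : ∀ x u v, A x u v = A x v u
  pos : ∀ x ∈ N, ∀ u, IsTangent N x u → u ≠ 0 → 0 < A x u u

namespace IsAmbientMetric

variable {N : Set E} {m : E → E → E → ℝ} {A : E → E →L[ℝ] E →L[ℝ] ℝ} {U : Set E}

theorem contDiffAt (H : IsAmbientMetric N m A U) {x : E} (hx : x ∈ N) : ContDiffAt ℝ ∞ A x :=
  H.smooth.contDiffAt (H.isOpen.mem_nhds (H.subset hx))

theorem differentiableAt (H : IsAmbientMetric N m A U) {x : E} (hx : x ∈ N) :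
    DifferentiableAt ℝ A x :=
  (H.contDiffAt hx).differentiableAt (by simp)

theorem fderiv_symm (H : IsAmbientMetric N m A U) {x : E} (hx : x ∈ N) (u v w : E) :
    fderiv ℝ A x u v w = fderiv ℝ A x u w v := by
  have h : ∀ v w : E, HasFDerivAt (fun y => A y v w)
      (((fderiv ℝ A x).flip v).flip w) x := fun v w => by
    have := ((H.differentiableAt hx).hasFDerivAt.clm_apply (hasFDerivAt_const v x)).clm_apply
      (hasFDerivAt_const w x)
    simpa using this
  have h2 : (fun y => A y v w) = fun y => A y w v := funext fun y => H.symm y v w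
  have h3 := h v w
  rw [h2] at h3
  simpa using congrArg (fun L => L u) (h3.unique (h w v))

theorem isRiemannianMetricOn (H : IsAmbientMetric N m A U) : IsRiemannianMetricOn N m :=
  ⟨fun _ hx => ⟨U, A, H.isOpen, H.subset hx, H.smooth, fun y _ u v _ _ => (H.eq y u v).symm⟩,
    fun x _ u v _ _ => by rw [H.eq, H.eq, H.symm],
    fun x hx u hu hu0 => by rw [H.eq]; exact H.pos x hx u hu hu0⟩

end IsAmbientMetric

/-- The left-hand side of the equations of motion at the point `x`, for the velocity `w` and the
second derivative `a`, tested against `v`. -/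
noncomputable def eulerLagrange (A : E → E →L[ℝ] E →L[ℝ] ℝ) (V : E → ℝ) (K : E [⋀^Fin 2]→L[ℝ] ℝ)
    (x w a v : E) : ℝ :=
  A x a v + fderiv ℝ A x w w v - 1 / 2 * fderiv ℝ A x v w w + K ![w, v] + fderiv ℝ V x v

namespace GyroSystem

variable {S : GyroSystem E} {A : E → E →L[ℝ] E →L[ℝ] ℝ} {U : Set E}

/-- The form `A_x(w, ·)` composed with the first projection extends `θ`, and `dθ(Y₀, Y₁) = Y₀(θ Y₁)
- Y₁(θ Y₀)` for constant fields. -/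
theorem hasExtDerivAt_lagrangeForm (H : IsAmbientMetric S.M S.m A U) {x w : E}
    (hx : x ∈ S.M) :
    HasExtDerivAt (tangentBundle S.M) S.lagrangeForm (x, w) (fun Y =>
      (fderiv ℝ A x (Y 0).1 w (Y 1).1 + A x (Y 0).2 (Y 1).1) -
      (fderiv ℝ A x (Y 1).1 w (Y 0).1 + A x (Y 1).2 (Y 0).1)) := by
  set B : E × E → (E × E) →L[ℝ] ℝ := fun p => (A p.1 p.2).comp (.fst ℝ E E) with hB
  set L := (ContinuousAlternatingMap.ofSubsingletonLIE (𝕜 := ℝ) (E := E × E) (F := ℝ) (0 : Fin 1)) with hL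
  have hsm : ContDiffOn ℝ ∞ B (U ×ˢ Set.univ) := by
    have h1 : ContDiffOn ℝ ∞ (fun p : E × E => A p.1) (U ×ˢ Set.univ) :=
      H.smooth.comp contDiff_fst.contDiffOn (fun p hp => hp.1)
    have h2 : ContDiffOn ℝ ∞ (fun p : E × E => A p.1 p.2) (U ×ˢ Set.univ) :=
      h1.clm_apply contDiff_snd.contDiffOn
    exact h2.clm_comp contDiffOn_const
  have hU : IsOpen (U ×ˢ (Set.univ : Set E)) := H.isOpen.prod isOpen_univ
  have hmem : (x, w) ∈ U ×ˢ (Set.univ : Set E) := ⟨H.subset hx, trivial⟩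
  have hsm' : ContDiffOn ℝ ∞ (fun p => L (B p)) (U ×ˢ Set.univ) :=
    L.toContinuousLinearEquiv.contDiff.comp_contDiffOn hsm
  refine ⟨U ×ˢ Set.univ, fun p => L (B p), ⟨hU, hmem, hsm', ?_⟩, ?_⟩
  · intro p _ v _
    simp only [lagrangeForm, H.eq]
    rfl
  · intro v _
    rw [extDeriv_apply ((hsm'.contDiffAt (hU.mem_nhds hmem)).differentiableAt (by simp))]
    have hder : ∀ Z : E × E, HasFDerivAt (fun p : E × E => A p.1 p.2 Z.1)
        ((((fderiv ℝ A x).comp (.fst ℝ E E)).flip w + (A x).comp (.snd ℝ E E)).flip Z.1)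
          (x, w) := fun Z => by
      have h1 := HasFDerivAt.comp_fst (F := E →L[ℝ] E →L[ℝ] ℝ)
        (H.differentiableAt hx).hasFDerivAt w
      have := (h1.clm_apply hasFDerivAt_snd).clm_apply (hasFDerivAt_const Z.1 (x, w))
      exact this.congr_fderiv (by ext <;> simp [add_comm])
    have e : ∀ i : Fin 2, (fun p => L (B p) (i.removeNth v)) =
        fun p : E × E => A p.1 p.2 ((i.removeNth v) 0).1 := fun i => rfl
    simp only [e, (hder _).fderiv]
    simp [Fin.removeNth]
    ring

theorem hasExtDerivAt_energy (H : IsAmbientMetric S.M S.m A U) {V' : E → ℝ} {O : Set E} {x w : E}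
    (hx : x ∈ S.M) (hO : IsOpen O) (hxO : x ∈ O) (hV' : ContDiffOn ℝ ∞ V' O)
    (hVV' : ∀ y ∈ O ∩ S.M, V' y = S.V y) :
    HasExtDerivAt (tangentBundle S.M) (fun q (_ : Fin 0 → E × E) => S.energy q) (x, w) (fun Y =>
      (fderiv ℝ A x (Y 0).1 w w / 2 + A x w (Y 0).2 + fderiv ℝ V' x (Y 0).1)) := by
  set B : E × E → ℝ := fun p => A p.1 p.2 p.2 / 2 + V' p.1 with hB
  set L := (ContinuousAlternatingMap.constOfIsEmptyLIE ℝ (E × E) ℝ (Fin 0)) with hL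
  have hU : IsOpen ((U ∩ O) ×ˢ (Set.univ : Set E)) := (H.isOpen.inter hO).prod isOpen_univ
  have hmem : (x, w) ∈ (U ∩ O) ×ˢ (Set.univ : Set E) := ⟨⟨H.subset hx, hxO⟩, trivial⟩
  have hsm : ContDiffOn ℝ ∞ B ((U ∩ O) ×ˢ Set.univ) := by
    have h1 : ContDiffOn ℝ ∞ (fun p : E × E => A p.1) ((U ∩ O) ×ˢ Set.univ) :=
      H.smooth.comp contDiff_fst.contDiffOn (fun p hp => hp.1.1)
    have h2 : ContDiffOn ℝ ∞ (fun p : E × E => A p.1 p.2 p.2) ((U ∩ O) ×ˢ Set.univ) :=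
      (h1.clm_apply contDiff_snd.contDiffOn).clm_apply contDiff_snd.contDiffOn
    have h3 : ContDiffOn ℝ ∞ (fun p : E × E => V' p.1) ((U ∩ O) ×ˢ Set.univ) :=
      hV'.comp contDiff_fst.contDiffOn (fun p hp => hp.1.2)
    exact (h2.div_const 2).add h3
  have hsm' : ContDiffOn ℝ ∞ (fun p => L (B p)) ((U ∩ O) ×ˢ Set.univ) :=
    L.toContinuousLinearEquiv.contDiff.comp_contDiffOn hsm
  refine ⟨(U ∩ O) ×ˢ Set.univ, fun p => L (B p), ⟨hU, hmem, hsm', ?_⟩, ?_⟩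
  · intro p hp v _
    simp only [energy, H.eq, ← hVV' p.1 ⟨hp.1.1.2, hp.2.1⟩]
    rfl
  · intro v _
    have hd : HasFDerivAt B ((2⁻¹ : ℝ) • ((A x w).comp (.snd ℝ E E) +
        ((((fderiv ℝ A x).comp (.fst ℝ E E)).flip w + (A x).comp (.snd ℝ E E)).flip w)) +
        (fderiv ℝ V' x).comp (.fst ℝ E E)) (x, w) := by
      have h1 := HasFDerivAt.comp_fst (F := E →L[ℝ] E →L[ℝ] ℝ)
        (H.differentiableAt hx).hasFDerivAt w
      have h2 := ((h1.clm_apply hasFDerivAt_snd).clm_apply hasFDerivAt_snd).const_mul (2⁻¹ : ℝ)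
      have h3 : HasFDerivAt (fun p : E × E => V' p.1) ((fderiv ℝ V' x).comp (.fst ℝ E E)) (x, w) :=
        (((hV'.contDiffAt (hO.mem_nhds hxO)).differentiableAt (by simp)).hasFDerivAt).comp_fst w
      have h4 : B = (fun p : E × E => 2⁻¹ * A p.1 p.2 p.2) + fun p => V' p.1 := by
        ext p; simp [hB]; ring
      rw [h4]
      exact (h2.add h3).congr_fderiv (by ext <;> simp [add_comm])
    have e : extDeriv (fun p => L (B p)) (x, w) = _ := extDeriv_constOfIsEmpty B (x, w)
    rw [e, hd.fderiv]
    simp [H.symm x (v 0).2 w]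
    ring

variable {g : E → G} {V' : E → ℝ} {O : Set E} {x w : E} {K : E [⋀^Fin 2]→L[ℝ] ℝ}

theorem isTangent_tangentBundle_iff {N : Set E} (R : IsRegularLevel F g N) {p X : E × E}
    (hp : p ∈ tangentBundle N) : IsTangent (tangentBundle N) p X ↔
      fderiv ℝ g p.1 X.1 = 0 ∧
        fderiv ℝ g p.1 X.2 + fderiv ℝ (fderiv ℝ g) p.1 X.1 p.2 = 0 := by
  rw [R.tangentBundle.isTangent_iff hp, (R.hasFDerivAt_tangent p).fderiv]
  simp

/-- Vertical test vectors see only the metric and force the base component of `X` to be the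
velocity; after that the fibre components of the test vectors cancel between `dθ` and the energy,
leaving an equation on `M`. -/
theorem isDynamicalVector_iff (R : IsRegularLevel F g S.M) (H : IsAmbientMetric S.M S.m A U)
    (hx : x ∈ S.M) (hw : IsTangent S.M x w)
    (hO : IsOpen O) (hxO : x ∈ O) (hV' : ContDiffOn ℝ ∞ V' O)
    (hVV' : ∀ y ∈ O ∩ S.M, V' y = S.V y) (hK : ∀ v, S.κ x v = K v) {X : E × E} :
    S.IsDynamicalVector (x, w) X ↔ IsTangent (tangentBundle S.M) (x, w) X ∧ X.1 = w ∧
      ∀ v, IsTangent S.M x v → eulerLagrange A V' K x w X.2 v = 0 := by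
  have hp : (x, w) ∈ tangentBundle S.M := ⟨hx, hw⟩
  have hL := hasExtDerivAt_lagrangeForm H (w := w) hx
  have hE := hasExtDerivAt_energy H (w := w) hx hO hxO hV' hVV'
  have step : S.IsDynamicalVector (x, w) X ↔ IsTangent (tangentBundle S.M) (x, w) X ∧
      ∀ Y, IsTangent (tangentBundle S.M) (x, w) Y →
        (fderiv ℝ A x X.1 w Y.1 + A x X.2 Y.1) - (fderiv ℝ A x Y.1 w X.1 + A x Y.2 X.1) +
          K ![X.1, Y.1] = - (fderiv ℝ A x Y.1 w w / 2 + A x w Y.2 + fderiv ℝ V' x Y.1) := by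
    constructor
    · rintro ⟨hX, σ, dH, hσ, hdH, h⟩
      refine ⟨hX, fun Y hY => ?_⟩
      have e1 := R.tangentBundle.hasExtDerivAt_unique hp hσ hL ![X, Y]
        (by intro i; fin_cases i <;> assumption)
      have e2 := R.tangentBundle.hasExtDerivAt_unique hp hdH hE ![Y]
        (by intro i; fin_cases i; assumption)
      have e3 := h Y hY
      rw [e1, e2] at e3
      simpa [hK] using e3
    · rintro ⟨hX, h⟩
      refine ⟨hX, _, _, hL, hE, fun Y hY => ?_⟩
      simpa [hK] using h Y hY
  rw [step]
  refine and_congr_right fun hX => ?_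
  have hX' := (isTangent_tangentBundle_iff R hp).1 hX
  have hsymm := H.symm x
  have hfs := H.fderiv_symm hx
  constructor
  · intro h
    have hXw : X.1 = w := by
      by_contra hne
      have ht : IsTangent S.M x (X.1 - w) := (R.isTangent_iff hx).2 (by
        rw [map_sub, hX'.1, R.fderiv_eq_zero hw, sub_zero])
      -- For this vertical vector the equation reduces to `A x (X.1 - w) (X.1 - w) = 0`, against
      -- positivity.
      have h0 := h (0, X.1 - w) ((isTangent_tangentBundle_iff R hp).2 (by
        simp [R.fderiv_eq_zero ht]))
      have hK0 : K ![X.1, 0] = 0 := K.map_coord_zero 1 rfl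
      have hpos := H.pos x hx _ ht (sub_ne_zero.2 hne)
      simp only [map_zero, _root_.zero_apply, hK0] at h0
      have : A x (X.1 - w) (X.1 - w) = 0 := by
        have e1 := hsymm w (X.1 - w)
        have e2 : A x (X.1 - w) (X.1 - w) = A x (X.1 - w) X.1 - A x (X.1 - w) w :=
          map_sub _ _ _
        linarith
      exact hpos.ne' this
    refine ⟨hXw, fun v hv => ?_⟩
    subst hXw
    obtain ⟨v', hv'⟩ := R.exists_isTangent_tangentBundle hx hw hv
    have h1 := h (v, v') hv'
    simp only at h1
    unfold eulerLagrange
    have e1 := hsymm v' X.1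
    have e2 := hfs X.1 X.1 v
    have e3 := hfs v X.1 X.1
    linarith
  · rintro ⟨rfl, h⟩ Y hY
    have hY' := (isTangent_tangentBundle_iff R hp).1 hY
    have h1 := h Y.1 ((R.isTangent_iff hx).2 hY'.1)
    unfold eulerLagrange at h1
    have e1 := hsymm Y.2 X.1
    linarith

/-- The admissible accelerations form an affine space over the tangent space, and the Euler–Lagrange
expression is affine in the acceleration with linear part the metric. Positive definiteness makes
the metric an isomorphism onto the dual, so exactly one acceleration solves the equation. -/
theorem existsUnique_isDynamicalVector [FiniteDimensional ℝ E]
    (R : IsRegularLevel F g S.M) (H : IsAmbientMetric S.M S.m A U)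
    (hx : x ∈ S.M) (hw : IsTangent S.M x w)
    (hV : IsSmoothForm S.M (fun y (_ : Fin 0 → E) => S.V y)) (hK : ∀ v, S.κ x v = K v) :
    ∃! X, S.IsDynamicalVector (x, w) X := by
  obtain ⟨O, A₀, hO, hxO, hA₀, hVA⟩ := hV x hx
  set V' : E → ℝ := fun y => (ContinuousAlternatingMap.constOfIsEmptyLIE ℝ E ℝ (Fin 0)).symm (A₀ y)
    with hV'def
  have hV' : ContDiffOn ℝ ∞ V' O :=
    (ContinuousAlternatingMap.constOfIsEmptyLIE ℝ E ℝ
      (Fin 0)).symm.toContinuousLinearEquiv.contDiff.comp_contDiffOn hA₀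
  have hVV' : ∀ y ∈ O ∩ S.M, V' y = S.V y := fun y hy => hVA y hy 0 (fun i => i.elim0)
  have key := fun X : E × E => isDynamicalVector_iff (X := X) R H hx hw hO hxO hV' hVV' hK
  simp only [key]
  -- The origin `a₀` of the affine space of admissible accelerations; the unknown becomes the
  -- tangent correction `δ`.
  obtain ⟨a₀, ha₀⟩ := R.exists_isTangent_tangentBundle hx hw hw
  have ha₀' := (isTangent_tangentBundle_iff R ⟨hx, hw⟩).1 ha₀
  set T := LinearMap.ker (fderiv ℝ g x).toLinearMap with hT
  have memT : ∀ v, v ∈ T ↔ IsTangent S.M x v := fun v => (R.isTangent_iff hx).symm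
  set B : T →ₗ[ℝ] Module.Dual ℝ T :=
    ((A x).toLinearMap₁₂.domRestrict₁₂ T T) with hB
  have hBapp : ∀ u v : T, B u v = A x u v := fun u v => rfl
  have hBinj : Function.Injective B := by
    rw [injective_iff_map_eq_zero]
    intro u hu
    by_contra hne
    have := H.pos x hx u ((memT _).1 u.2) (by simpa using hne)
    rw [← hBapp, hu] at this
    exact lt_irrefl _ this
  have hBsurj : Function.Surjective B :=
    (LinearMap.injective_iff_surjective_of_finrank_eq_finrank
      (Subspace.dual_finrank_eq (K := ℝ) (V := T)).symm).1 hBinj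
  set ℓ : E →L[ℝ] ℝ := A x a₀ + fderiv ℝ A x w w - (1 / 2 : ℝ) • ((fderiv ℝ A x).flip w).flip w +
    (ContinuousAlternatingMap.ofSubsingletonLIE (𝕜 := ℝ) (E := E) (F := ℝ) (0 : Fin 1)).symm (K.curryLeft w) +
    fderiv ℝ V' x with hℓ
  have hℓapp : ∀ v, ℓ v = eulerLagrange A V' K x w a₀ v := fun v => by
    have : ![w, v] = Matrix.vecCons w (fun _ => v) := by rw [Matrix.vec_single_eq_const]
    simp [hℓ, eulerLagrange, this]
  have hadd : ∀ δ v, eulerLagrange A V' K x w (a₀ + δ) v =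
      eulerLagrange A V' K x w a₀ v + A x δ v := fun δ v => by
    simp only [eulerLagrange, map_add, _root_.add_apply]; ring
  obtain ⟨δ, hδ⟩ := hBsurj (-(ℓ.toLinearMap.domRestrict T))
  have hδ' : ∀ v, IsTangent S.M x v → A x δ v = - eulerLagrange A V' K x w a₀ v := fun v hv => by
    rw [← hℓapp]
    exact congrArg (fun L => L ⟨v, (memT v).2 hv⟩) hδ
  refine ⟨(w, a₀ + δ), ⟨(isTangent_tangentBundle_iff R ⟨hx, hw⟩).2 ⟨ha₀'.1, ?_⟩, rfl,
    fun v hv => by rw [hadd, hδ' v hv, add_neg_cancel]⟩, ?_⟩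
  · have : fderiv ℝ g x δ = 0 := δ.2
    simpa [this] using ha₀'.2
  · rintro ⟨w', a⟩ ⟨ha, hw', hel⟩
    obtain rfl : w' = w := hw'
    have ha' := ((isTangent_tangentBundle_iff R ⟨hx, hw⟩).1 ha).2
    have hdiff : IsTangent S.M x (a - a₀ - δ) := by
      rw [R.isTangent_iff hx, map_sub, map_sub, show fderiv ℝ g x δ = 0 from δ.2]
      have := ha₀'.2
      simp only at this ha'
      rw [eq_neg_of_add_eq_zero_left this, eq_neg_of_add_eq_zero_left ha']
      simp
    by_contra hne
    have hpos := H.pos x hx _ hdiff (fun h0 => hne (by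
      rw [sub_sub, sub_eq_zero] at h0
      rw [h0]))
    have e1 := hel _ hdiff
    have e2 := hδ' _ hdiff
    have e3 := hadd (a - a₀) (a - a₀ - δ)
    rw [add_sub_cancel] at e3
    have e4 : A x (a - a₀ - δ) (a - a₀ - δ) =
        A x (a - a₀) (a - a₀ - δ) - A x δ (a - a₀ - δ) := by
      rw [map_sub (A x) (a - a₀) (δ : E)]; rfl
    simp only at e1
    linarith

end GyroSystem

end EulerLagrange

/-! ### Entrywise calculus for matrices -/

section MatrixCalculus

variable {E : Type*} [NormedAddCommGroup E] [NormedSpace ℝ E] {m n : Type*}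
  [Fintype m] [Fintype n]

theorem contDiff_matrix {k : WithTop ℕ∞} {f : E → Matrix m n ℝ} :
    ContDiff ℝ k f ↔ ∀ i j, ContDiff ℝ k fun x => f x i j :=
  contDiff_pi.trans (forall_congr' fun _ => contDiff_pi)

theorem contDiff_matrix_apply {k : WithTop ℕ∞} (i : m) (j : n) :
    ContDiff ℝ k fun Q : Matrix m n ℝ => Q i j :=
  contDiff_matrix.1 contDiff_id i j

omit [Fintype m] in
theorem hasDerivAt_matrix {f : ℝ → Matrix m n ℝ} {f' : Matrix m n ℝ} {t : ℝ} :
    HasDerivAt f f' t ↔ ∀ i j, HasDerivAt (fun s => f s i j) (f' i j) t :=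
  hasDerivAt_pi.trans (forall_congr' fun _ => hasDerivAt_pi)

theorem ContDiff.fderiv_apply_eq_of_hasDerivAt {F : Type*} [NormedAddCommGroup F] [NormedSpace ℝ F]
    {φ : F → E} (hφ : ContDiff ℝ ∞ φ) {y h : F} {u : E}
    (hd : HasDerivAt (fun t : ℝ => φ (y + t • h)) u 0) : fderiv ℝ φ y h = u := by
  have h1 : HasDerivAt (fun t : ℝ => y + t • h) h 0 := by
    simpa using ((hasDerivAt_id (0 : ℝ)).smul_const h).const_add y
  have h2 : HasFDerivAt φ (fderiv ℝ φ y) (y + (0 : ℝ) • h) := by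
    simpa using (hφ.differentiable (by simp) y).hasFDerivAt
  exact (h2.comp_hasDerivAt (0 : ℝ) h1).unique hd

end MatrixCalculus

/-! ### The sphere as a regular level set -/

section Sphere

theorem dotProduct_fin_three (a b : Fin 3 → ℝ) : a ⬝ᵥ b = a 0 * b 0 + a 1 * b 1 + a 2 * b 2 := by
  simp [dotProduct, Fin.sum_univ_three]

theorem mem_poissonSphere {ν : Fin 3 → ℝ} :
    ν ∈ poissonSphere ↔ ν 0 ^ 2 + ν 1 ^ 2 + ν 2 ^ 2 = 1 := by
  rw [poissonSphere, Set.mem_ofPred_eq, dotProduct_fin_three]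
  ring_nf

/-- The function whose zero set is the unit sphere. -/
def sphereEq (ν : Fin 3 → ℝ) : ℝ := ν 0 ^ 2 + ν 1 ^ 2 + ν 2 ^ 2 - 1

theorem contDiff_sphereEq : ContDiff ℝ ∞ sphereEq := by
  unfold sphereEq; fun_prop

theorem fderiv_sphereEq (ν u : Fin 3 → ℝ) : fderiv ℝ sphereEq ν u = 2 * (ν ⬝ᵥ u) := by
  have h : ∀ i : Fin 3, HasFDerivAt (fun ν : Fin 3 → ℝ => ν i) (.proj (R := ℝ) i) ν :=
    fun i => hasFDerivAt_apply i ν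
  have := ((((h 0).pow 2).add ((h 1).pow 2)).add ((h 2).pow 2)).sub_const 1
  rw [HasFDerivAt.fderiv (f := sphereEq) this, dotProduct_fin_three]
  simp
  ring

theorem isRegularLevel_poissonSphere : IsRegularLevel (Fin 3 → ℝ) sphereEq poissonSphere where
  smooth := contDiff_sphereEq
  zero x hx := by rw [sphereEq, mem_poissonSphere.1 hx, sub_self]
  param x hx := by
    -- The parametrization is inverse stereographic projection from `-x`, precomposed with the
    -- projection `P` onto the tangent plane so that it is defined on all of the space. Its
    -- derivative at 0 doubles tangent vectors, whence the witness `2⁻¹ • u`.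
    set P : (Fin 3 → ℝ) → Fin 3 → ℝ := fun h => h - (x ⬝ᵥ h) • x with hP
    have hPc : ContDiff ℝ ∞ P := by simp only [hP, dotProduct_fin_three]; fun_prop
    have hPc' : ∀ i, ContDiff ℝ ∞ fun h => P h i := fun i => contDiff_pi.1 hPc i
    have hne : ∀ h, 1 + P h ⬝ᵥ P h ≠ 0 := fun h => by
      rw [dotProduct_fin_three]
      nlinarith [mul_self_nonneg (P h 0), mul_self_nonneg (P h 1), mul_self_nonneg (P h 2)]
    have hsm : ContDiff ℝ ∞ fun h =>
        (1 + P h ⬝ᵥ P h)⁻¹ • ((1 - P h ⬝ᵥ P h) • x + (2 : ℝ) • P h) := by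
      have h1 : ContDiff ℝ ∞ fun h => P h ⬝ᵥ P h := by
        simp only [dotProduct_fin_three]
        have := hPc' 0
        have := hPc' 1
        have := hPc' 2
        fun_prop
      have h2 := (contDiff_const (c := (1 : ℝ))).add h1
      exact (h2.inv hne).smul ((((contDiff_const (c := (1 : ℝ))).sub h1).smul contDiff_const).add
        ((contDiff_const (c := (2 : ℝ))).smul hPc))
    refine ⟨_, hsm, by simp [hP], fun h => ?_, fun u hu => ⟨(2⁻¹ : ℝ) • u, ?_⟩⟩
    · have hx1 : x ⬝ᵥ x = 1 := hx
      have hxP : x ⬝ᵥ P h = 0 := by simp [hP, hx1]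
      have hPx : P h ⬝ᵥ x = 0 := by rw [dotProduct_comm, hxP]
      have := hne h
      simp only [poissonSphere, Set.mem_ofPred_eq, smul_dotProduct, dotProduct_smul,
        add_dotProduct, dotProduct_add, hx1, hxP, hPx, smul_eq_mul]
      field_simp
      ring
    · rw [fderiv_sphereEq] at hu
      have hxu : x ⬝ᵥ u = 0 := by linarith
      apply hsm.fderiv_apply_eq_of_hasDerivAt
      have e : ∀ t : ℝ, P (0 + t • (2⁻¹ : ℝ) • u) = (t * 2⁻¹) • u := fun t => by
        simp [hP, dotProduct_smul, hxu, smul_smul]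
      simp only [e, smul_dotProduct, dotProduct_smul, smul_eq_mul]
      set c := u ⬝ᵥ u
      have d1 : HasDerivAt (fun t : ℝ => t * 2⁻¹ * (t * 2⁻¹ * c)) 0 0 := by
        have := ((hasDerivAt_id (0 : ℝ)).mul_const 2⁻¹).mul
          (((hasDerivAt_id (0 : ℝ)).mul_const 2⁻¹).mul_const c)
        simpa [Pi.mul_def] using this
      have d2 := (d1.const_add 1).inv (by simp)
      have d3 := (d1.const_sub 1).smul_const x
      have d4 := (((hasDerivAt_id (0 : ℝ)).mul_const 2⁻¹).smul_const u).const_smul (2 : ℝ)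
      have := d2.smul (d3.add d4)
      simpa [Pi.smul_def', Pi.inv_def, Pi.add_def] using this

theorem isTangent_poissonSphere_iff {ν u : Fin 3 → ℝ} (hν : ν ∈ poissonSphere) :
    IsTangent poissonSphere ν u ↔ ν 0 * u 0 + ν 1 * u 1 + ν 2 * u 2 = 0 := by
  rw [isRegularLevel_poissonSphere.isTangent_iff hν, fderiv_sphereEq, dotProduct_fin_three]
  simp

end Sphere

/-! ### The rotation group as a regular level set -/

section Rotations

/-- The skew-symmetric matrix of a vector. -/
def hat (a : Fin 3 → ℝ) : Mat3 := !![0, -a 2, a 1; a 2, 0, -a 0; -a 1, a 0, 0]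

theorem vee_hat (a : Fin 3 → ℝ) : vee (hat a) = a := by
  ext i; fin_cases i <;> simp [vee, hat]

theorem hat_zero : hat 0 = 0 := by
  ext i j; fin_cases i <;> fin_cases j <;> simp [hat]

theorem mem_SO3 {Q : Mat3} : Q ∈ SO3 ↔ Qᵀ * Q = 1 ∧ Q.det = 1 := by
  rw [SO3, SetLike.mem_coe, Matrix.mem_specialOrthogonalGroup_iff, Matrix.mem_orthogonalGroup_iff']

theorem mul_transpose_of_mem_SO3 {Q : Mat3} (hQ : Q ∈ SO3) : Q * Qᵀ = 1 :=
  mul_eq_one_comm.1 (mem_SO3.1 hQ).1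

theorem mul_mem_SO3 {Q R : Mat3} (hQ : Q ∈ SO3) (hR : R ∈ SO3) : Q * R ∈ SO3 :=
  (Matrix.specialOrthogonalGroup (Fin 3) ℝ).mul_mem hQ hR

theorem transpose_mem_SO3 {Q : Mat3} (hQ : Q ∈ SO3) : Qᵀ ∈ SO3 :=
  mem_SO3.2 ⟨by rw [Matrix.transpose_transpose, mul_transpose_of_mem_SO3 hQ],
    by rw [Matrix.det_transpose, (mem_SO3.1 hQ).2]⟩

/-- The Cayley parametrization of the rotations. -/
noncomputable def cayley (a : Fin 3 → ℝ) : Mat3 :=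
  (1 + a ⬝ᵥ a)⁻¹ • ((1 - a ⬝ᵥ a) • 1 + (2 : ℝ) • hat a + (2 : ℝ) • Matrix.vecMulVec a a)

theorem cayley_mem_SO3 (a : Fin 3 → ℝ) : cayley a ∈ SO3 := by
  have hne : 1 + (a 0 * a 0 + a 1 * a 1 + a 2 * a 2) ≠ 0 := by
    nlinarith [mul_self_nonneg (a 0), mul_self_nonneg (a 1), mul_self_nonneg (a 2)]
  rw [mem_SO3]
  constructor
  · ext i j
    fin_cases i <;> fin_cases j <;>
      simp [cayley, hat, Matrix.mul_apply, Fin.sum_univ_three, Matrix.vecMulVec_apply,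
        dotProduct_fin_three] <;> field_simp <;> ring
  · simp [cayley, hat, Matrix.det_fin_three, Matrix.vecMulVec_apply,
        dotProduct_fin_three]
    field_simp
    ring

theorem contDiff_cayley : ContDiff ℝ ∞ cayley := by
  rw [contDiff_matrix]
  have h1 : ContDiff ℝ ∞ fun a : Fin 3 → ℝ => (1 + (a 0 * a 0 + a 1 * a 1 + a 2 * a 2))⁻¹ :=
    ContDiff.inv (by fun_prop) fun a => by
      nlinarith [mul_self_nonneg (a 0), mul_self_nonneg (a 1), mul_self_nonneg (a 2)]
  intro i j
  fin_cases i <;> fin_cases j <;>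
    simp [cayley, hat, Matrix.vecMulVec_apply, dotProduct_fin_three] <;> fun_prop

/-- The Cayley parameter is the tangent of half the angle times the axis, so the derivative at 0 is
`2 hat a`; the factor `2⁻¹` compensates for this. -/
theorem hasDerivAt_cayley (a : Fin 3 → ℝ) :
    HasDerivAt (fun t : ℝ => cayley (0 + t • (2⁻¹ : ℝ) • a)) (hat a) 0 := by
  have d0 : HasDerivAt (fun t : ℝ => (t * (t * (a ⬝ᵥ a / 4)))) 0 0 := by
    have := (hasDerivAt_id (0 : ℝ)).mul ((hasDerivAt_id (0 : ℝ)).mul_const (a ⬝ᵥ a / 4))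
    simpa [Pi.mul_def] using this
  have d1 : HasDerivAt (fun t : ℝ => (1 + t * (t * (a ⬝ᵥ a / 4)))⁻¹) 0 0 := by
    simpa [Pi.inv_def] using (d0.const_add 1).inv (by simp)
  refine hasDerivAt_matrix.2 fun i j => ?_
  have d2 := (d0.const_sub 1).mul_const ((1 : Mat3) i j)
  have d3 := (hasDerivAt_id (0 : ℝ)).mul_const (hat a i j)
  have d4 := (hasDerivAt_id (0 : ℝ)).mul ((hasDerivAt_id (0 : ℝ)).mul_const (a i * a j / 2))
  refine ((d1.mul ((d2.add d3).add d4)).congr_deriv (by simp)).congr_of_eventuallyEq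
    (Eventually.of_forall fun t => ?_)
  have e1 : (t • (2⁻¹ : ℝ) • a) ⬝ᵥ (t • (2⁻¹ : ℝ) • a) = t * (t * (a ⬝ᵥ a / 4)) := by
    simp only [smul_dotProduct, dotProduct_smul, smul_eq_mul]; ring
  have e2 : hat (t • (2⁻¹ : ℝ) • a) i j = t * 2⁻¹ * hat a i j := by
    fin_cases i <;> fin_cases j <;> simp [hat, mul_assoc]
  simp only [cayley, zero_add, Matrix.smul_apply, Matrix.add_apply, e1, e2, Matrix.vecMulVec_apply,
    Pi.smul_apply, smul_eq_mul, Pi.mul_apply, Pi.add_apply, id_eq]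
  ring

/-- The equation of the orthogonal matrices. -/
def orthogonalEq (Q : Mat3) : Mat3 := Qᵀ * Q - 1

theorem contDiff_orthogonalEq : ContDiff ℝ ∞ orthogonalEq := by
  rw [contDiff_matrix]
  have h := fun i j => contDiff_matrix_apply (k := ∞) (m := Fin 3) (n := Fin 3) i j
  intro i j
  simp only [orthogonalEq, Matrix.sub_apply, Matrix.mul_apply, Matrix.transpose_apply,
    Fin.sum_univ_three]
  exact (((h _ _).mul (h _ _)).add ((h _ _).mul (h _ _))).add ((h _ _).mul (h _ _))
    |>.sub contDiff_const

theorem hasDerivAt_orthogonalEq (Q A : Mat3) :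
    HasDerivAt (fun t : ℝ => orthogonalEq (Q + t • A)) (Qᵀ * A + Aᵀ * Q) 0 := by
  refine hasDerivAt_matrix.2 fun i j => ?_
  have h3 : ∀ i j, HasDerivAt (fun t : ℝ => Q i j + t * A i j) (A i j) 0 := fun i j => by
    simpa using ((hasDerivAt_id (0 : ℝ)).mul_const (A i j)).const_add (Q i j)
  have h4 := fun k => (h3 k i).mul (h3 k j)
  have := (((h4 0).add (h4 1)).add (h4 2)).sub_const ((1 : Mat3) i j)
  refine (this.congr_deriv ?_).congr_of_eventuallyEq (Eventually.of_forall fun t => ?_)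
  · simp [Matrix.mul_apply, Fin.sum_univ_three]
    ring
  · simp [orthogonalEq, Matrix.mul_apply, Fin.sum_univ_three]

theorem eq_mul_hat {Q A : Mat3} (hQ : Q ∈ SO3) (hA : Qᵀ * A + Aᵀ * Q = 0) :
    A = Q * hat (spin Q A) := by
  have h : hat (spin Q A) = Qᵀ * A := by
    have h1 : Qᵀ * A = -(Qᵀ * A)ᵀ := by
      rw [Matrix.transpose_mul, Matrix.transpose_transpose]
      exact eq_neg_of_add_eq_zero_left hA
    unfold spin
    generalize Qᵀ * A = B at h1 ⊢
    have h2 : ∀ i j, B i j = - B j i := fun i j => congrFun (congrFun h1 i) j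
    ext i j
    have := h2 i j
    have := h2 i i
    fin_cases i <;> fin_cases j <;> simp [hat, vee] at * <;> linarith
  rw [h, ← mul_assoc, mul_transpose_of_mem_SO3 hQ, one_mul]

theorem spin_mul_hat {Q : Mat3} (hQ : Q ∈ SO3) (a : Fin 3 → ℝ) : spin Q (Q * hat a) = a := by
  rw [spin, ← mul_assoc, (mem_SO3.1 hQ).1, one_mul, vee_hat]

/-- The condition on the determinant need not enter the equation: the orthogonality equation already
has the right kernel, and left translates of the Cayley map remain in `SO3`. -/
theorem isRegularLevel_SO3 : IsRegularLevel (Fin 3 → ℝ) orthogonalEq SO3 where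
  smooth := contDiff_orthogonalEq
  zero Q hQ := by rw [orthogonalEq, (mem_SO3.1 hQ).1, sub_self]
  param Q hQ := by
    have hsm : ContDiff ℝ ∞ fun a => Q * cayley a := by
      rw [contDiff_matrix]
      intro i j
      simp only [Matrix.mul_apply, Fin.sum_univ_three]
      have h := fun k => (contDiff_const (c := Q i k)).mul (contDiff_matrix.1 contDiff_cayley k j)
      exact ((h 0).add (h 1)).add (h 2)
    refine ⟨_, hsm, by simp [cayley, hat_zero],
      fun a => mul_mem_SO3 hQ (cayley_mem_SO3 a), fun A hA => ⟨(2⁻¹ : ℝ) • spin Q A, ?_⟩⟩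
    rw [contDiff_orthogonalEq.fderiv_apply_eq_of_hasDerivAt (hasDerivAt_orthogonalEq Q A)] at hA
    apply hsm.fderiv_apply_eq_of_hasDerivAt
    rw [eq_mul_hat hQ hA, spin_mul_hat hQ]
    generalize spin Q A = a
    have hc := hasDerivAt_cayley a
    refine hasDerivAt_matrix.2 fun i j => ?_
    simp only [Matrix.mul_apply, Fin.sum_univ_three]
    have h := fun k => (hasDerivAt_matrix.1 hc k j).const_mul (Q i k)
    exact ((h 0).add (h 1)).add (h 2)

theorem isTangent_SO3_iff {Q A : Mat3} (hQ : Q ∈ SO3) :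
    IsTangent SO3 Q A ↔ ∃ a, A = Q * hat a := by
  rw [isRegularLevel_SO3.isTangent_iff hQ,
    contDiff_orthogonalEq.fderiv_apply_eq_of_hasDerivAt (hasDerivAt_orthogonalEq Q A)]
  refine ⟨fun h => ⟨_, eq_mul_hat hQ h⟩, ?_⟩
  rintro ⟨a, rfl⟩
  rw [Matrix.transpose_mul, ← mul_assoc, (mem_SO3.1 hQ).1, one_mul, mul_assoc, (mem_SO3.1 hQ).1,
    mul_one]
  ext i j
  fin_cases i <;> fin_cases j <;> simp [hat]

end Rotations

/-! ### The projection to the Poisson sphere, its fibres and invariant functions -/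

section Projection

/-- In terms of the spin, `Tp` is the cross product with `γ`. All later computations rest on this.
-/
theorem poissonMap_mul_hat (Q : Mat3) (a : Fin 3 → ℝ) :
    poissonMap (Q * hat a) = poissonMap Q ⨯₃ a := by
  ext i
  fin_cases i <;> simp [poissonMap, hat, Matrix.mul_apply, Fin.sum_univ_three, cross_apply] <;> ring

theorem poissonMap_mem {Q : Mat3} (hQ : Q ∈ SO3) : poissonMap Q ∈ poissonSphere := by
  have h := congrFun (congrFun (mul_transpose_of_mem_SO3 hQ) 0) 0
  simp only [Matrix.mul_apply, Matrix.transpose_apply, Fin.sum_univ_three, Matrix.one_apply_eq] at h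
  rw [mem_poissonSphere, poissonMap]
  linarith

theorem genField_eq (Q : Mat3) : genField Q = hat ![1, 0, 0] * Q := by
  have h : HasDerivAt (fun τ : ℝ => rot τ * Q) (hat ![1, 0, 0] * Q) 0 := by
    have hs := Real.hasDerivAt_sin 0
    have hc := Real.hasDerivAt_cos 0
    rw [Real.cos_zero] at hs
    rw [Real.sin_zero, neg_zero] at hc
    refine hasDerivAt_matrix.2 fun i j => ?_
    fin_cases i
    · simpa [rot, hat, Matrix.mul_apply, Fin.sum_univ_three] using hasDerivAt_const (0 : ℝ) (Q 0 j)
    · have := (hc.mul_const (Q 1 j)).add (hs.neg.mul_const (Q 2 j))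
      simpa [rot, hat, Matrix.mul_apply, Fin.sum_univ_three, Pi.add_def] using this
    · have := (hs.mul_const (Q 1 j)).add (hc.mul_const (Q 2 j))
      simpa [rot, hat, Matrix.mul_apply, Fin.sum_univ_three, Pi.add_def] using this
  exact h.deriv

/-- With determinant 1 the adjugate is the transpose; its first column expresses the first row
through the cofactors. -/
theorem row_zero_of_mem_SO3 {Q : Mat3} (hQ : Q ∈ SO3) : Q 0 = Q 1 ⨯₃ Q 2 := by
  obtain ⟨h1, h2⟩ := mem_SO3.1 hQ
  have h3 : Q.adjugate = Qᵀ := by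
    have := Q.mul_adjugate
    rw [h2, one_smul] at this
    calc Q.adjugate = (Qᵀ * Q) * Q.adjugate := by rw [h1, one_mul]
      _ = Qᵀ := by rw [mul_assoc, this, mul_one]
  rw [Matrix.adjugate_fin_three] at h3
  have h4 := fun i => congrFun (congrFun h3 i) 0
  ext i
  have := h4 i
  fin_cases i <;> simp [cross_apply] at * <;> linarith

/-- Conjugating by `Q` carries the vertical axis to its body components, which form the first row.
-/
theorem spin_genField {Q : Mat3} (hQ : Q ∈ SO3) : spin Q (genField Q) = poissonMap Q := by
  have h : ∀ j, genField Q 0 j = 0 ∧ genField Q 1 j = - Q 2 j ∧ genField Q 2 j = Q 1 j := fun j => by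
    simp only [genField_eq, hat, Matrix.mul_apply, Fin.sum_univ_three]
    simp
  rw [poissonMap, row_zero_of_mem_SO3 hQ]
  ext i
  fin_cases i <;>
    simp [spin, vee, Matrix.mul_apply, Fin.sum_univ_three, cross_apply, h] <;> ring

theorem exists_cos_sin {c s : ℝ} (h : c ^ 2 + s ^ 2 = 1) : ∃ τ, Real.cos τ = c ∧ Real.sin τ = s := by
  have hn : ‖(⟨c, s⟩ : ℂ)‖ = 1 := by
    rw [← sq_eq_sq₀ (norm_nonneg _) zero_le_one, Complex.sq_norm, Complex.normSq_mk]; linarith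
  have h0 : (⟨c, s⟩ : ℂ) ≠ 0 := fun h => by simp [h] at hn
  refine ⟨Complex.arg ⟨c, s⟩, ?_, ?_⟩
  · rw [Complex.cos_arg h0, hn, div_one]
  · rw [Complex.sin_arg, hn, div_one]

theorem eq_rot_of_mem_SO3 {R : Mat3} (hR : R ∈ SO3) (h0 : R 0 = ![1, 0, 0]) : ∃ τ, R = rot τ := by
  have h := row_zero_of_mem_SO3 hR
  have h1 := mul_transpose_of_mem_SO3 hR
  have h2 := fun i j => congrFun (congrFun h1 i) j
  have e0 : R 0 0 = 1 := by simp [h0]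
  have e1 : R 0 1 = 0 := by simp [h0]
  have e2 : R 0 2 = 0 := by simp [h0]
  simp only [Matrix.mul_apply, Fin.sum_univ_three, Matrix.transpose_apply] at h2
  have a01 : R 1 0 = 0 := by simpa [e0, e1, e2] using h2 0 1
  have a02 : R 2 0 = 0 := by simpa [e0, e1, e2] using h2 0 2
  have a11 : R 1 1 * R 1 1 + R 1 2 * R 1 2 = 1 := by simpa [a01] using h2 1 1
  have a12 : R 1 1 * R 2 1 + R 1 2 * R 2 2 = 0 := by simpa [a01] using h2 1 2
  have d0 : 1 = R 1 1 * R 2 2 - R 1 2 * R 2 1 := by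
    simpa [e0, cross_apply] using congrFun h 0
  obtain ⟨τ, hc, hs⟩ := exists_cos_sin (c := R 1 1) (s := - R 1 2) (by linarith)
  have h3 : R 2 1 = - R 1 2 := by
    linear_combination (- R 2 1) * a11 + R 1 1 * a12 + R 1 2 * d0
  have h4 : R 2 2 = R 1 1 := by
    linear_combination (- R 2 2) * a11 + R 1 2 * a12 - R 1 1 * d0
  refine ⟨τ, ?_⟩
  ext i j
  fin_cases i <;> fin_cases j <;> simp [rot, hc, hs, e0, e1, e2, a01, a02, h3, h4]

theorem poissonMap_rot_mul (τ : ℝ) (Q : Mat3) : poissonMap (rot τ * Q) = poissonMap Q := by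
  ext i
  simp [poissonMap, rot, Matrix.mul_apply, Fin.sum_univ_three]

theorem poissonMap_eq_iff {Q Q' : Mat3} (hQ : Q ∈ SO3) (hQ' : Q' ∈ SO3) :
    poissonMap Q = poissonMap Q' ↔ ∃ τ, Q' = rot τ * Q := by
  constructor
  · intro h
    -- Equal first rows mean that the rotation `Q' * Qᵀ` has the same first row as `Q * Qᵀ = 1`, so
    -- it is a rotation about the vertical.
    obtain ⟨τ, hτ⟩ := eq_rot_of_mem_SO3 (mul_mem_SO3 hQ' (transpose_mem_SO3 hQ)) (by
      have h1 := mul_transpose_of_mem_SO3 hQ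
      have h2 : (Q' * Qᵀ) 0 = (Q * Qᵀ) 0 := by
        ext j
        have := fun i => congrFun h i
        simp only [poissonMap] at this
        simp [Matrix.mul_apply, this]
      rw [h2, h1]
      ext j
      fin_cases j
      · exact Matrix.one_apply_eq 0
      · simp
      · simp)
    exact ⟨τ, by rw [← hτ, mul_assoc, (mem_SO3.1 hQ).1, mul_one]⟩
  · rintro ⟨τ, rfl⟩
    rw [poissonMap_rot_mul]

/-- The rotation whose first row is the direction of `x` and whose second row is the direction of
`x × e`. -/
noncomputable def frame (e x : Fin 3 → ℝ) : Mat3 :=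
  let r := (√(x ⬝ᵥ x))⁻¹ • x
  let s := (√((x ⨯₃ e) ⬝ᵥ (x ⨯₃ e)))⁻¹ • (x ⨯₃ e)
  Matrix.of ![r, s, r ⨯₃ s]

theorem dotProduct_self_pos_of_ne_zero {x : Fin 3 → ℝ} (hx : x ≠ 0) : 0 < x ⬝ᵥ x := by
  refine lt_of_le_of_ne ?_ (Ne.symm (dotProduct_self_eq_zero.not.2 hx))
  rw [dotProduct_fin_three]
  nlinarith [mul_self_nonneg (x 0), mul_self_nonneg (x 1), mul_self_nonneg (x 2)]

theorem normalize_dotProduct_self {x : Fin 3 → ℝ} (hx : x ≠ 0) :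
    ((√(x ⬝ᵥ x))⁻¹ • x) ⬝ᵥ ((√(x ⬝ᵥ x))⁻¹ • x) = 1 := by
  have h := dotProduct_self_pos_of_ne_zero hx
  have h1 := Real.sqrt_pos.2 h
  have h2 := Real.sq_sqrt h.le
  simp only [smul_dotProduct, dotProduct_smul, smul_eq_mul]
  field_simp
  linarith

theorem ne_zero_of_cross_ne_zero {x e : Fin 3 → ℝ} (h : x ⨯₃ e ≠ 0) : x ≠ 0 := by
  rintro rfl
  simp at h

theorem of_mem_SO3 {r s : Fin 3 → ℝ} (hr : r ⬝ᵥ r = 1) (hs : s ⬝ᵥ s = 1) (hrs : r ⬝ᵥ s = 0) :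
    (Matrix.of ![r, s, r ⨯₃ s] : Mat3) ∈ SO3 := by
  rw [dotProduct_fin_three] at hr hs hrs
  have hl : (r 1 * s 2 - r 2 * s 1) ^ 2 + (r 2 * s 0 - r 0 * s 2) ^ 2 +
      (r 0 * s 1 - r 1 * s 0) ^ 2 = 1 := by
    linear_combination (s 0 * s 0 + s 1 * s 1 + s 2 * s 2) * hr + hs -
      (r 0 * s 0 + r 1 * s 1 + r 2 * s 2) * hrs
  refine mem_SO3.2 ⟨mul_eq_one_comm.1 ?_, ?_⟩
  · ext i j
    fin_cases i <;> fin_cases j <;>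
      simp [Matrix.mul_apply, Fin.sum_univ_three, cross_apply] <;> linarith
  · simp [Matrix.det_fin_three, cross_apply]
    linarith

theorem frame_mem_SO3 {e x : Fin 3 → ℝ} (h : x ⨯₃ e ≠ 0) : frame e x ∈ SO3 := by
  refine of_mem_SO3 (normalize_dotProduct_self (ne_zero_of_cross_ne_zero h))
    (normalize_dotProduct_self h) ?_
  simp [smul_dotProduct, dotProduct_smul]

theorem poissonMap_frame (e x : Fin 3 → ℝ) :
    poissonMap (frame e x) = (√(x ⬝ᵥ x))⁻¹ • x := rfl

theorem exists_cross_ne_zero {x : Fin 3 → ℝ} (hx : x ≠ 0) : ∃ e, x ⨯₃ e ≠ 0 := by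
  by_contra! h
  have h0 := h ![1, 0, 0]
  have h1 := h ![0, 1, 0]
  apply hx
  have a1 := congrFun h0 1
  have a2 := congrFun h0 2
  have a0 := congrFun h1 2
  simp [cross_apply] at a0 a1 a2
  ext i
  fin_cases i <;> simp [a0, a1, a2]

theorem ne_zero_of_mem_poissonSphere {ν : Fin 3 → ℝ} (hν : ν ∈ poissonSphere) : ν ≠ 0 := by
  rintro rfl
  simp [poissonSphere] at hν

theorem exists_poissonMap_eq {ν : Fin 3 → ℝ} (hν : ν ∈ poissonSphere) :
    ∃ Q ∈ SO3, poissonMap Q = ν := by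
  obtain ⟨e, he⟩ := exists_cross_ne_zero (ne_zero_of_mem_poissonSphere hν)
  refine ⟨frame e ν, frame_mem_SO3 he, ?_⟩
  rw [poissonMap_frame, show ν ⬝ᵥ ν = 1 from hν]
  simp

theorem poissonMap_image : poissonMap '' SO3 = poissonSphere := by
  ext ν
  constructor
  · rintro ⟨Q, hQ, rfl⟩
    exact poissonMap_mem hQ
  · exact exists_poissonMap_eq

theorem contDiffOn_frame (e : Fin 3 → ℝ) : ContDiffOn ℝ ∞ (frame e) {x | x ⨯₃ e ≠ 0} := by
  have hn : ∀ f : (Fin 3 → ℝ) → Fin 3 → ℝ, ContDiff ℝ ∞ f → (∀ x ∈ {x | x ⨯₃ e ≠ 0}, f x ≠ 0) →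
      ∀ i, ContDiffOn ℝ ∞ (fun x => ((√(f x ⬝ᵥ f x))⁻¹ • f x) i) {x | x ⨯₃ e ≠ 0} := by
    intro f hf hf0 i
    have hf' : ∀ i, ContDiff ℝ ∞ fun x => f x i := fun i => contDiff_pi.1 hf i
    have h1 : ContDiff ℝ ∞ fun x => f x ⬝ᵥ f x := by
      simp only [dotProduct_fin_three]
      exact (((hf' 0).mul (hf' 0)).add ((hf' 1).mul (hf' 1))).add ((hf' 2).mul (hf' 2))
    have h2 : ContDiffOn ℝ ∞ (fun x => (√(f x ⬝ᵥ f x))⁻¹) {x | x ⨯₃ e ≠ 0} :=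
      (h1.contDiffOn.sqrt fun x hx => (dotProduct_self_pos_of_ne_zero (hf0 x hx)).ne').inv
        fun x hx => (Real.sqrt_pos.2 (dotProduct_self_pos_of_ne_zero (hf0 x hx))).ne'
    exact h2.mul (hf' i).contDiffOn
  have hr := hn (fun x => x) contDiff_id (fun x hx => ne_zero_of_cross_ne_zero hx)
  have hs := hn (fun x => x ⨯₃ e) (by
    simp only [cross_apply]
    refine contDiff_pi.2 fun i => ?_
    fin_cases i <;> simp <;> fun_prop) (fun x hx => hx)
  refine contDiffOn_pi.2 fun i => contDiffOn_pi.2 fun j => ?_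
  fin_cases i
  · exact hr j
  · exact hs j
  · fin_cases j
    · exact ((hr 1).mul (hs 2)).sub ((hr 2).mul (hs 1))
    · exact ((hr 2).mul (hs 0)).sub ((hr 0).mul (hs 2))
    · exact ((hr 0).mul (hs 1)).sub ((hr 1).mul (hs 0))

/-- An invariant function is the pull-back of a function that is smooth near the sphere. -/
theorem exists_reducedPotential {V : Mat3 → ℝ}
    (hV : IsSmoothForm SO3 (fun Q (_ : Fin 0 → Mat3) => V Q))
    (hsymm : ∀ τ : ℝ, ∀ Q ∈ SO3, V (rot τ * Q) = V Q) :
    ∃ (W : (Fin 3 → ℝ) → ℝ) (U : Set (Fin 3 → ℝ)), IsOpen U ∧ poissonSphere ⊆ U ∧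
      ContDiffOn ℝ ∞ W U ∧ ∀ Q ∈ SO3, V Q = W (poissonMap Q) := by
  classical
  have hsec : ∀ x : Fin 3 → ℝ, x ≠ 0 → ∃ Q ∈ SO3, poissonMap Q = (√(x ⬝ᵥ x))⁻¹ • x :=
    fun x hx => exists_poissonMap_eq (normalize_dotProduct_self hx)
  -- The section `σ` over radial directions is arbitrary and possibly discontinuous. By invariance
  -- `V ∘ σ` equals `V ∘ frame e` wherever `x ⨯₃ e ≠ 0`, and that function is smooth near the
  -- sphere.
  choose! σ hσ hpσ using hsec
  have hinv : ∀ Q ∈ SO3, ∀ Q' ∈ SO3, poissonMap Q = poissonMap Q' → V Q = V Q' := by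
    intro Q hQ Q' hQ' h
    obtain ⟨τ, rfl⟩ := (poissonMap_eq_iff hQ hQ').1 h
    exact (hsymm τ Q hQ).symm
  have hW : ∀ e x, x ⨯₃ e ≠ 0 → V (σ x) = V (frame e x) := fun e x h =>
    have hx := ne_zero_of_cross_ne_zero h
    hinv _ (hσ x hx) _ (frame_mem_SO3 h) ((hpσ x hx).trans (poissonMap_frame e x).symm)
  have hloc : ∀ ν ∈ poissonSphere, ∃ O, IsOpen O ∧ ν ∈ O ∧ ContDiffOn ℝ ∞ (fun x => V (σ x)) O := by
    intro ν hν
    obtain ⟨e, he⟩ := exists_cross_ne_zero (ne_zero_of_mem_poissonSphere hν)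
    obtain ⟨O, A, hO, hνO, hA, hVA⟩ := hV _ (frame_mem_SO3 he)
    have hopen : IsOpen {x : Fin 3 → ℝ | x ⨯₃ e ≠ 0} := by
      refine isOpen_ne_fun ?_ continuous_const
      simp only [cross_apply]
      refine continuous_pi fun i => ?_
      fin_cases i <;> simp <;> fun_prop
    refine ⟨{x | x ⨯₃ e ≠ 0} ∩ frame e ⁻¹' O,
      (contDiffOn_frame e).continuousOn.isOpen_inter_preimage hopen hO, ⟨he, hνO⟩, ?_⟩
    have h1 := (ContinuousAlternatingMap.constOfIsEmptyLIE ℝ Mat3 ℝ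
      (Fin 0)).symm.toContinuousLinearEquiv.contDiff.comp_contDiffOn (n := ∞)
        (hA.comp ((contDiffOn_frame e).mono Set.inter_subset_left) fun x hx => hx.2)
    refine h1.congr fun x hx => ?_
    rw [hW e x hx.1]
    exact (hVA _ ⟨hx.2, frame_mem_SO3 hx.1⟩ 0 fun i => i.elim0).symm
  choose! O hO hνO hWO using hloc
  refine ⟨fun x => V (σ x), ⋃ ν ∈ poissonSphere, O ν, isOpen_biUnion hO,
    fun ν hν => Set.mem_biUnion hν (hνO ν hν), fun x hx => ?_, fun Q hQ => ?_⟩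
  · obtain ⟨ν, hν, hx⟩ := Set.mem_iUnion₂.1 hx
    exact ((hWO ν hν).contDiffAt ((hO ν hν).mem_nhds hx)).contDiffWithinAt
  · have hν := poissonMap_mem hQ
    have hν0 := ne_zero_of_mem_poissonSphere hν
    refine hinv _ hQ _ (hσ _ hν0) ?_
    rw [hpσ _ hν0, show poissonMap Q ⬝ᵥ poissonMap Q = 1 from hν]
    simp

end Projection

/-! ### Smooth families of linear and bilinear forms -/

section LinearCombinations

variable {E F : Type*} [NormedAddCommGroup E] [NormedSpace ℝ E] [NormedAddCommGroup F]
  [NormedSpace ℝ F]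

/-- The continuous linear maps between two normed spaces; for matrices, this selects the instances
that come from the norm. -/
abbrev NormedHom (E F : Type*) [NormedAddCommGroup E] [NormedSpace ℝ E] [NormedAddCommGroup F]
    [NormedSpace ℝ F] : Type _ := E →L[ℝ] F

/-- A linear combination of three linear forms. -/
noncomputable def combination (c : Fin 3 → ℝ) (s : Fin 3 → NormedHom E ℝ) : NormedHom E ℝ :=
  c 0 • s 0 + c 1 • s 1 + c 2 • s 2

theorem combination_apply (c : Fin 3 → ℝ) (s : Fin 3 → NormedHom E ℝ) (x : E) :
    combination c s x = c 0 * s 0 x + c 1 * s 1 x + c 2 * s 2 x := by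
  simp [combination]

theorem ContDiff.combination {c : F → Fin 3 → ℝ} {s : F → Fin 3 → NormedHom E ℝ}
    (hc : ∀ i, ContDiff ℝ ∞ fun y => c y i) (hs : ∀ i, ContDiff ℝ ∞ fun y => s y i) :
    ContDiff ℝ ∞ fun y => combination (c y) (s y) :=
  (((hc 0).smul (hs 0)).add ((hc 1).smul (hs 1))).add ((hc 2).smul (hs 2))

/-- The bilinear form which is a linear combination of the squares of three linear forms. -/
noncomputable def combinationSq (c : Fin 3 → ℝ) (s : Fin 3 → NormedHom E ℝ) :
    NormedHom E (NormedHom E ℝ) :=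
  c 0 • (s 0).smulRight (s 0) + c 1 • (s 1).smulRight (s 1) + c 2 • (s 2).smulRight (s 2)

theorem combinationSq_apply (c : Fin 3 → ℝ) (s : Fin 3 → NormedHom E ℝ) (x y : E) :
    combinationSq c s x y = c 0 * s 0 x * s 0 y + c 1 * s 1 x * s 1 y + c 2 * s 2 x * s 2 y := by
  simp [combinationSq, mul_assoc]

theorem ContDiff.combinationSq {c : Fin 3 → ℝ} {s : F → Fin 3 → NormedHom E ℝ}
    (hs : ∀ i, ContDiff ℝ ∞ fun y => s y i) : ContDiff ℝ ∞ fun y => combinationSq c (s y) := by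
  have h := fun i => contDiff_const (c := c i) |>.smul ((hs i).smulRight (hs i))
  exact ((h 0).add (h 1)).add (h 2)

theorem ContDiffOn.smul_bilin {f : F → ℝ} {t : Set F} (hf : ContDiffOn ℝ ∞ f t)
    (B : NormedHom E (NormedHom E ℝ)) : ContDiffOn ℝ ∞ (fun y => f y • B) t :=
  hf.smul contDiffOn_const

end LinearCombinations

/-! ### The two metrics as smooth ambient fields of bilinear forms -/

section Metrics

/-- The linear form which reads off an entry of a matrix. -/
noncomputable def entryCLM (i j : Fin 3) : NormedHom Mat3 ℝ where
  toFun Q := Q i j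
  map_add' _ _ := rfl
  map_smul' _ _ := rfl
  cont := (contDiff_matrix_apply (k := 0) i j).continuous

/-- The `i`-th component of the spin as a linear form. -/
noncomputable def spinCLM (Q : Mat3) (i : Fin 3) : NormedHom Mat3 ℝ :=
  combination (fun k => Q k (i + 2)) fun k => entryCLM k (i + 1)

/-- Indices are added in `Fin 3`, so `i + 1` and `i + 2` run cyclically and one formula covers the
three components. -/
theorem spin_apply (Q A : Mat3) (i : Fin 3) : spin Q A i =
    Q 0 (i + 2) * A 0 (i + 1) + Q 1 (i + 2) * A 1 (i + 1) + Q 2 (i + 2) * A 2 (i + 1) := by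
  fin_cases i <;> simp [spin, vee, Matrix.mul_apply, Fin.sum_univ_three]

theorem spinCLM_apply (Q A : Mat3) (i : Fin 3) : spinCLM Q i A = spin Q A i := by
  rw [spin_apply, spinCLM, combination_apply]; rfl

theorem contDiff_spinCLM (i : Fin 3) : ContDiff ℝ ∞ fun Q => spinCLM Q i :=
  ContDiff.combination (fun _ => contDiff_matrix_apply _ _) fun _ => contDiff_const

theorem spin_add_left (Q R A : Mat3) (i : Fin 3) : spin (Q + R) A i = spin Q A i + spin R A i := by
  simp only [spin_apply, Matrix.add_apply]; ring

theorem spin_smul_left (t : ℝ) (Q A : Mat3) (i : Fin 3) : spin (t • Q) A i = t * spin Q A i := by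
  simp only [spin_apply, Matrix.smul_apply, smul_eq_mul]; ring

/-- The body metric as a field of continuous bilinear forms. -/
noncomputable def bodyForm (I : Fin 3 → ℝ) (Q : Mat3) : NormedHom Mat3 (NormedHom Mat3 ℝ) :=
  combinationSq I (spinCLM Q)

theorem bodyForm_apply (I : Fin 3 → ℝ) (Q A B : Mat3) : bodyForm I Q A B =
    I 0 * spin Q A 0 * spin Q B 0 + I 1 * spin Q A 1 * spin Q B 1 +
      I 2 * spin Q A 2 * spin Q B 2 := by
  simp only [bodyForm, combinationSq_apply, spinCLM_apply]

theorem bodyMetric_eq (I : Fin 3 → ℝ) (Q A B : Mat3) : bodyMetric I Q A B =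
    I 0 * spin Q A 0 * spin Q B 0 + I 1 * spin Q A 1 * spin Q B 1 +
      I 2 * spin Q A 2 * spin Q B 2 := by
  rw [bodyMetric, Fin.sum_univ_three]

theorem isAmbientMetric_body {I : Fin 3 → ℝ} (hI : ∀ i, 0 < I i) :
    IsAmbientMetric SO3 (bodyMetric I) (bodyForm I) Set.univ where
  isOpen := isOpen_univ
  subset := Set.subset_univ _
  smooth := (ContDiff.combinationSq contDiff_spinCLM).contDiffOn
  eq Q A B := by rw [bodyMetric_eq, bodyForm_apply]
  symm Q A B := by rw [bodyForm_apply, bodyForm_apply]; ring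
  pos Q hQ A hA hA0 := by
    obtain ⟨a, rfl⟩ := (isTangent_SO3_iff hQ).1 hA
    have ha : a ≠ 0 := by
      rintro rfl
      exact hA0 (by rw [hat_zero, mul_zero])
    simp only [bodyForm_apply, spin_mul_hat hQ]
    have h0 := mul_nonneg (hI 0).le (mul_self_nonneg (a 0))
    have h1 := mul_nonneg (hI 1).le (mul_self_nonneg (a 1))
    have h2 := mul_nonneg (hI 2).le (mul_self_nonneg (a 2))
    obtain ⟨i, hi⟩ := Function.ne_iff.1 ha
    have h3 := mul_pos (hI i) (mul_self_pos.2 hi)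
    fin_cases i <;> simp only [Fin.zero_eta, Fin.mk_one, Fin.reduceFinMk] at h3 <;> linarith

theorem inertiaForm_pos {I : Fin 3 → ℝ} (hI : ∀ i, 0 < I i) {ν : Fin 3 → ℝ} (hν : ν ≠ 0) :
    0 < inertiaForm I ν := by
  obtain ⟨i, hi⟩ := Function.ne_iff.1 hν
  have h0 := mul_nonneg (hI 0).le (sq_nonneg (ν 0))
  have h1 := mul_nonneg (hI 1).le (sq_nonneg (ν 1))
  have h2 := mul_nonneg (hI 2).le (sq_nonneg (ν 2))
  have h3 := mul_pos (hI i) (sq_pos_of_ne_zero hi)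
  unfold inertiaForm
  fin_cases i <;> simp only [Fin.zero_eta, Fin.mk_one, Fin.reduceFinMk] at h3 <;> linarith

theorem contDiff_inertiaForm (I : Fin 3 → ℝ) : ContDiff ℝ ∞ (inertiaForm I) := by
  unfold inertiaForm; fun_prop

/-- The form `I₂I₃ a₁b₁ + I₃I₁ a₂b₂ + I₁I₂ a₃b₃`. -/
noncomputable def cofactorForm (I : Fin 3 → ℝ) :
    NormedHom (Fin 3 → ℝ) (NormedHom (Fin 3 → ℝ) ℝ) :=
  combinationSq ![I 1 * I 2, I 0 * I 2, I 0 * I 1] fun i => .proj i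

theorem cofactorForm_apply (I a b : Fin 3 → ℝ) : cofactorForm I a b =
    I 1 * I 2 * (a 0 * b 0) + I 0 * I 2 * (a 1 * b 1) + I 0 * I 1 * (a 2 * b 2) := by
  simp [cofactorForm, combinationSq_apply, mul_assoc]

/-- The reduced metric as a field of continuous bilinear forms. -/
noncomputable def reducedForm (I ν : Fin 3 → ℝ) :
    NormedHom (Fin 3 → ℝ) (NormedHom (Fin 3 → ℝ) ℝ) :=
  (inertiaForm I ν)⁻¹ • cofactorForm I

theorem reducedForm_apply (I ν a b : Fin 3 → ℝ) :
    reducedForm I ν a b = cofactorForm I a b / inertiaForm I ν := by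
  simp [reducedForm, div_eq_inv_mul]

/-- Multiplying `1 / I i` by the product of the moments gives the cofactors of the inertia matrix,
so the only denominator left is `inertiaForm I ν`. -/
theorem reducedMetric_eq {I : Fin 3 → ℝ} (hI : ∀ i, 0 < I i) (ν a b : Fin 3 → ℝ) :
    reducedMetric I ν a b = reducedForm I ν a b := by
  rw [reducedForm_apply, cofactorForm_apply, reducedMetric]
  have h0 := (hI 0).ne'
  have h1 := (hI 1).ne'
  have h2 := (hI 2).ne'
  congr 1
  field_simp

theorem cofactorForm_pos {I : Fin 3 → ℝ} (hI : ∀ i, 0 < I i) {a : Fin 3 → ℝ} (ha : a ≠ 0) :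
    0 < cofactorForm I a a := by
  have h := inertiaForm_pos (I := ![I 1 * I 2, I 0 * I 2, I 0 * I 1]) (fun i => by
    fin_cases i <;> simp [hI]) ha
  rw [cofactorForm_apply]
  simp only [inertiaForm, Matrix.cons_val] at h
  linarith

/-- The set on which the reduced metric is smooth. -/
def regularSet (I : Fin 3 → ℝ) : Set (Fin 3 → ℝ) := {ν | inertiaForm I ν ≠ 0}

theorem isOpen_regularSet (I : Fin 3 → ℝ) : IsOpen (regularSet I) :=
  isOpen_ne_fun (contDiff_inertiaForm I).continuous continuous_const

theorem poissonSphere_subset_regularSet {I : Fin 3 → ℝ} (hI : ∀ i, 0 < I i) :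
    poissonSphere ⊆ regularSet I :=
  fun _ hν => (inertiaForm_pos hI (ne_zero_of_mem_poissonSphere hν)).ne'

theorem isAmbientMetric_reduced {I : Fin 3 → ℝ} (hI : ∀ i, 0 < I i) :
    IsAmbientMetric poissonSphere (reducedMetric I) (reducedForm I) (regularSet I) where
  isOpen := isOpen_regularSet I
  subset := poissonSphere_subset_regularSet hI
  smooth := ((contDiff_inertiaForm I).contDiffOn.inv fun _ h => h).smul_bilin _
  eq := reducedMetric_eq hI
  symm ν a b := by
    rw [reducedForm_apply, reducedForm_apply, cofactorForm_apply, cofactorForm_apply]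
    ring
  pos ν hν a _ ha := by
    rw [reducedForm_apply]
    exact div_pos (cofactorForm_pos hI ha) (inertiaForm_pos hI (ne_zero_of_mem_poissonSphere hν))

end Metrics

/-! ### Lifts with prescribed momentum and the horizontal isometry -/

section Horizontal

theorem momentum_mul_hat {Q : Mat3} (hQ : Q ∈ SO3) (I a : Fin 3 → ℝ) :
    momentum I (Q, Q * hat a) = I 0 * Q 0 0 * a 0 + I 1 * Q 0 1 * a 1 + I 2 * Q 0 2 * a 2 := by
  rw [momentum, bodyMetric_eq]
  simp only [spin_genField hQ, spin_mul_hat hQ, poissonMap]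

theorem bodyMetric_mul_hat {Q : Mat3} (hQ : Q ∈ SO3) (I a b : Fin 3 → ℝ) :
    bodyMetric I Q (Q * hat a) (Q * hat b) = I 0 * a 0 * b 0 + I 1 * a 1 * b 1 + I 2 * a 2 * b 2 := by
  rw [bodyMetric_eq]
  simp only [spin_mul_hat hQ]

theorem bodyMetric_genField {Q : Mat3} (hQ : Q ∈ SO3) (I : Fin 3 → ℝ) :
    bodyMetric I Q (genField Q) (genField Q) = inertiaForm I (poissonMap Q) := by
  rw [bodyMetric_eq]
  simp only [spin_genField hQ, inertiaForm]
  ring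

/-- The spin of the tangent vector with momentum `k` that is mapped to `a`. -/
noncomputable def liftSpin (I : Fin 3 → ℝ) (k : ℝ) (ν a : Fin 3 → ℝ) : Fin 3 → ℝ :=
  a ⨯₃ ν + ((k - (I 0 * ν 0 * (a ⨯₃ ν) 0 + I 1 * ν 1 * (a ⨯₃ ν) 1 + I 2 * ν 2 * (a ⨯₃ ν) 2)) /
    inertiaForm I ν) • ν

/-- For a unit vector `ν` orthogonal to `a` one has `ν × (a × ν) = a`; the multiple of `ν` in
`liftSpin` is invisible here and serves only to adjust the momentum. -/
theorem cross_liftSpin (I : Fin 3 → ℝ) (k : ℝ) {ν a : Fin 3 → ℝ} (hν : ν ∈ poissonSphere)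
    (ha : ν 0 * a 0 + ν 1 * a 1 + ν 2 * a 2 = 0) : ν ⨯₃ liftSpin I k ν a = a := by
  rw [mem_poissonSphere] at hν
  rw [liftSpin, map_add, map_smul, cross_self, smul_zero, add_zero]
  ext i
  fin_cases i <;> simp [cross_apply]
  · linear_combination a 0 * hν - ν 0 * ha
  · linear_combination a 1 * hν - ν 1 * ha
  · linear_combination a 2 * hν - ν 2 * ha

theorem momentum_liftSpin {I : Fin 3 → ℝ} (k : ℝ) {ν a : Fin 3 → ℝ} (h : inertiaForm I ν ≠ 0) :
    I 0 * ν 0 * liftSpin I k ν a 0 + I 1 * ν 1 * liftSpin I k ν a 1 +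
      I 2 * ν 2 * liftSpin I k ν a 2 = k := by
  simp only [liftSpin, Pi.add_apply, Pi.smul_apply, smul_eq_mul]
  set s := I 0 * ν 0 * (a ⨯₃ ν) 0 + I 1 * ν 1 * (a ⨯₃ ν) 1 + I 2 * ν 2 * (a ⨯₃ ν) 2 with hs
  have h1 : (k - s) / inertiaForm I ν * inertiaForm I ν = k - s := div_mul_cancel₀ _ h
  have h2 : inertiaForm I ν = I 0 * ν 0 ^ 2 + I 1 * ν 1 ^ 2 + I 2 * ν 2 ^ 2 := rfl
  generalize (k - s) / inertiaForm I ν = r at h1 ⊢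
  rw [h2] at h1
  linarith

theorem exists_lift {I : Fin 3 → ℝ} (hI : ∀ i, 0 < I i) (k : ℝ) {Q : Mat3} (hQ : Q ∈ SO3)
    {a : Fin 3 → ℝ} (ha : IsTangent poissonSphere (poissonMap Q) a) :
    ∃ w, momentum I (Q, Q * hat w) = k ∧ poissonMap (Q * hat w) = a := by
  have hν := poissonMap_mem hQ
  refine ⟨liftSpin I k (poissonMap Q) a, ?_, ?_⟩
  · rw [momentum_mul_hat hQ]
    exact momentum_liftSpin k (inertiaForm_pos hI (ne_zero_of_mem_poissonSphere hν)).ne'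
  · rw [poissonMap_mul_hat]
    exact cross_liftSpin I k hν ((isTangent_poissonSphere_iff hν).1 ha)

theorem eq_smul_of_cross_eq_zero {ν c : Fin 3 → ℝ} (hν : ν ∈ poissonSphere) (h : ν ⨯₃ c = 0) :
    c = (ν 0 * c 0 + ν 1 * c 1 + ν 2 * c 2) • ν := by
  rw [mem_poissonSphere] at hν
  have h0 := congrFun h 0
  have h1 := congrFun h 1
  have h2 := congrFun h 2
  simp [cross_apply] at h0 h1 h2
  ext i
  fin_cases i <;> simp
  · linear_combination (- c 0) * hν - ν 1 * h2 + ν 2 * h1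
  · linear_combination (- c 1) * hν + ν 0 * h2 - ν 2 * h0
  · linear_combination (- c 2) * hν - ν 0 * h1 + ν 1 * h0

/-- Two lifts differ by a multiple `r` of `γ`, which changes the momentum by `r D(γ)` with `D(γ) >
0`. -/
theorem lift_unique {I : Fin 3 → ℝ} (hI : ∀ i, 0 < I i) {Q : Mat3} (hQ : Q ∈ SO3)
    {a b : Fin 3 → ℝ} (hm : momentum I (Q, Q * hat a) = momentum I (Q, Q * hat b))
    (hp : poissonMap (Q * hat a) = poissonMap (Q * hat b)) : a = b := by
  have hν := poissonMap_mem hQ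
  have hD := inertiaForm_pos hI (ne_zero_of_mem_poissonSphere hν)
  rw [momentum_mul_hat hQ, momentum_mul_hat hQ] at hm
  rw [poissonMap_mul_hat, poissonMap_mul_hat, ← sub_eq_zero, ← map_sub] at hp
  have h := eq_smul_of_cross_eq_zero hν hp
  set r := poissonMap Q 0 * (a - b) 0 + poissonMap Q 1 * (a - b) 1 + poissonMap Q 2 * (a - b) 2
  have h' : ∀ i, a i - b i = r * Q 0 i := fun i => congrFun h i
  have hr : r * inertiaForm I (poissonMap Q) = 0 := by
    simp only [inertiaForm, poissonMap]
    linear_combination hm - I 0 * Q 0 0 * h' 0 - I 1 * Q 0 1 * h' 1 - I 2 * Q 0 2 * h' 2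
  have hr0 : r = 0 := (mul_eq_zero.1 hr).resolve_right hD.ne'
  ext i
  have := h' i
  rw [hr0, zero_mul, sub_eq_zero] at this
  exact this

/-- The cofactor matrix maps `ν × a` to `Iν × Ia`, and Binet–Cauchy expands `(Iν × Ia) · (ν × b)`.
-/
theorem cofactorForm_cross (I ν a b : Fin 3 → ℝ) :
    cofactorForm I (ν ⨯₃ a) (ν ⨯₃ b) =
      inertiaForm I ν * (I 0 * a 0 * b 0 + I 1 * a 1 * b 1 + I 2 * a 2 * b 2) -
      (I 0 * ν 0 * b 0 + I 1 * ν 1 * b 1 + I 2 * ν 2 * b 2) *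
        (I 0 * ν 0 * a 0 + I 1 * ν 1 * a 1 + I 2 * ν 2 * a 2) := by
  rw [cofactorForm_apply, inertiaForm]
  simp [cross_apply]
  ring

/-- The correction in `cofactorForm_cross` is the product of the two momenta, so it vanishes as soon
as one vector is horizontal. -/
theorem reducedMetric_of_horizontal {I : Fin 3 → ℝ} (hI : ∀ i, 0 < I i) {Q : Mat3} (hQ : Q ∈ SO3)
    {w₁ w₂ : Mat3} (h₁ : IsTangent SO3 Q w₁) (h₂ : IsTangent SO3 Q w₂)
    (hm : momentum I (Q, w₂) = 0) :
    reducedMetric I (poissonMap Q) (poissonMap w₁) (poissonMap w₂) = bodyMetric I Q w₁ w₂ := by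
  obtain ⟨a, rfl⟩ := (isTangent_SO3_iff hQ).1 h₁
  obtain ⟨b, rfl⟩ := (isTangent_SO3_iff hQ).1 h₂
  have hD := inertiaForm_pos hI (ne_zero_of_mem_poissonSphere (poissonMap_mem hQ))
  rw [momentum_mul_hat hQ] at hm
  rw [reducedMetric_eq hI, reducedForm_apply, poissonMap_mul_hat, poissonMap_mul_hat,
    cofactorForm_cross, bodyMetric_mul_hat hQ]
  simp only [poissonMap] at *
  rw [hm, zero_mul, sub_zero, mul_div_cancel_left₀ _ hD.ne']

/-- The projection of matrices to their first row, as a continuous linear map. -/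
noncomputable def poissonCLM : NormedHom Mat3 (Fin 3 → ℝ) :=
  ContinuousLinearMap.pi fun j => entryCLM 0 j

theorem IsTangent.map {E F : Type*} [NormedAddCommGroup E] [NormedSpace ℝ E]
    [NormedAddCommGroup F] [NormedSpace ℝ F] {N : Set E} {N' : Set F} (L : E →L[ℝ] F)
    (hL : ∀ x ∈ N, L x ∈ N') {x u : E} (h : IsTangent N x u) : IsTangent N' (L x) (L u) := by
  obtain ⟨c, hc, hcN, rfl, rfl⟩ := h
  refine ⟨fun t => L (c t), L.contDiff.comp hc, fun t => hL _ (hcN t), rfl, ?_⟩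
  exact (L.hasFDerivAt.comp_hasDerivAt (0 : ℝ)
    (hc.differentiable (by simp) 0).hasDerivAt).deriv

theorem isTangent_poissonMap {Q w : Mat3} (h : IsTangent SO3 Q w) :
    IsTangent poissonSphere (poissonMap Q) (poissonMap w) :=
  h.map poissonCLM fun _ hQ => poissonMap_mem hQ

theorem rho_mem {p : Mat3 × Mat3} (hp : p ∈ tangentBundle SO3) :
    rho p ∈ tangentBundle poissonSphere :=
  ⟨poissonMap_mem hp.1, isTangent_poissonMap hp.2⟩

theorem isTangent_rho {p X : Mat3 × Mat3} (h : IsTangent (tangentBundle SO3) p X) :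
    IsTangent (tangentBundle poissonSphere) (rho p) (rho X) :=
  h.map (poissonCLM.prodMap poissonCLM) fun _ hp => rho_mem hp

theorem rho_image {I : Fin 3 → ℝ} (hI : ∀ i, 0 < I i) (k : ℝ) :
    rho '' momentumLevel I k = tangentBundle poissonSphere := by
  ext p
  constructor
  · rintro ⟨q, hq, rfl⟩
    exact rho_mem hq.1
  · rintro ⟨hν, ha⟩
    obtain ⟨Q, hQ, hQν⟩ := exists_poissonMap_eq hν
    rw [← hQν] at ha
    obtain ⟨w, hw, hwa⟩ := exists_lift hI k hQ ha
    exact ⟨(Q, Q * hat w), ⟨⟨hQ, (isTangent_SO3_iff hQ).2 ⟨w, rfl⟩⟩, hw⟩, Prod.ext hQν hwa⟩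

end Horizontal

/-! ### Exterior and directional derivatives of ambient forms -/

section Forms

variable {E F : Type*} [NormedAddCommGroup E] [NormedSpace ℝ E] [NormedAddCommGroup F]
  [NormedSpace ℝ F]

theorem extDeriv_zero {n : ℕ} (x : E) : extDeriv (0 : E → E [⋀^Fin n]→L[ℝ] ℝ) x = 0 := by
  simpa using extDeriv_smul (x := x) (0 : ℝ) (0 : E → E [⋀^Fin n]→L[ℝ] ℝ)

theorem HasExtDerivAt.congr {n : ℕ} {N : Set E} {α : E → (Fin n → E) → ℝ} {x : E}
    {η η' : (Fin (n + 1) → E) → ℝ} (h : HasExtDerivAt N α x η)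
    (he : ∀ v : Fin (n + 1) → E, (∀ i, IsTangent N x (v i)) → η' v = η v) :
    HasExtDerivAt N α x η' := by
  obtain ⟨U, A, hA, hη⟩ := h
  exact ⟨U, A, hA, fun v hv => (he v hv).trans (hη v hv)⟩

theorem hasExtDerivAt_one_form {N : Set E} {α : E → (Fin 1 → E) → ℝ} {x : E} {U : Set E}
    {β : E → NormedHom E ℝ} (hU : IsOpen U) (hx : x ∈ U) (hβ : ContDiffOn ℝ ∞ β U)
    (h : ∀ y ∈ U ∩ N, ∀ v, IsTangent N y (v 0) → β y (v 0) = α y v) :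
    HasExtDerivAt N α x (fun v => fderiv ℝ β x (v 0) (v 1) - fderiv ℝ β x (v 1) (v 0)) := by
  set L := (ContinuousAlternatingMap.ofSubsingletonLIE (𝕜 := ℝ) (E := E) (F := ℝ) (0 : Fin 1))
  have hsm : ContDiffOn ℝ ∞ (fun p => L (β p)) U :=
    L.toContinuousLinearEquiv.contDiff.comp_contDiffOn hβ
  refine ⟨U, fun p => L (β p), ⟨hU, hx, hsm, fun y hy v hv => h y hy v (hv 0)⟩, fun v _ => ?_⟩
  rw [extDeriv_apply ((hsm.contDiffAt (hU.mem_nhds hx)).differentiableAt (by simp))]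
  have hd : DifferentiableAt ℝ β x := (hβ.contDiffAt (hU.mem_nhds hx)).differentiableAt (by simp)
  have hder : ∀ z : E, HasFDerivAt (fun p => β p z) ((fderiv ℝ β x).flip z) x := fun z =>
    (hd.hasFDerivAt.clm_apply (hasFDerivAt_const z x)).congr_fderiv (by ext; simp)
  have e : ∀ i : Fin 2, (fun p => L (β p) (i.removeNth v)) = fun p => β p (i.removeNth v 0) :=
    fun i => rfl
  simp only [e, (hder _).fderiv]
  simp [Fin.removeNth]
  ring

theorem DifferentiableAt.fderiv_apply_of_hasDerivAt {f : E → F} {x u : E} {c : F}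
    (hf : DifferentiableAt ℝ f x) (h : HasDerivAt (fun t : ℝ => f (x + t • u)) c 0) :
    fderiv ℝ f x u = c := by
  have h1 : HasDerivAt (fun t : ℝ => x + t • u) u 0 := by
    simpa using ((hasDerivAt_id (0 : ℝ)).smul_const u).const_add x
  have h2 : HasFDerivAt f (fderiv ℝ f x) (x + (0 : ℝ) • u) := by simpa using hf.hasFDerivAt
  exact (h2.comp_hasDerivAt (0 : ℝ) h1).unique h

theorem fderiv_form_apply {β : E → NormedHom E ℝ} {x u v : E} {c : ℝ} (hβ : DifferentiableAt ℝ β x)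
    (h : HasDerivAt (fun t : ℝ => β (x + t • u) v) c 0) : fderiv ℝ β x u v = c := by
  have h1 : HasFDerivAt (fun p => β p v) ((fderiv ℝ β x).flip v) x :=
    (hβ.hasFDerivAt.clm_apply (hasFDerivAt_const v x)).congr_fderiv (by ext; simp)
  rw [← h1.differentiableAt.fderiv_apply_of_hasDerivAt h, h1.fderiv]
  rfl

theorem fderiv_bilin_apply {A : E → NormedHom E (NormedHom E ℝ)} {x u a b : E} {c : ℝ}
    (hA : DifferentiableAt ℝ A x) (h : HasDerivAt (fun t : ℝ => A (x + t • u) a b) c 0) :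
    fderiv ℝ A x u a b = c := by
  have h1 : HasFDerivAt (fun p => A p a) ((fderiv ℝ A x).flip a) x :=
    (hA.hasFDerivAt.clm_apply (hasFDerivAt_const a x)).congr_fderiv (by ext; simp)
  rw [← fderiv_form_apply h1.differentiableAt h, h1.fderiv]
  rfl

/-- Along a line in the ambient space the body metric, the numerator of the connection form and
`inertiaForm` are all sums of this shape, since the spin is linear in `Q`. -/
theorem hasDerivAt_sum_mul (c p p' q q' : Fin 3 → ℝ) :
    HasDerivAt (fun t : ℝ => c 0 * (p 0 + t * p' 0) * (q 0 + t * q' 0) +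
      c 1 * (p 1 + t * p' 1) * (q 1 + t * q' 1) + c 2 * (p 2 + t * p' 2) * (q 2 + t * q' 2))
      (c 0 * (p' 0 * q 0 + p 0 * q' 0) + c 1 * (p' 1 * q 1 + p 1 * q' 1) +
        c 2 * (p' 2 * q 2 + p 2 * q' 2)) 0 := by
  have h : ∀ a b : ℝ, HasDerivAt (fun t : ℝ => a + t * b) b 0 := fun a b => by
    simpa using ((hasDerivAt_id (0 : ℝ)).mul_const b).const_add a
  have h1 := fun i => ((h (p i) (p' i)).const_mul (c i)).mul (h (q i) (q' i))
  refine (((h1 0).add (h1 1)).add (h1 2)).congr_deriv ?_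
  simp only [zero_mul, add_zero]
  ring

end Forms

/-! ### The curvature of the connection -/

section Connection

/-- The first argument is a tangent vector, not a rotation: this is the derivative of the spin of a
constant matrix along `Q * hat a`. -/
theorem spin_mul_hat_mul_hat {Q : Mat3} (hQ : Q ∈ SO3) (a b : Fin 3 → ℝ) :
    spin (Q * hat a) (Q * hat b) = -![b 2 * a 1, b 0 * a 2, b 1 * a 0] := by
  rw [spin, Matrix.transpose_mul, mul_assoc, ← mul_assoc Qᵀ, (mem_SO3.1 hQ).1, one_mul]
  ext i
  fin_cases i <;> simp [vee, hat, Matrix.mul_apply, Fin.sum_univ_three, mul_comm]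

/-- A smooth extension of the connection form. -/
noncomputable def connectionExt (I : Fin 3 → ℝ) (Q : Mat3) : NormedHom Mat3 ℝ :=
  combination (fun i => (inertiaForm I (poissonMap Q))⁻¹ * (I i * Q 0 i)) (spinCLM Q)

theorem connectionExt_apply (I : Fin 3 → ℝ) (Q A : Mat3) : connectionExt I Q A =
    (I 0 * Q 0 0 * spin Q A 0 + I 1 * Q 0 1 * spin Q A 1 + I 2 * Q 0 2 * spin Q A 2) /
      inertiaForm I (poissonMap Q) := by
  simp only [connectionExt, combination_apply, spinCLM_apply]
  ring

theorem contDiff_poissonMap : ContDiff ℝ ∞ poissonMap := poissonCLM.contDiff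

theorem contDiffOn_connectionExt (I : Fin 3 → ℝ) :
    ContDiffOn ℝ ∞ (connectionExt I) (poissonMap ⁻¹' regularSet I) := by
  have h1 : ContDiffOn ℝ ∞ (fun Q : Mat3 => (inertiaForm I (poissonMap Q))⁻¹)
      (poissonMap ⁻¹' regularSet I) :=
    ((contDiff_inertiaForm I).comp contDiff_poissonMap).contDiffOn.inv fun Q hQ => hQ
  have h2 := fun i => h1.mul (contDiff_const (c := I i) |>.mul
    (contDiff_matrix_apply (k := ∞) (m := Fin 3) (n := Fin 3) 0 i)).contDiffOn
  have h3 := fun i => (h2 i).smul (contDiff_spinCLM i).contDiffOn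
  exact ((h3 0).add (h3 1)).add (h3 2)

theorem isOpen_preimage_regularSet (I : Fin 3 → ℝ) : IsOpen (poissonMap ⁻¹' regularSet I) :=
  (isOpen_regularSet I).preimage contDiff_poissonMap.continuous

theorem hasDerivAt_inertiaForm (I ν u : Fin 3 → ℝ) :
    HasDerivAt (fun t : ℝ => inertiaForm I (ν + t • u))
      (2 * (I 0 * ν 0 * u 0 + I 1 * ν 1 * u 1 + I 2 * ν 2 * u 2)) 0 := by
  refine ((hasDerivAt_sum_mul I ν u ν u).congr_deriv (by ring)).congr_of_eventuallyEq
    (Eventually.of_forall fun t => ?_)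
  simp only [inertiaForm, Pi.add_apply, Pi.smul_apply, smul_eq_mul]
  ring

theorem fderiv_connectionExt {I : Fin 3 → ℝ} {Q : Mat3} (h : Q ∈ poissonMap ⁻¹' regularSet I)
    (u v : Mat3) : fderiv ℝ (connectionExt I) Q u v =
      ((I 0 * (u 0 0 * spin Q v 0 + Q 0 0 * spin u v 0) +
        I 1 * (u 0 1 * spin Q v 1 + Q 0 1 * spin u v 1) +
        I 2 * (u 0 2 * spin Q v 2 + Q 0 2 * spin u v 2)) * inertiaForm I (poissonMap Q) -
      (I 0 * Q 0 0 * spin Q v 0 + I 1 * Q 0 1 * spin Q v 1 + I 2 * Q 0 2 * spin Q v 2) *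
        (2 * (I 0 * Q 0 0 * u 0 0 + I 1 * Q 0 1 * u 0 1 + I 2 * Q 0 2 * u 0 2))) /
        inertiaForm I (poissonMap Q) ^ 2 := by
  apply fderiv_form_apply
    (((contDiffOn_connectionExt I).contDiffAt
      ((isOpen_preimage_regularSet I).mem_nhds h)).differentiableAt (by simp))
  have h1 := hasDerivAt_sum_mul I (Q 0) (u 0) (spin Q v) (spin u v)
  have h2 := hasDerivAt_inertiaForm I (poissonMap Q) (poissonMap u)
  have h3 := h1.div h2 (by rw [zero_smul, add_zero]; exact h)
  refine (h3.congr_deriv ?_).congr_of_eventuallyEq (Eventually.of_forall fun t => ?_)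
  · simp [poissonMap]
  · simp only [connectionExt_apply, spin_add_left, spin_smul_left]
    rfl

/-- Since `(ν × a) × (ν × b) = (ν · (a × b)) ν`, the area of the projections is `|ν|²` times the
determinant of `ν, a, b`. -/
theorem gyroForm_cross {I ν : Fin 3 → ℝ} (hν : ν ∈ poissonSphere) (a b : Fin 3 → ℝ) :
    gyroForm I ν ![ν ⨯₃ a, ν ⨯₃ b] = gyroCoeff I ν *
      (ν 0 * (a 1 * b 2 - a 2 * b 1) + ν 1 * (a 2 * b 0 - a 0 * b 2) +
        ν 2 * (a 0 * b 1 - a 1 * b 0)) := by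
  rw [mem_poissonSphere] at hν
  rw [gyroForm, sphereVolume]
  congr 1
  simp [cross_apply]
  linear_combination (ν 0 * (a 1 * b 2 - a 2 * b 1) + ν 1 * (a 2 * b 0 - a 0 * b 2) +
        ν 2 * (a 0 * b 1 - a 1 * b 0)) * hν

theorem hasExtDerivAt_connectionForm {I : Fin 3 → ℝ} (hI : ∀ i, 0 < I i) {Q : Mat3}
    (hQ : Q ∈ SO3) : HasExtDerivAt SO3 (connectionForm I) Q
      (fun v => gyroForm I (poissonMap Q) (fun i => poissonMap (v i))) := by
  have hmem : ∀ R ∈ SO3, R ∈ poissonMap ⁻¹' regularSet I := fun R hR =>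
    poissonSphere_subset_regularSet hI (poissonMap_mem hR)
  refine (hasExtDerivAt_one_form (isOpen_preimage_regularSet I) (hmem Q hQ)
    (contDiffOn_connectionExt I) fun R hR v _ => ?_).congr fun v hv => ?_
  · rw [connectionExt_apply, connectionForm, bodyMetric_genField hR.2, bodyMetric_eq,
      spin_genField hR.2]
    rfl
  · obtain ⟨a, ha⟩ := (isTangent_SO3_iff hQ).1 (hv 0)
    obtain ⟨b, hb⟩ := (isTangent_SO3_iff hQ).1 (hv 1)
    have e : (fun i => poissonMap (v i)) = ![poissonMap Q ⨯₃ a, poissonMap Q ⨯₃ b] := by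
      ext i
      fin_cases i <;> simp [ha, hb, poissonMap_mul_hat]
    have e' : ∀ c, (Q * hat c) 0 = Q 0 ⨯₃ c := poissonMap_mul_hat Q
    refine Eq.trans ?_ (congrArg₂ (· - ·) (fderiv_connectionExt (hmem Q hQ) (v 0) (v 1))
      (fderiv_connectionExt (hmem Q hQ) (v 1) (v 0))).symm
    rw [e, gyroForm_cross (poissonMap_mem hQ), ha, hb]
    simp only [spin_mul_hat hQ, spin_mul_hat_mul_hat hQ, gyroCoeff, e', ← sub_div]
    rw [div_mul_eq_mul_div]
    -- Both sides now have the denominator `D²`, and the numerators agree as polynomials in the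
    -- first row and the two spins; `|γ| = 1` was used only in `gyroForm_cross`.
    congr 1
    simp [inertiaForm, poissonMap, cross_apply]
    ring

end Connection

/-! ### Both quadruples are mechanical systems -/

section Mechanical

/-- The alternating forms on a normed space; for coordinate spaces, this selects the instances
that come from the norm. -/
abbrev NormedForm (E : Type*) [NormedAddCommGroup E] [NormedSpace ℝ E] (n : ℕ) : Type _ :=
  E [⋀^Fin n]→L[ℝ] ℝ

/-- The determinant of three vectors. -/
noncomputable def detForm : NormedForm (Fin 3 → ℝ) 3 where
  __ := Matrix.detRowAlternating (R := ℝ) (n := Fin 3)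
  cont := by
    change Continuous fun v : Fin 3 → Fin 3 → ℝ => Matrix.det (Matrix.of v)
    simp only [Matrix.det_fin_three, Matrix.of_apply]
    fun_prop

theorem curryLeft_detForm (ν : Fin 3 → ℝ) (v : Fin 2 → Fin 3 → ℝ) :
    detForm.curryLeft ν v = sphereVolume ν v := by
  rw [ContinuousAlternatingMap.curryLeft_apply_apply]
  have e : Matrix.vecCons ν v = ![ν, v 0, v 1] := by ext i; fin_cases i <;> rfl
  change Matrix.det (Matrix.of (Matrix.vecCons ν v)) = _
  rw [e, Matrix.det_fin_three, sphereVolume]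
  simp
  ring

theorem gyroForm_eq (I : Fin 3 → ℝ) (k : ℝ) (ν : Fin 3 → ℝ) (v : Fin 2 → Fin 3 → ℝ) :
    k * gyroForm I ν v = ((k * gyroCoeff I ν) • detForm.curryLeft ν) v := by
  rw [ContinuousAlternatingMap.smul_apply, curryLeft_detForm, gyroForm, smul_eq_mul, mul_assoc]

theorem contDiffOn_gyroCoeff (I : Fin 3 → ℝ) : ContDiffOn ℝ ∞ (gyroCoeff I) (regularSet I) := by
  refine ContDiffOn.div (ContDiff.contDiffOn (by fun_prop))
    ((contDiff_inertiaForm I).pow 2).contDiffOn fun ν hν => pow_ne_zero 2 hν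

theorem ContDiffOn.smul_form {E : Type*} [NormedAddCommGroup E] [NormedSpace ℝ E] {n : ℕ}
    {f : E → ℝ} {t : Set E} (hf : ContDiffOn ℝ ∞ f t) (B : NormedHom E (NormedForm E n)) :
    ContDiffOn ℝ ∞ (fun y => f y • B y) t :=
  hf.smul B.contDiff.contDiffOn

/-- Three vectors orthogonal to `ν` are dependent, so every 3-form vanishes on them; hence every
2-form on the sphere is closed. -/
theorem not_linearIndependent_of_isTangent_poissonSphere {ν : Fin 3 → ℝ} (hν : ν ∈ poissonSphere)
    {v : Fin 3 → Fin 3 → ℝ} (hv : ∀ i, IsTangent poissonSphere ν (v i)) :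
    ¬ LinearIndependent ℝ v := by
  intro h
  have h1 : (Matrix.of v).det = 0 := Matrix.exists_mulVec_eq_zero_iff.1
    ⟨ν, ne_zero_of_mem_poissonSphere hν, by
      ext i
      have := (isTangent_poissonSphere_iff hν).1 (hv i)
      simp only [Matrix.mulVec, dotProduct_fin_three, Matrix.of_apply, Pi.zero_apply]
      linarith⟩
  have h2 : IsUnit (Matrix.of v) := Matrix.linearIndependent_rows_iff_isUnit.1 h
  rw [Matrix.isUnit_iff_isUnit_det, h1] at h2
  simp at h2

variable {I : Fin 3 → ℝ} {V : Mat3 → ℝ} {W : (Fin 3 → ℝ) → ℝ} {U : Set (Fin 3 → ℝ)} {k : ℝ}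

theorem isMechanical_bodySystem (hI : ∀ i, 0 < I i)
    (hV : IsSmoothForm SO3 (fun Q (_ : Fin 0 → Mat3) => V Q)) : (bodySystem I V).IsMechanical := by
  refine ⟨(isAmbientMetric_body hI).isRiemannianMetricOn, hV, fun Q _ => ?_⟩
  refine ⟨Set.univ, 0, ⟨isOpen_univ, trivial, contDiffOn_const, fun _ _ _ _ => rfl⟩, fun v _ => ?_⟩
  rw [extDeriv_zero]
  rfl

theorem isSmoothForm_of_contDiffOn {E : Type*} [NormedAddCommGroup E] [NormedSpace ℝ E]
    {N O : Set E} {f : E → ℝ} (hO : IsOpen O) (hN : N ⊆ O) (hf : ContDiffOn ℝ ∞ f O) :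
    IsSmoothForm N (fun y (_ : Fin 0 → E) => f y) := fun _ hx =>
  ⟨O, fun y => ContinuousAlternatingMap.constOfIsEmptyLIE ℝ E ℝ (Fin 0) (f y), hO, hN hx,
    (ContinuousAlternatingMap.constOfIsEmptyLIE ℝ E ℝ
      (Fin 0)).toContinuousLinearEquiv.contDiff.comp_contDiffOn hf, fun _ _ _ _ => rfl⟩

theorem contDiffOn_amendedPotential (hW : ContDiffOn ℝ ∞ W U) :
    ContDiffOn ℝ ∞ (amendedPotential I W k) (U ∩ regularSet I) :=
  (hW.mono Set.inter_subset_left).add (contDiffOn_const.div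
    (contDiffOn_const.mul (contDiff_inertiaForm I).contDiffOn)
    fun _ hν => mul_ne_zero two_ne_zero hν.2)

theorem isMechanical_reducedSystem (hI : ∀ i, 0 < I i) (hU : IsOpen U) (hSU : poissonSphere ⊆ U)
    (hW : ContDiffOn ℝ ∞ W U) : (reducedSystem I W k).IsMechanical := by
  have hS := poissonSphere_subset_regularSet hI
  refine ⟨(isAmbientMetric_reduced hI).isRiemannianMetricOn,
    isSmoothForm_of_contDiffOn (hU.inter (isOpen_regularSet I)) (Set.subset_inter hSU hS)
      (contDiffOn_amendedPotential hW), fun ν hν => ?_⟩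
  refine ⟨regularSet I, fun ν => (k * gyroCoeff I ν) • detForm.curryLeft ν,
    ⟨isOpen_regularSet I, hS hν, ?_, fun y _ v _ => (gyroForm_eq I k y v).symm⟩, fun v hv => ?_⟩
  · exact (contDiffOn_const.mul (contDiffOn_gyroCoeff I)).smul_form detForm.curryLeft
  · exact ((extDeriv (fun ν => (k * gyroCoeff I ν) • detForm.curryLeft ν)
      ν).toAlternatingMap.map_linearDependent v
        (not_linearIndependent_of_isTangent_poissonSphere hν hv)).symm

end Mechanical

/-! ### Euler's equations of the body -/

section BodyEquations

theorem hasDerivAt_bodyForm (I : Fin 3 → ℝ) (Q u A B : Mat3) :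
    HasDerivAt (fun t : ℝ => bodyForm I (Q + t • u) A B)
      (I 0 * (spin u A 0 * spin Q B 0 + spin Q A 0 * spin u B 0) +
        I 1 * (spin u A 1 * spin Q B 1 + spin Q A 1 * spin u B 1) +
        I 2 * (spin u A 2 * spin Q B 2 + spin Q A 2 * spin u B 2)) 0 := by
  refine (hasDerivAt_sum_mul I (spin Q A) (spin u A) (spin Q B)
    (spin u B)).congr_of_eventuallyEq (Eventually.of_forall fun t => ?_)
  simp only [bodyForm_apply, spin_add_left, spin_smul_left]

/-- This is `Q̈ = Q̇ hat Ω + Q hat Ω̇`, with `α` the angular acceleration. It comes from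
differentiating the tangency relation `Qᵀ Q̇ + Q̇ᵀ Q = 0` along a curve in the tangent bundle. -/
theorem eq_of_isTangent_tangentBundle_SO3 {Q w : Mat3} {X : Mat3 × Mat3} (hQ : Q ∈ SO3)
    (hw : IsTangent SO3 Q w) (hX : IsTangent (tangentBundle SO3) (Q, w) X) (hXw : X.1 = w) :
    ∃ α, X.2 = w * hat (spin Q w) + Q * hat α := by
  obtain ⟨Ω, rfl⟩ := (isTangent_SO3_iff hQ).1 hw
  rw [spin_mul_hat hQ]
  obtain ⟨c, hc, hcN, hc0, hcd⟩ := hX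
  have hd : HasDerivAt c X 0 := hcd ▸ (hc.differentiable (by simp) 0).hasDerivAt
  have h1 : ∀ i j, HasDerivAt (fun t => (c t).1 i j) (X.1 i j) 0 := fun i j =>
    (((entryCLM i j).comp (.fst ℝ Mat3 Mat3)).hasFDerivAt.comp_hasDerivAt (0 : ℝ) hd)
  have h2 : ∀ i j, HasDerivAt (fun t => (c t).2 i j) (X.2 i j) 0 := fun i j =>
    (((entryCLM i j).comp (.snd ℝ Mat3 Mat3)).hasFDerivAt.comp_hasDerivAt (0 : ℝ) hd)
  have hz : ∀ t, ((c t).1)ᵀ * (c t).2 + ((c t).2)ᵀ * (c t).1 = 0 := fun t => by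
    obtain ⟨a, ha⟩ := (isTangent_SO3_iff (hcN t).1).1 (hcN t).2
    rw [ha, Matrix.transpose_mul, ← mul_assoc, (mem_SO3.1 (hcN t).1).1, one_mul, mul_assoc,
      (mem_SO3.1 (hcN t).1).1, mul_one]
    ext i j
    fin_cases i <;> fin_cases j <;> simp [hat]
  have h3 : X.1ᵀ * (Q * hat Ω) + Qᵀ * X.2 + (X.2ᵀ * Q + (Q * hat Ω)ᵀ * X.1) = 0 := by
    ext i j
    have e := fun k => ((h1 k i).mul (h2 k j)).add ((h2 k i).mul (h1 k j))
    have e1 := ((e 0).add (e 1)).add (e 2)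
    have e2 := (e1.congr_of_eventuallyEq (f₁ := fun _ => (0 : ℝ)) (Eventually.of_forall fun t => by
      have := congrFun (congrFun (hz t) i) j
      simp only [Matrix.add_apply, Matrix.mul_apply, Matrix.transpose_apply, Fin.sum_univ_three,
        Matrix.zero_apply] at this
      simp only [Pi.add_apply, Pi.mul_apply]
      linarith)).unique (hasDerivAt_const _ _)
    rw [hc0] at e2
    simp only [Matrix.add_apply, Matrix.mul_apply, Matrix.transpose_apply, Fin.sum_univ_three,
      Matrix.zero_apply] at e2 ⊢
    linarith
  rw [hXw] at h3
  -- Removing the centripetal part `Q (hat Ω)²` turns the differentiated constraint into the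
  -- homogeneous one, whose solutions are tangent.
  have h4 : Qᵀ * (X.2 - Q * hat Ω * hat Ω) + (X.2 - Q * hat Ω * hat Ω)ᵀ * Q = 0 := by
    have e1 : Qᵀ * (Q * hat Ω * hat Ω) = hat Ω * hat Ω := by
      rw [← mul_assoc, ← mul_assoc, (mem_SO3.1 hQ).1, one_mul]
    have e2 : (Q * hat Ω * hat Ω)ᵀ * Q = hat Ω * hat Ω := by
      have : (hat Ω)ᵀ = - hat Ω := by
        ext i j; fin_cases i <;> fin_cases j <;> simp [hat]
      rw [Matrix.transpose_mul, Matrix.transpose_mul, mul_assoc, mul_assoc, (mem_SO3.1 hQ).1,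
        mul_one, this, neg_mul_neg]
    have e3 : (Q * hat Ω)ᵀ * (Q * hat Ω) = - (hat Ω * hat Ω) := by
      have : (hat Ω)ᵀ = - hat Ω := by
        ext i j; fin_cases i <;> fin_cases j <;> simp [hat]
      rw [Matrix.transpose_mul, mul_assoc, ← mul_assoc Qᵀ, (mem_SO3.1 hQ).1, one_mul, this, neg_mul]
    rw [Matrix.mul_sub, Matrix.transpose_sub, Matrix.sub_mul, e1, e2]
    rw [e3] at h3
    rw [← h3]
    abel
  exact ⟨_, sub_eq_iff_eq_add'.1 (eq_mul_hat hQ h4)⟩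

/-- The derivative of a function along a vector; for matrices, this selects the instances that come
from the norm. -/
noncomputable abbrev dirDeriv {E : Type*} [NormedAddCommGroup E] [NormedSpace ℝ E] (f : E → ℝ)
    (x v : E) : ℝ := fderiv ℝ f x v

/-- Equated to zero, this is Euler's equation `Iα = IΩ × Ω` plus the torque of the potential, tested
against the spin `ξ`. -/
theorem eulerLagrange_body {I : Fin 3 → ℝ} (hI : ∀ i, 0 < I i) (V : Mat3 → ℝ) {Q : Mat3}
    (hQ : Q ∈ SO3) (Ω α ξ : Fin 3 → ℝ) :
    eulerLagrange (bodyForm I) V 0 Q (Q * hat Ω) (Q * hat Ω * hat Ω + Q * hat α) (Q * hat ξ) =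
      (I 0 * α 0 * ξ 0 + I 1 * α 1 * ξ 1 + I 2 * α 2 * ξ 2) -
      (I 0 * Ω 0 * (Ω 1 * ξ 2 - Ω 2 * ξ 1) + I 1 * Ω 1 * (Ω 2 * ξ 0 - Ω 0 * ξ 2) +
        I 2 * Ω 2 * (Ω 0 * ξ 1 - Ω 1 * ξ 0)) + dirDeriv V Q (Q * hat ξ) := by
  have hd := (isAmbientMetric_body hI).differentiableAt hQ
  have e : spin Q (Q * hat Ω * hat Ω + Q * hat α) = ![Ω 1 * Ω 2, Ω 2 * Ω 0, Ω 0 * Ω 1] + α := by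
    rw [spin, Matrix.mul_add, ← mul_assoc, ← mul_assoc, ← mul_assoc, (mem_SO3.1 hQ).1, one_mul,
      one_mul]
    ext i
    fin_cases i <;> simp [vee, hat, mul_comm]
  rw [eulerLagrange]
  refine Eq.trans (congrArg₂ (· + ·) (congrArg₂ (· + ·) (congrArg₂ (· - ·) (congrArg₂ (· + ·)
    (bodyForm_apply I Q _ _) (fderiv_bilin_apply hd (hasDerivAt_bodyForm I Q _ _ _)))
    (congrArg (1 / 2 * ·) (fderiv_bilin_apply hd (hasDerivAt_bodyForm I Q _ _ _))))
    (rfl : (0 : NormedForm Mat3 2) ![Q * hat Ω, Q * hat ξ] = 0))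
    (rfl : dirDeriv V Q (Q * hat ξ) = dirDeriv V Q (Q * hat ξ))) ?_
  simp only [e, spin_mul_hat hQ, spin_mul_hat_mul_hat hQ]
  simp
  ring

end BodyEquations

/-! ### The equations on the sphere and the reduction -/

section ReducedEquations

variable {I : Fin 3 → ℝ} {V : Mat3 → ℝ} {W : (Fin 3 → ℝ) → ℝ} {U : Set (Fin 3 → ℝ)} {k : ℝ}

theorem hasDerivAt_reducedForm {ν : Fin 3 → ℝ} (hν : ν ∈ regularSet I) (u a b : Fin 3 → ℝ) :
    HasDerivAt (fun t : ℝ => reducedForm I (ν + t • u) a b)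
      (-(cofactorForm I a b * (2 * (I 0 * ν 0 * u 0 + I 1 * ν 1 * u 1 + I 2 * ν 2 * u 2))) /
        inertiaForm I ν ^ 2) 0 := by
  have h := (hasDerivAt_const (0 : ℝ) (cofactorForm I a b)).div (hasDerivAt_inertiaForm I ν u)
    (by rw [zero_smul, add_zero]; exact hν)
  refine (h.congr_deriv (by simp)).congr_of_eventuallyEq (Eventually.of_forall fun t => ?_)
  exact reducedForm_apply I _ a b

theorem fderiv_amendedPotential (hU : IsOpen U) (hW : ContDiffOn ℝ ∞ W U) {ν : Fin 3 → ℝ}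
    (hνU : ν ∈ U) (hν : ν ∈ regularSet I) (u : Fin 3 → ℝ) :
    fderiv ℝ (amendedPotential I W k) ν u = fderiv ℝ W ν u -
      k ^ 2 * (I 0 * ν 0 * u 0 + I 1 * ν 1 * u 1 + I 2 * ν 2 * u 2) / inertiaForm I ν ^ 2 := by
  have hd : DifferentiableAt ℝ (amendedPotential I W k) ν :=
    ((contDiffOn_amendedPotential hW).contDiffAt
      ((hU.inter (isOpen_regularSet I)).mem_nhds ⟨hνU, hν⟩)).differentiableAt (by simp)
  have hdW : DifferentiableAt ℝ W ν := (hW.contDiffAt (hU.mem_nhds hνU)).differentiableAt (by simp)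
  have hν' : inertiaForm I ν ≠ 0 := hν
  apply hd.fderiv_apply_of_hasDerivAt
  have h1 : HasDerivAt (fun t : ℝ => W (ν + t • u)) (fderiv ℝ W ν u) 0 := by
    have h1 : HasDerivAt (fun t : ℝ => ν + t • u) u 0 := by
      simpa using ((hasDerivAt_id (0 : ℝ)).smul_const u).const_add ν
    exact HasFDerivAt.comp_hasDerivAt (0 : ℝ) (by simpa using hdW.hasFDerivAt) h1
  have h2 := (hasDerivAt_const (0 : ℝ) (k ^ 2)).div ((hasDerivAt_inertiaForm I ν u).const_mul 2)
    (by rw [zero_smul, add_zero]; exact mul_ne_zero two_ne_zero hν)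
  refine (h1.add h2).congr_deriv ?_
  rw [zero_smul, add_zero]
  field_simp
  ring

/-- The two-form of gyroscopic forces as a form on the ambient space. -/
noncomputable def gyroExt (I : Fin 3 → ℝ) (k : ℝ) (ν : Fin 3 → ℝ) : NormedForm (Fin 3 → ℝ) 2 :=
  (k * gyroCoeff I ν) • detForm.curryLeft ν

theorem gyroExt_apply (I : Fin 3 → ℝ) (k : ℝ) (ν : Fin 3 → ℝ) (v : Fin 2 → Fin 3 → ℝ) :
    gyroExt I k ν v = k * gyroForm I ν v := (gyroForm_eq I k ν v).symm

theorem eulerLagrange_reduced (hI : ∀ i, 0 < I i) (hU : IsOpen U) (hSU : poissonSphere ⊆ U)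
    (hW : ContDiffOn ℝ ∞ W U) {ν : Fin 3 → ℝ} (hν : ν ∈ poissonSphere) (w a b : Fin 3 → ℝ) :
    eulerLagrange (reducedForm I) (amendedPotential I W k) (gyroExt I k ν) ν w a b =
      cofactorForm I a b / inertiaForm I ν +
      -(cofactorForm I w b * (2 * (I 0 * ν 0 * w 0 + I 1 * ν 1 * w 1 + I 2 * ν 2 * w 2))) /
        inertiaForm I ν ^ 2 -
      1 / 2 * (-(cofactorForm I w w *
        (2 * (I 0 * ν 0 * b 0 + I 1 * ν 1 * b 1 + I 2 * ν 2 * b 2))) / inertiaForm I ν ^ 2) +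
      k * gyroForm I ν ![w, b] + (fderiv ℝ W ν b -
        k ^ 2 * (I 0 * ν 0 * b 0 + I 1 * ν 1 * b 1 + I 2 * ν 2 * b 2) / inertiaForm I ν ^ 2) := by
  have hd := (isAmbientMetric_reduced hI).differentiableAt hν
  have hr := poissonSphere_subset_regularSet hI hν
  exact congrArg₂ (· + ·) (congrArg₂ (· + ·) (congrArg₂ (· - ·) (congrArg₂ (· + ·)
    (reducedForm_apply I ν a b) (fderiv_bilin_apply hd (hasDerivAt_reducedForm hr _ _ _)))
    (congrArg (1 / 2 * ·) (fderiv_bilin_apply hd (hasDerivAt_reducedForm hr _ _ _))))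
    (gyroExt_apply I k ν _)) (fderiv_amendedPotential hU hW (hSU hν) hr b)

theorem isDynamicalVector_reducedSystem_iff (hI : ∀ i, 0 < I i) (hU : IsOpen U)
    (hSU : poissonSphere ⊆ U) (hW : ContDiffOn ℝ ∞ W U) {ν w : Fin 3 → ℝ}
    (hν : ν ∈ poissonSphere) (hw : IsTangent poissonSphere ν w)
    {X : (Fin 3 → ℝ) × (Fin 3 → ℝ)} :
    (reducedSystem I W k).IsDynamicalVector (ν, w) X ↔
      IsTangent (tangentBundle poissonSphere) (ν, w) X ∧ X.1 = w ∧
      ∀ b, IsTangent poissonSphere ν b → eulerLagrange (reducedForm I) (amendedPotential I W k)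
        (gyroExt I k ν) ν w X.2 b = 0 :=
  GyroSystem.isDynamicalVector_iff (S := reducedSystem I W k) isRegularLevel_poissonSphere
    (isAmbientMetric_reduced hI) hν hw (hU.inter (isOpen_regularSet I))
    ⟨hSU hν, poissonSphere_subset_regularSet hI hν⟩ (contDiffOn_amendedPotential hW)
    (fun _ _ => rfl) fun v => (gyroExt_apply I k ν v).symm

/-- The extension `V'` and `W ∘ p` need to agree only on `SO3`, so they are compared along a curve
in `SO3`. -/
theorem fderiv_eq_fderiv_poissonMap {O : Set Mat3} {V' : Mat3 → ℝ} {Q v : Mat3} (hO : IsOpen O)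
    (hQO : Q ∈ O) (hV' : ContDiffOn ℝ ∞ V' O) (hU : IsOpen U) (hSU : poissonSphere ⊆ U)
    (hW : ContDiffOn ℝ ∞ W U) (hVW : ∀ R ∈ O ∩ SO3, V' R = W (poissonMap R)) (hQ : Q ∈ SO3)
    (hv : IsTangent SO3 Q v) : fderiv ℝ V' Q v = fderiv ℝ W (poissonMap Q) (poissonMap v) := by
  obtain ⟨c, hc, hcN, rfl, rfl⟩ := hv
  have hd := (hc.differentiable (by simp) 0).hasDerivAt
  have h1 := ((hV'.contDiffAt (hO.mem_nhds hQO)).differentiableAt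
    (by simp)).hasFDerivAt.comp_hasDerivAt (0 : ℝ) hd
  have h2 := poissonCLM.hasFDerivAt.comp_hasDerivAt (0 : ℝ) hd
  have h3 := ((hW.contDiffAt (hU.mem_nhds (hSU (poissonMap_mem hQ)))).differentiableAt
    (by simp)).hasFDerivAt.comp_hasDerivAt (0 : ℝ) h2
  refine h1.unique (h3.congr_of_eventuallyEq ?_)
  filter_upwards [hc.continuous.continuousAt (hO.mem_nhds hQO)] with t ht
  exact hVW _ ⟨ht, hcN t⟩

/-- This is `D²` times the difference of the reduced and the body equations, after the angular
acceleration and the potential have cancelled and with `k` written as `Iν · Ω`. The long factor in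
the proof is the quotient of the left side by the momentum of `ξ`. -/
theorem reduction_identity (I ν Ω ξ : Fin 3 → ℝ)
    (h : I 0 * ν 0 * ξ 0 + I 1 * ν 1 * ξ 1 + I 2 * ν 2 * ξ 2 = 0) :
    inertiaForm I ν * cofactorForm I ((ν ⨯₃ Ω) ⨯₃ Ω) (ν ⨯₃ ξ) + inertiaForm I ν ^ 2 *
      (I 0 * Ω 0 * (Ω 1 * ξ 2 - Ω 2 * ξ 1) + I 1 * Ω 1 * (Ω 2 * ξ 0 - Ω 0 * ξ 2) +
        I 2 * Ω 2 * (Ω 0 * ξ 1 - Ω 1 * ξ 0)) -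
      2 * (I 0 * ν 0 * (ν ⨯₃ Ω) 0 + I 1 * ν 1 * (ν ⨯₃ Ω) 1 + I 2 * ν 2 * (ν ⨯₃ Ω) 2) *
        cofactorForm I (ν ⨯₃ Ω) (ν ⨯₃ ξ) +
      (I 0 * ν 0 * (ν ⨯₃ ξ) 0 + I 1 * ν 1 * (ν ⨯₃ ξ) 1 + I 2 * ν 2 * (ν ⨯₃ ξ) 2) *
        cofactorForm I (ν ⨯₃ Ω) (ν ⨯₃ Ω) +
      (I 0 * ν 0 * Ω 0 + I 1 * ν 1 * Ω 1 + I 2 * ν 2 * Ω 2) *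
        ((I 1 + I 2 - I 0) * I 0 * ν 0 ^ 2 + (I 2 + I 0 - I 1) * I 1 * ν 1 ^ 2
          + (I 0 + I 1 - I 2) * I 2 * ν 2 ^ 2) *
        (ν 0 * (Ω 1 * ξ 2 - Ω 2 * ξ 1) + ν 1 * (Ω 2 * ξ 0 - Ω 0 * ξ 2) +
          ν 2 * (Ω 0 * ξ 1 - Ω 1 * ξ 0)) -
      (I 0 * ν 0 * Ω 0 + I 1 * ν 1 * Ω 1 + I 2 * ν 2 * Ω 2) ^ 2 *
        (I 0 * ν 0 * (ν ⨯₃ ξ) 0 + I 1 * ν 1 * (ν ⨯₃ ξ) 1 + I 2 * ν 2 * (ν ⨯₃ ξ) 2) = 0 := by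
  simp only [cofactorForm_apply, inertiaForm, cross_apply, Matrix.cons_val]
  linear_combination (I 0 * I 1 * ν 0 ^ 3 * Ω 1 * Ω 2 - I 0 * I 2 * ν 0 ^ 3 * Ω 1 * Ω 2
    - I 1 * I 2 * ν 0 * ν 1 ^ 2 * Ω 1 * Ω 2 + I 1 * I 2 * ν 0 * ν 2 ^ 2 * Ω 1 * Ω 2
    - I 0 * I 2 * ν 1 * ν 2 ^ 2 * Ω 0 * Ω 2 - I 0 * I 1 * ν 1 ^ 3 * Ω 0 * Ω 2
    + I 0 * I 2 * ν 2 ^ 3 * Ω 0 * Ω 1 + I 0 * I 1 * ν 1 ^ 2 * ν 2 * Ω 0 * Ω 1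
    - I 1 ^ 2 * ν 1 ^ 2 * ν 2 * Ω 0 * Ω 1 + I 2 ^ 2 * ν 1 * ν 2 ^ 2 * Ω 0 * Ω 2
    - I 0 * I 1 * ν 0 ^ 2 * ν 2 * Ω 0 * Ω 1 + I 0 * I 2 * ν 0 ^ 2 * ν 1 * Ω 0 * Ω 2
    - I 0 ^ 2 * ν 0 ^ 2 * ν 1 * Ω 0 * Ω 2 + I 0 ^ 2 * ν 0 ^ 2 * ν 2 * Ω 0 * Ω 1
    + I 1 * I 2 * ν 1 ^ 3 * Ω 0 * Ω 2 - I 1 * I 2 * ν 2 ^ 3 * Ω 0 * Ω 1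
    + I 1 ^ 2 * ν 0 * ν 1 ^ 2 * Ω 1 * Ω 2 - I 2 ^ 2 * ν 0 * ν 2 ^ 2 * Ω 1 * Ω 2) * h

theorem isDynamicalVector_rho (hI : ∀ i, 0 < I i)
    (hV : IsSmoothForm SO3 (fun Q (_ : Fin 0 → Mat3) => V Q)) (hU : IsOpen U)
    (hSU : poissonSphere ⊆ U) (hW : ContDiffOn ℝ ∞ W U)
    (hVW : ∀ Q ∈ SO3, V Q = W (poissonMap Q)) {p X : Mat3 × Mat3} (hp : p ∈ momentumLevel I k)
    (hX : (bodySystem I V).IsDynamicalVector p X) :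
    (reducedSystem I W k).IsDynamicalVector (rho p) (rho X) := by
  obtain ⟨Q, w⟩ := p
  have hQ : Q ∈ SO3 := hp.1.1
  have hw : IsTangent SO3 Q w := hp.1.2
  have hk := hp.2
  obtain ⟨O, A, hO, hQO, hA, hVA⟩ := hV Q hQ
  set V' : Mat3 → ℝ := fun R =>
    (ContinuousAlternatingMap.constOfIsEmptyLIE ℝ Mat3 ℝ (Fin 0)).symm (A R)
  have hV' : ContDiffOn ℝ ∞ V' O := (ContinuousAlternatingMap.constOfIsEmptyLIE ℝ Mat3 ℝ
    (Fin 0)).symm.toContinuousLinearEquiv.contDiff.comp_contDiffOn hA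
  have hVV' : ∀ R ∈ O ∩ SO3, V' R = V R := fun R hR => hVA R hR 0 fun i => i.elim0
  obtain ⟨hXt, hXw : X.1 = w, hEL⟩ := (GyroSystem.isDynamicalVector_iff (S := bodySystem I V) (K := 0)
    isRegularLevel_SO3 (isAmbientMetric_body hI) hQ hw hO hQO hV' hVV' fun _ => rfl).1 hX
  have hν := poissonMap_mem hQ
  refine (isDynamicalVector_reducedSystem_iff hI hU hSU hW hν (isTangent_poissonMap hw)).2
    ⟨isTangent_rho hXt, congrArg poissonMap hXw, fun b (hb : IsTangent poissonSphere
      (poissonMap Q) b) => ?_⟩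
  obtain ⟨α, hα⟩ := eq_of_isTangent_tangentBundle_SO3 hQ hw hXt hXw
  obtain ⟨Ω, rfl⟩ := (isTangent_SO3_iff hQ).1 hw
  rw [spin_mul_hat hQ] at hα
  -- The test vector is lifted with momentum 0, whatever `k` is: only the velocity lies in the level
  -- `k`.
  obtain ⟨ξ, hξ, rfl⟩ := exists_lift hI 0 hQ hb
  have hξt : IsTangent SO3 Q (Q * hat ξ) := (isTangent_SO3_iff hQ).2 ⟨ξ, rfl⟩
  have hel := hEL _ hξt
  rw [hα, eulerLagrange_body hI _ hQ] at hel
  have hdV := fderiv_eq_fderiv_poissonMap hO hQO hV' hU hSU hW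
    (fun R hR => (hVV' R hR).trans (hVW R hR.2)) hQ hξt
  have hD := (inertiaForm_pos hI (ne_zero_of_mem_poissonSphere hν)).ne'
  have hX2 : (rho X).2 = (poissonMap Q ⨯₃ Ω) ⨯₃ Ω + poissonMap Q ⨯₃ α := by
    have e : ∀ A B : Mat3, poissonMap (A + B) = poissonMap A + poissonMap B := fun _ _ => rfl
    rw [show (rho X).2 = poissonMap X.2 from rfl, hα, e, poissonMap_mul_hat, poissonMap_mul_hat,
      poissonMap_mul_hat]
  rw [momentum_mul_hat hQ] at hk hξ
  have key := reduction_identity I (poissonMap Q) Ω ξ hξ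
  -- Horizontality of `ξ` removes the correction in `cofactorForm_cross`, so `α` enters exactly as
  -- in the body equation, up to the factor `D`.
  have hcof : cofactorForm I ((poissonMap Q ⨯₃ Ω) ⨯₃ Ω + poissonMap Q ⨯₃ α) (poissonMap Q ⨯₃ ξ) =
      cofactorForm I ((poissonMap Q ⨯₃ Ω) ⨯₃ Ω) (poissonMap Q ⨯₃ ξ) +
      inertiaForm I (poissonMap Q) * (I 0 * α 0 * ξ 0 + I 1 * α 1 * ξ 1 + I 2 * α 2 * ξ 2) := by
    have := cofactorForm_cross I (poissonMap Q) α ξ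
    simp only [poissonMap] at this hξ ⊢
    rw [hξ, zero_mul, sub_zero] at this
    rw [map_add, _root_.add_apply, this]
  refine (eulerLagrange_reduced hI hU hSU hW hν _ _ _).trans ?_
  rw [hX2, poissonMap_mul_hat, poissonMap_mul_hat, hcof,
    gyroForm_cross hν, gyroCoeff, ← poissonMap_mul_hat Q ξ, ← hdV, poissonMap_mul_hat]
  have hk' : I 0 * poissonMap Q 0 * Ω 0 + I 1 * poissonMap Q 1 * Ω 1 + I 2 * poissonMap Q 2 * Ω 2
      = k := hk
  rw [hk'] at key
  have hdv : dirDeriv V' Q (Q * hat ξ) = _ := eq_neg_of_add_eq_zero_right hel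
  refine Eq.trans (congrArg (fun r => _ + (r - _)) hdv) ?_
  field_simp
  linear_combination key

end ReducedEquations

/-! ### The covariant acceleration without coordinates -/

section CovariantAcceleration

variable {E P G : Type*} [NormedAddCommGroup E] [NormedSpace ℝ E] [NormedAddCommGroup P]
  [NormedSpace ℝ P] [NormedAddCommGroup G] [NormedSpace ℝ G]

theorem ContDiffAt.hasFDerivAt_fderiv {φ : P → E} {r : P} (hφ : ContDiffAt ℝ ∞ φ r) :
    HasFDerivAt (fderiv ℝ φ) (fderiv ℝ (fderiv ℝ φ) r) r :=
  ((hφ.fderiv_right (m := ∞) (by simp)).differentiableAt (by simp)).hasFDerivAt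

theorem fderiv_pullback_bilin {A : E → NormedHom E (NormedHom E ℝ)} {φ : P → E} {r : P}
    (hA : DifferentiableAt ℝ A (φ r)) (hφ : ContDiffAt ℝ ∞ φ r) (i j l : P) :
    fderiv ℝ (fun s => A (φ s) (fderiv ℝ φ s j) (fderiv ℝ φ s l)) r i =
      fderiv ℝ A (φ r) (fderiv ℝ φ r i) (fderiv ℝ φ r j) (fderiv ℝ φ r l) +
      A (φ r) (fderiv ℝ (fderiv ℝ φ) r i j) (fderiv ℝ φ r l) +
      A (φ r) (fderiv ℝ φ r j) (fderiv ℝ (fderiv ℝ φ) r i l) := by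
  have h1 := hA.hasFDerivAt.comp r (hφ.differentiableAt (by simp)).hasFDerivAt
  have h2 : ∀ v : P, HasFDerivAt (fun s => fderiv ℝ φ s v) ((fderiv ℝ (fderiv ℝ φ) r).flip v) r :=
    fun v => (hφ.hasFDerivAt_fderiv.clm_apply (hasFDerivAt_const v r)).congr_fderiv (by ext; simp)
  have h3 := (h1.clm_apply (h2 j)).clm_apply (h2 l)
  refine (congrArg (fun L => L i) h3.fderiv).trans ?_
  simp
  ring

theorem second_fderiv_symm {φ : P → E} {r : P} (hφ : ContDiffAt ℝ ∞ φ r) (u v : P) :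
    fderiv ℝ (fderiv ℝ φ) r u v = fderiv ℝ (fderiv ℝ φ) r v u :=
  (hφ.isSymmSndFDerivAt (by
    rw [minSmoothness_of_isRCLikeNormedField]; exact WithTop.coe_le_coe.2 le_top)) u v

theorem deriv_deriv_comp {φ : P → E} {q : ℝ → P} {x : ℝ → E} {t : ℝ} {U : Set P} (hU : IsOpen U)
    (hφ : ContDiffOn ℝ ∞ φ U) (hqU : q t ∈ U) (hx : ∀ᶠ s in 𝓝 t, φ (q s) = x s)
    (hq : ∀ᶠ s in 𝓝 t, DifferentiableAt ℝ q s) (hq' : DifferentiableAt ℝ (deriv q) t) :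
    deriv x t = fderiv ℝ φ (q t) (deriv q t) ∧
    deriv (deriv x) t = fderiv ℝ (fderiv ℝ φ) (q t) (deriv q t) (deriv q t) +
      fderiv ℝ φ (q t) (deriv (deriv q) t) := by
  have hmem : ∀ᶠ s in 𝓝 t, q s ∈ U := hq.self_of_nhds.continuousAt (hU.mem_nhds hqU)
  have h1 : ∀ᶠ s in 𝓝 t, deriv x s = fderiv ℝ φ (q s) (deriv q s) := by
    filter_upwards [hx.eventually_nhds, hq, hmem] with s hs hqs hsU
    have h := ((hφ.contDiffAt (hU.mem_nhds hsU)).differentiableAt (by simp)).hasFDerivAt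
      |>.comp_hasDerivAt s hqs.hasDerivAt
    exact (h.congr_of_eventuallyEq (hs.mono fun r hr => hr.symm)).deriv
  refine ⟨h1.self_of_nhds, ?_⟩
  have h2 := (hφ.contDiffAt (hU.mem_nhds hqU)).hasFDerivAt_fderiv.comp_hasDerivAt t
    hq.self_of_nhds.hasDerivAt
  have h3 := h2.clm_apply hq'.hasDerivAt
  exact (h3.congr_of_eventuallyEq h1).deriv

/-- The Christoffel symbols with the upper index lowered. -/
theorem sum_mul_christoffel {M : (Fin 2 → ℝ) → Matrix (Fin 2) (Fin 2) ℝ} {r : Fin 2 → ℝ}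
    (hdet : (M r).det ≠ 0) (hsymm : ∀ i j, M r i j = M r j i) (i j l : Fin 2) :
    ∑ a, M r a l * christoffel M r a i j =
      1 / 2 * (fderiv ℝ (fun s => M s j l) r (coordVec i) + fderiv ℝ (fun s => M s i l) r (coordVec j)
        - fderiv ℝ (fun s => M s i j) r (coordVec l)) := by
  set T : Fin 2 → ℝ := fun l => fderiv ℝ (fun s => M s j l) r (coordVec i) +
    fderiv ℝ (fun s => M s i l) r (coordVec j) - fderiv ℝ (fun s => M s i j) r (coordVec l)
  have h1 : M r * (M r)⁻¹ = 1 := Matrix.mul_nonsing_inv _ (isUnit_iff_ne_zero.2 hdet)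
  have h2 : ∀ a, christoffel M r a i j = 1 / 2 * ∑ m, (M r)⁻¹ a m * T m := fun a => rfl
  have h3 : ∑ a, M r a l * ∑ m, (M r)⁻¹ a m * T m = T l := by
    have : ∀ m, ∑ a, M r a l * (M r)⁻¹ a m = (1 : Matrix (Fin 2) (Fin 2) ℝ) l m := fun m => by
      rw [← h1, Matrix.mul_apply]
      exact Finset.sum_congr rfl fun a _ => by rw [hsymm a l]
    calc ∑ a, M r a l * ∑ m, (M r)⁻¹ a m * T m = ∑ m, (∑ a, M r a l * (M r)⁻¹ a m) * T m := by
          simp only [Finset.mul_sum, Finset.sum_mul, ← mul_assoc]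
          exact Finset.sum_comm
      _ = T l := by simp [this, Matrix.one_apply]
  simp only [h2, mul_left_comm _ (1 / 2 : ℝ), ← Finset.mul_sum, h3]
  rfl

/-- The inner products of the covariant acceleration with tangent vectors, in ambient terms. -/
theorem IsCovAccel.inner_eq {N : Set E} {g : E → E → E → ℝ}
    {A : E → NormedHom E (NormedHom E ℝ)} {x : ℝ → E} {t : ℝ} {a : E} {f : E → G}
    (hA : DifferentiableAt ℝ A (x t)) (hg : ∀ y u v, g y u v = A y u v)
    (hsymm : ∀ y u v, A y u v = A y v u) (hpos : ∀ u, u ≠ 0 → 0 < A (x t) u u)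
    (hf : DifferentiableAt ℝ f (x t)) (hfN : ∀ y ∈ N, f y = 0) (h : IsCovAccel N g x t a) :
    ∃ L : (Fin 2 → ℝ) →ₗ[ℝ] E, Function.Injective L ∧ (∀ r, fderiv ℝ f (x t) (L r) = 0) ∧
      (∃ r, L r = a) ∧ ∀ r, A (x t) a (L r) = A (x t) (deriv (deriv x) t) (L r) +
        fderiv ℝ A (x t) (deriv x t) (deriv x t) (L r) -
        1 / 2 * fderiv ℝ A (x t) (L r) (deriv x t) (deriv x t) := by
  obtain ⟨U, φ, q, hφ, hqU, hx, hq, hq', ha⟩ := h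
  have hxt : φ (q t) = x t := hx.self_of_nhds
  have hφt := hφ.smooth.contDiffAt (hφ.isOpen.mem_nhds hqU)
  obtain ⟨hd1, hd2⟩ := deriv_deriv_comp hφ.isOpen hφ.smooth hqU hx hq hq'
  set L : (Fin 2 → ℝ) →ₗ[ℝ] E := (fderiv ℝ φ (q t)).toLinearMap with hL
  set S : (Fin 2 → ℝ) →L[ℝ] (Fin 2 → ℝ) →L[ℝ] E := fderiv ℝ (fderiv ℝ φ) (q t) with hS
  rw [← hxt] at hA hpos hf ⊢
  set A₀ := A (φ (q t)) with hA₀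
  set M := metricMatrix g φ with hM
  have hMapp : ∀ i j, M (q t) i j = A₀ (L (coordVec i)) (L (coordVec j)) := fun i j => hg _ _ _
  have hMsymm : ∀ i j, M (q t) i j = M (q t) j i := fun i j => by
    rw [hMapp, hMapp]; exact hsymm _ _ _
  have hdec : ∀ r : Fin 2 → ℝ, r = r 0 • coordVec 0 + r 1 • coordVec 1 := fun r => by
    ext i; fin_cases i <;> simp [coordVec]
  have hLdec : ∀ r : Fin 2 → ℝ, L r = r 0 • L (coordVec 0) + r 1 • L (coordVec 1) := fun r => by
    conv_lhs => rw [hdec r]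
    rw [map_add, map_smul, map_smul]
  have hinj : Function.Injective L := hφ.immersion _ hqU
  -- `M` is the Gram matrix of a positive definite form on independent vectors: a null vector would
  -- give a nonzero tangent vector of length 0.
  have hdet : (M (q t)).det ≠ 0 := by
    intro h0
    obtain ⟨v, hv, hMv⟩ := Matrix.exists_mulVec_eq_zero_iff.2 h0
    have hLv : L v ≠ 0 := fun h1 => hv (hinj (by rw [h1, map_zero]))
    have h1 := hpos _ hLv
    have e : A₀ (L v) (L v) = v ⬝ᵥ (M (q t) *ᵥ v) := by
      rw [hLdec v]
      simp only [Matrix.mulVec, dotProduct, Fin.sum_univ_two, hMapp, map_add, map_smul,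
        _root_.add_apply, _root_.smul_apply, smul_eq_mul]
      ring
    rw [e, hMv, dotProduct_zero] at h1
    exact lt_irrefl _ h1
  have hMder : ∀ i j l, fderiv ℝ (fun s => M s j l) (q t) (coordVec i) =
      fderiv ℝ A (φ (q t)) (L (coordVec i)) (L (coordVec j)) (L (coordVec l)) +
      A₀ (S (coordVec i) (coordVec j)) (L (coordVec l)) +
      A₀ (L (coordVec j)) (S (coordVec i) (coordVec l)) := fun i j l => by
    have e : (fun s => M s j l) = fun s => A (φ s) (fderiv ℝ φ s (coordVec j))
      (fderiv ℝ φ s (coordVec l)) := funext fun s => hg _ _ _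
    rw [e]
    exact fderiv_pullback_bilin hA hφt _ _ _
  have hSsymm : ∀ u v, S u v = S v u := fun u v => second_fderiv_symm hφt u v
  have hlow := fun i j l => sum_mul_christoffel hdet hMsymm i j l
  refine ⟨L, hinj, fun r => ?_, ⟨_, ha.symm⟩, fun r => ?_⟩
  -- The chart takes values in `N`, where `f` vanishes; differentiating `f ∘ φ = 0` puts the range
  -- of `L` in the kernel.
  · obtain ⟨O, hO, hOU⟩ := hφ.open_image U subset_rfl hφ.isOpen
    have hz : (fun s => f (φ s)) =ᶠ[𝓝 (q t)] fun _ => 0 := by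
      filter_upwards [hφ.isOpen.mem_nhds hqU] with s hs
      exact hfN _ (hOU ▸ Set.mem_image_of_mem φ hs : φ s ∈ O ∩ N).2
    have h1 := hf.hasFDerivAt.comp (q t) (hφt.differentiableAt (by simp)).hasFDerivAt
    have h2 := (h1.congr_of_eventuallyEq hz.symm).unique (hasFDerivAt_const _ _)
    exact congrArg (fun T => T r) h2
  · have hA₀symm : ∀ u v, A₀ u v = A₀ v u := hsymm _
    have hS10 : S (coordVec 1) (coordVec 0) = S (coordVec 0) (coordVec 1) := hSsymm _ _
    -- In the lowered Christoffel symbols the second derivatives `S` of the chart cancel by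
    -- symmetry, except for `A₀ (S i j) (L l)`; these complete the second derivative of the
    -- coordinates to that of `x`.
    have key : ∀ l, A₀ a (L (coordVec l)) = A₀ (deriv (deriv x) t) (L (coordVec l)) +
        fderiv ℝ A (φ (q t)) (deriv x t) (deriv x t) (L (coordVec l)) -
        1 / 2 * fderiv ℝ A (φ (q t)) (L (coordVec l)) (deriv x t) (deriv x t) := by
      intro l
      set v := deriv q t
      have e1 : deriv x t = v 0 • L (coordVec 0) + v 1 • L (coordVec 1) := hd1.trans (hLdec v)
      have e2 : deriv (deriv x) t = (v 0 * v 0) • S (coordVec 0) (coordVec 0) +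
          (2 * v 0 * v 1) • S (coordVec 0) (coordVec 1) +
          (v 1 * v 1) • S (coordVec 1) (coordVec 1) +
          (deriv (deriv q) t 0 • L (coordVec 0) + deriv (deriv q) t 1 • L (coordVec 1)) := by
        rw [hd2, ← hLdec]
        congr 1
        conv_lhs => rw [hdec v]
        simp only [map_add, map_smul, _root_.add_apply, _root_.smul_apply, hS10]
        module
      have e3 : a = coordCovAccel M q t 0 • L (coordVec 0) +
          coordCovAccel M q t 1 • L (coordVec 1) := ha.trans (hLdec _)
      have hlow' := fun i j => hlow i j l
      simp only [hMder, hMapp, Fin.sum_univ_two] at hlow'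
      rw [e1, e2, e3]
      simp only [map_add, map_smul, _root_.add_apply, _root_.smul_apply, smul_eq_mul,
        coordCovAccel, Fin.sum_univ_two]
      have h00 := hlow' 0 0
      have h01 := hlow' 0 1
      have h10 := hlow' 1 0
      have h11 := hlow' 1 1
      simp only [hS10, hSsymm (coordVec l), hA₀symm (L (coordVec 0)) (S _ _),
        hA₀symm (L (coordVec 1)) (S _ _)] at h00 h01 h10 h11
      linear_combination v 0 * v 0 * h00 + v 0 * v 1 * h01 + v 1 * v 0 * h10 + v 1 * v 1 * h11
    rw [hLdec r]
    simp only [map_add, map_smul, _root_.add_apply, _root_.smul_apply, smul_eq_mul, key]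
    ring

end CovariantAcceleration

/-- With coordinates `ψ` smooth on the ambient space near `x t`, the coordinate curve `ψ ∘ x`
inherits the regularity of `x` by the chain rule. -/
theorem IsLocalParametrization.exists_isCovAccel {E : Type*} [NormedAddCommGroup E]
    [NormedSpace ℝ E] {N : Set E} {U : Set (Fin 2 → ℝ)} {φ : (Fin 2 → ℝ) → E}
    {ψ : E → Fin 2 → ℝ} {x y : ℝ → E} {t : ℝ} (hφ : IsLocalParametrization N U φ)
    (hψ : ContDiffAt ℝ ∞ ψ (x t)) (hU : ψ (x t) ∈ U) (hx : ∀ᶠ s in 𝓝 t, φ (ψ (x s)) = x s)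
    (hd : ∀ᶠ s in 𝓝 t, HasDerivAt x (y s) s) (hy : DifferentiableAt ℝ y t)
    (g : E → E → E → ℝ) : ∃ a, IsCovAccel N g x t a := by
  have hψ' : ∀ᶠ z in 𝓝 (x t), DifferentiableAt ℝ ψ z :=
    ((hψ.of_le (m := 1) (by simp)).eventually (by simp)).mono fun z hz =>
      hz.differentiableAt (by simp)
  have hq : ∀ᶠ s in 𝓝 t, HasDerivAt (fun r => ψ (x r)) (fderiv ℝ ψ (x s) (y s)) s := by
    filter_upwards [hd, hd.self_of_nhds.continuousAt.eventually hψ'] with s hs hs'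
    exact hs'.hasFDerivAt.comp_hasDerivAt s hs
  refine ⟨_, U, φ, fun s => ψ (x s), hφ, hU, hx, hq.mono fun s hs => hs.differentiableAt, ?_, rfl⟩
  have h := (hψ.hasFDerivAt_fderiv.comp_hasDerivAt t hd.self_of_nhds).clm_apply hy.hasDerivAt
  exact (h.congr_of_eventuallyEq (hq.mono fun s hs => hs.deriv)).differentiableAt

/-! ### Gnomonic charts of the sphere -/

section Gnomonic

/-- The gnomonic parametrization of the hemisphere whose centre is the first row of `Q`. -/
noncomputable def gnomonic (Q : Mat3) (s : Fin 2 → ℝ) : Fin 3 → ℝ :=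
  (√(1 + s 0 ^ 2 + s 1 ^ 2))⁻¹ • (![1, s 0, s 1] ᵥ* Q)

/-- The coordinates inverse to the gnomonic parametrization. -/
noncomputable def gnomonicCoord (Q : Mat3) (y : Fin 3 → ℝ) : Fin 2 → ℝ :=
  ![(Q *ᵥ y) 1 / (Q *ᵥ y) 0, (Q *ᵥ y) 2 / (Q *ᵥ y) 0]

/-- The open half-space around the first row of `Q`. -/
def halfSpace (Q : Mat3) : Set (Fin 3 → ℝ) := {y | 0 < (Q *ᵥ y) 0}

variable {Q : Mat3}

theorem one_add_sq_pos (s : Fin 2 → ℝ) : 0 < 1 + s 0 ^ 2 + s 1 ^ 2 := by positivity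

theorem mulVec_gnomonic (hQ : Q ∈ SO3) (s : Fin 2 → ℝ) :
    Q *ᵥ gnomonic Q s = (√(1 + s 0 ^ 2 + s 1 ^ 2))⁻¹ • ![1, s 0, s 1] := by
  rw [gnomonic, Matrix.mulVec_smul, ← Matrix.mulVec_transpose, Matrix.mulVec_mulVec,
    mul_transpose_of_mem_SO3 hQ, Matrix.one_mulVec]

theorem gnomonicCoord_gnomonic (hQ : Q ∈ SO3) (s : Fin 2 → ℝ) :
    gnomonicCoord Q (gnomonic Q s) = s := by
  have h := (Real.sqrt_pos.2 (one_add_sq_pos s)).ne'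
  ext i
  fin_cases i <;> simp [gnomonicCoord, mulVec_gnomonic hQ] <;> field_simp

theorem dotProduct_mulVec_mulVec_self (hQ : Q ∈ SO3) (y : Fin 3 → ℝ) :
    (Q *ᵥ y) ⬝ᵥ (Q *ᵥ y) = y ⬝ᵥ y := by
  rw [Matrix.dotProduct_mulVec, ← Matrix.mulVec_transpose, Matrix.mulVec_mulVec,
    (mem_SO3.1 hQ).1, Matrix.one_mulVec]

theorem gnomonic_mem (hQ : Q ∈ SO3) (s : Fin 2 → ℝ) : gnomonic Q s ∈ poissonSphere := by
  have h := one_add_sq_pos s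
  change gnomonic Q s ⬝ᵥ gnomonic Q s = 1
  rw [← dotProduct_mulVec_mulVec_self hQ, mulVec_gnomonic hQ, dotProduct_fin_three]
  simp
  have h3 := (Real.sqrt_pos.2 h).ne'
  field_simp
  linarith [Real.sq_sqrt h.le]

theorem gnomonic_mem_halfSpace (hQ : Q ∈ SO3) (s : Fin 2 → ℝ) : gnomonic Q s ∈ halfSpace Q := by
  change 0 < (Q *ᵥ gnomonic Q s) 0
  rw [mulVec_gnomonic hQ]
  simpa using one_add_sq_pos s

theorem gnomonic_gnomonicCoord (hQ : Q ∈ SO3) {y : Fin 3 → ℝ} (hy : y ∈ poissonSphere)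
    (hyQ : y ∈ halfSpace Q) : gnomonic Q (gnomonicCoord Q y) = y := by
  have hz : 0 < (Q *ᵥ y) 0 := hyQ
  have h1 : (Q *ᵥ y) ⬝ᵥ (Q *ᵥ y) = 1 := (dotProduct_mulVec_mulVec_self hQ y).trans hy
  rw [dotProduct_fin_three] at h1
  have h2 : Qᵀ *ᵥ (Q *ᵥ y) = y := by
    rw [Matrix.mulVec_mulVec, (mem_SO3.1 hQ).1, Matrix.one_mulVec]
  rw [gnomonic, ← Matrix.mulVec_transpose, ← Matrix.mulVec_smul]
  refine Eq.trans ?_ h2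
  congr 1
  set z := Q *ᵥ y with hzdef
  have h3 : 1 + gnomonicCoord Q y 0 ^ 2 + gnomonicCoord Q y 1 ^ 2 = (z 0)⁻¹ ^ 2 := by
    simp only [gnomonicCoord, Matrix.cons_val_zero, Matrix.cons_val_one, ← hzdef]
    field_simp
    linarith
  rw [h3, Real.sqrt_sq (inv_pos.2 hz).le, inv_inv]
  ext i
  fin_cases i <;> simp [gnomonicCoord, ← hzdef] <;> field_simp

theorem contDiff_mulVec (Q : Mat3) (i : Fin 3) : ContDiff ℝ ∞ fun y : Fin 3 → ℝ => (Q *ᵥ y) i := by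
  simp only [Matrix.mulVec, dotProduct]
  fun_prop

theorem isOpen_halfSpace (Q : Mat3) : IsOpen (halfSpace Q) :=
  isOpen_lt continuous_const (contDiff_mulVec Q 0).continuous

theorem contDiffOn_gnomonicCoord (Q : Mat3) : ContDiffOn ℝ ∞ (gnomonicCoord Q) (halfSpace Q) := by
  rw [contDiffOn_pi]
  intro i
  fin_cases i
  · exact (contDiff_mulVec Q 1).contDiffOn.div (contDiff_mulVec Q 0).contDiffOn fun y hy => ne_of_gt hy
  · exact (contDiff_mulVec Q 2).contDiffOn.div (contDiff_mulVec Q 0).contDiffOn fun y hy => ne_of_gt hy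

theorem contDiff_gnomonic (Q : Mat3) : ContDiff ℝ ∞ (gnomonic Q) := by
  have h1 : ContDiff ℝ ∞ fun s : Fin 2 → ℝ => (√(1 + s 0 ^ 2 + s 1 ^ 2))⁻¹ :=
    ((by fun_prop : ContDiff ℝ ∞ fun s : Fin 2 → ℝ => 1 + s 0 ^ 2 + s 1 ^ 2).sqrt
      fun s => (one_add_sq_pos s).ne').inv fun s => (Real.sqrt_pos.2 (one_add_sq_pos s)).ne'
  refine h1.smul (contDiff_pi.2 fun i => ?_)
  simp only [Matrix.vecMul, dotProduct, Fin.sum_univ_three]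
  simp
  fun_prop

/-- The smooth ambient left inverse `gnomonicCoord` gives everything: its derivative inverts that of
the chart, and preimages under it describe the images of open sets. -/
theorem isLocalParametrization_gnomonic (hQ : Q ∈ SO3) :
    IsLocalParametrization poissonSphere Set.univ (gnomonic Q) where
  isOpen := isOpen_univ
  smooth := (contDiff_gnomonic Q).contDiffOn
  immersion := fun s _ => by
    have h1 := ((contDiffOn_gnomonicCoord Q).contDiffAt ((isOpen_halfSpace Q).mem_nhds
      (gnomonic_mem_halfSpace hQ s))).differentiableAt (by simp)
    have h2 := h1.hasFDerivAt.comp s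
      ((contDiff_gnomonic Q).differentiable (by simp) s).hasFDerivAt
    have h3 := (h2.congr_of_eventuallyEq (f₁ := id) (Eventually.of_forall fun r =>
      (gnomonicCoord_gnomonic hQ r).symm)).unique (hasFDerivAt_id s)
    exact Function.LeftInverse.injective (g := fderiv ℝ (gnomonicCoord Q) (gnomonic Q s))
      fun r => congrArg (fun T => T r) h3
  injOn := (Function.LeftInverse.injective (gnomonicCoord_gnomonic hQ)).injOn
  open_image := fun W _ hW => by
    refine ⟨halfSpace Q ∩ gnomonicCoord Q ⁻¹' W,
      (contDiffOn_gnomonicCoord Q).continuousOn.isOpen_inter_preimage (isOpen_halfSpace Q) hW, ?_⟩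
    ext y
    constructor
    · rintro ⟨s, hs, rfl⟩
      refine ⟨⟨gnomonic_mem_halfSpace hQ s, ?_⟩, gnomonic_mem hQ s⟩
      rw [Set.mem_preimage, gnomonicCoord_gnomonic hQ]
      exact hs
    · rintro ⟨⟨h1, h2⟩, h3⟩
      exact ⟨_, h2, gnomonic_gnomonicCoord hQ h3 h1⟩

/-- Guarantees that statements about all covariant accelerations are not vacuous. The chart is
centred at `x t`, the first row of the chosen rotation. -/
theorem exists_isCovAccel_poissonSphere {x y : ℝ → Fin 3 → ℝ} {t : ℝ}
    (hx : ∀ᶠ s in 𝓝 t, x s ∈ poissonSphere) (hd : ∀ᶠ s in 𝓝 t, HasDerivAt x (y s) s)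
    (hy : DifferentiableAt ℝ y t) (g : (Fin 3 → ℝ) → (Fin 3 → ℝ) → (Fin 3 → ℝ) → ℝ) :
    ∃ a, IsCovAccel poissonSphere g x t a := by
  obtain ⟨Q, hQ, hQx⟩ := exists_poissonMap_eq hx.self_of_nhds
  have hxQ : x t ∈ halfSpace Q := by
    have h1 : (Q *ᵥ x t) 0 = x t ⬝ᵥ x t := by rw [← hQx]; rfl
    have h2 : x t ⬝ᵥ x t = 1 := hx.self_of_nhds
    change 0 < (Q *ᵥ x t) 0
    rw [h1, h2]
    exact one_pos
  have hmem := (isOpen_halfSpace Q).mem_nhds hxQ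
  refine (isLocalParametrization_gnomonic hQ).exists_isCovAccel
    ((contDiffOn_gnomonicCoord Q).contDiffAt hmem) (Set.mem_univ _) ?_ hd hy g
  filter_upwards [hx, hd.self_of_nhds.continuousAt hmem] with s h1 h2
  exact gnomonic_gnomonicCoord hQ h1 h2

end Gnomonic

/-! ### The left normal and areas in the reduced metric -/

section ConormalVector

variable {I ν u a : Fin 3 → ℝ}

theorem gyroCoeff_pos (hI : ∀ i, 0 < I i) (h0 : I 0 < I 1 + I 2) (h1 : I 1 < I 2 + I 0)
    (h2 : I 2 < I 0 + I 1) (hν : ν ∈ poissonSphere) : 0 < gyroCoeff I ν := by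
  have hν0 := ne_zero_of_mem_poissonSphere hν
  -- The numerator is again an inertia form; the triangle inequalities say that its fictitious
  -- moments are positive.
  have h := inertiaForm_pos (I := ![(I 1 + I 2 - I 0) * I 0, (I 2 + I 0 - I 1) * I 1,
    (I 0 + I 1 - I 2) * I 2]) (fun i => by
      fin_cases i
      · exact mul_pos (by linarith) (hI 0)
      · exact mul_pos (by linarith) (hI 1)
      · exact mul_pos (by linarith) (hI 2)) hν0
  exact div_pos h (pow_pos (inertiaForm_pos hI hν0) 2)

/-- The tangent vector at `ν` that is orthogonal to the tangent vector `u` in the reduced metric and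
lies to the left of it. -/
def leftNormal (I ν u : Fin 3 → ℝ) : Fin 3 → ℝ :=
  ![ν 1 * (I 0 * I 1 * u 2) - ν 2 * (I 0 * I 2 * u 1),
    ν 2 * (I 1 * I 2 * u 0) - ν 0 * (I 0 * I 1 * u 2),
    ν 0 * (I 0 * I 2 * u 1) - ν 1 * (I 1 * I 2 * u 0)]

theorem isTangent_leftNormal (hν : ν ∈ poissonSphere) :
    IsTangent poissonSphere ν (leftNormal I ν u) := by
  rw [isTangent_poissonSphere_iff hν]
  simp only [leftNormal, Matrix.cons_val]
  ring

/-- With `C` the cofactor matrix, `leftNormal` is `ν × Cu`, which is orthogonal to `Cu`. -/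
theorem cofactorForm_leftNormal_self : cofactorForm I u (leftNormal I ν u) = 0 := by
  rw [cofactorForm_apply]
  simp only [leftNormal, Matrix.cons_val]
  ring

theorem sphereVolume_leftNormal (hν : ν ∈ poissonSphere) (hu : IsTangent poissonSphere ν u) :
    sphereVolume ν ![u, leftNormal I ν u] = cofactorForm I u u := by
  have h1 := mem_poissonSphere.1 hν
  have h2 := (isTangent_poissonSphere_iff hν).1 hu
  rw [cofactorForm_apply, sphereVolume]
  simp only [leftNormal, Matrix.cons_val]
  linear_combination (I 1 * I 2 * (u 0 * u 0) + I 0 * I 2 * (u 1 * u 1) + I 0 * I 1 * (u 2 * u 2)) *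
    h1 - (I 1 * I 2 * u 0 * ν 0 + I 0 * I 2 * u 1 * ν 1 + I 0 * I 1 * u 2 * ν 2) * h2

/-- The cross product of two tangent vectors is normal to the sphere, hence its component along `ν`
times `ν`. -/
theorem cross_eq_sphereVolume_smul (hν : ν ∈ poissonSphere) (hu : IsTangent poissonSphere ν u)
    (ha : IsTangent poissonSphere ν a) :
    u 1 * a 2 - u 2 * a 1 = ν 0 * sphereVolume ν ![u, a] ∧
    u 2 * a 0 - u 0 * a 2 = ν 1 * sphereVolume ν ![u, a] ∧
    u 0 * a 1 - u 1 * a 0 = ν 2 * sphereVolume ν ![u, a] := by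
  have h1 := mem_poissonSphere.1 hν
  have h2 := (isTangent_poissonSphere_iff hν).1 hu
  have h3 := (isTangent_poissonSphere_iff hν).1 ha
  have e0 : ν 1 * (u 0 * a 1 - u 1 * a 0) - ν 2 * (u 2 * a 0 - u 0 * a 2) = 0 := by
    linear_combination u 0 * h3 - a 0 * h2
  have e1 : ν 2 * (u 1 * a 2 - u 2 * a 1) - ν 0 * (u 0 * a 1 - u 1 * a 0) = 0 := by
    linear_combination u 1 * h3 - a 1 * h2
  have e2 : ν 0 * (u 2 * a 0 - u 0 * a 2) - ν 1 * (u 1 * a 2 - u 2 * a 1) = 0 := by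
    linear_combination u 2 * h3 - a 2 * h2
  simp only [sphereVolume, Matrix.cons_val]
  refine ⟨?_, ?_, ?_⟩
  · linear_combination -(u 1 * a 2 - u 2 * a 1) * h1 - ν 1 * e2 + ν 2 * e1
  · linear_combination -(u 2 * a 0 - u 0 * a 2) * h1 - ν 2 * e0 + ν 0 * e2
  · linear_combination -(u 0 * a 1 - u 1 * a 0) * h1 - ν 0 * e1 + ν 1 * e0

/-- For the cofactor matrix `C` one has `Cu × Ca = det(I) I(u × a)`, and `u × a` is a multiple of
`ν`. Thus the inner product with the left normal measures oriented area. -/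
theorem cofactorForm_leftNormal (hν : ν ∈ poissonSphere) (hu : IsTangent poissonSphere ν u)
    (ha : IsTangent poissonSphere ν a) : cofactorForm I a (leftNormal I ν u) =
      I 0 * I 1 * I 2 * inertiaForm I ν * sphereVolume ν ![u, a] := by
  obtain ⟨e0, e1, e2⟩ := cross_eq_sphereVolume_smul hν hu ha
  rw [cofactorForm_apply, inertiaForm]
  set s := sphereVolume ν ![u, a]
  simp only [leftNormal, Matrix.cons_val]
  linear_combination I 0 * I 1 * I 2 * (I 0 * ν 0 * e0 + I 1 * ν 1 * e1 + I 2 * ν 2 * e2)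

theorem cofactorForm_gram (hν : ν ∈ poissonSphere) (hu : IsTangent poissonSphere ν u)
    (ha : IsTangent poissonSphere ν a) :
    cofactorForm I u u * cofactorForm I a a - cofactorForm I u a ^ 2 =
      I 0 * I 1 * I 2 * inertiaForm I ν * sphereVolume ν ![u, a] ^ 2 := by
  obtain ⟨e0, e1, e2⟩ := cross_eq_sphereVolume_smul hν hu ha
  have h : I 0 * I 1 * I 2 * inertiaForm I ν * sphereVolume ν ![u, a] ^ 2 = I 0 * I 1 * I 2 *
      (I 0 * (ν 0 * sphereVolume ν ![u, a]) ^ 2 + I 1 * (ν 1 * sphereVolume ν ![u, a]) ^ 2 +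
        I 2 * (ν 2 * sphereVolume ν ![u, a]) ^ 2) := by
    rw [inertiaForm]; ring
  rw [h, ← e0, ← e1, ← e2]
  simp only [cofactorForm_apply]
  ring

end ConormalVector

/-- The range of `L` has dimension 2 inside the plane orthogonal to `ν`, hence fills it. This allows
the left normal as a test vector in `IsCovAccel.inner_eq`. -/
theorem exists_eq_of_dotProduct_eq_zero {ν n : Fin 3 → ℝ} (hν : ν ≠ 0)
    {L : (Fin 2 → ℝ) →ₗ[ℝ] (Fin 3 → ℝ)} (hL : Function.Injective L) (hνL : ∀ r, ν ⬝ᵥ L r = 0)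
    (hn : ν ⬝ᵥ n = 0) : ∃ r, L r = n := by
  set K := LinearMap.ker (dotProductBilin ℝ ℝ ν : (Fin 3 → ℝ) →ₗ[ℝ] ℝ)
  have hle : LinearMap.range L ≤ K := by
    rintro _ ⟨r, rfl⟩
    exact hνL r
  have hlt : Module.finrank ℝ K < 3 := by
    have hne : K ≠ ⊤ := fun h => (dotProduct_self_pos_of_ne_zero hν).ne'
      (show ν ∈ K from h ▸ Submodule.mem_top)
    simpa using Submodule.finrank_lt hne
  have hr : Module.finrank ℝ (LinearMap.range L) = 2 := by
    simpa using LinearMap.finrank_range_of_inj hL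
  have he := Submodule.eq_of_le_of_finrank_le hle (by omega)
  exact (he.symm ▸ (show n ∈ K from hn) : n ∈ LinearMap.range L)

/-! ### Geodesic curvature of the reduced trajectories -/

section Trajectories

variable {I : Fin 3 → ℝ} {W : (Fin 3 → ℝ) → ℝ} {U : Set (Fin 3 → ℝ)} {k : ℝ}

/-- The base component of the dynamical vector is the velocity, so the fibre part of the integral
curve is the derivative of `x`, and its own derivative is the acceleration. -/
theorem GyroSystem.IsMotionOn.equations {x : ℝ → Fin 3 → ℝ} {J : Set ℝ} (hI : ∀ i, 0 < I i)
    (hU : IsOpen U) (hSU : poissonSphere ⊆ U) (hW : ContDiffOn ℝ ∞ W U) (hJ : IsOpen J)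
    (hx : (reducedSystem I W k).IsMotionOn x J) {t : ℝ} (ht : t ∈ J) :
    (∀ s ∈ J, x s ∈ poissonSphere) ∧ IsTangent poissonSphere (x t) (deriv x t) ∧
    (∀ s ∈ J, HasDerivAt x (deriv x s) s) ∧ DifferentiableAt ℝ (deriv x) t ∧
    ∀ b, IsTangent poissonSphere (x t) b → eulerLagrange (reducedForm I) (amendedPotential I W k)
      (gyroExt I k (x t)) (x t) (deriv x t) (deriv (deriv x) t) b = 0 := by
  obtain ⟨w, hw⟩ := hx
  have hwJ : ∀ s ∈ J, HasDerivAt x (w s).2 s := fun s hs => by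
    obtain ⟨h1, h2, X, hX, hd⟩ := hw s hs
    have hX1 := ((isDynamicalVector_reducedSystem_iff hI hU hSU hW h1.1 h1.2).1 hX).2.1
    rw [← hX1]
    exact ((hasFDerivAt_fst.comp_hasDerivAt s hd)).congr_of_eventuallyEq
      ((hJ.eventually_mem hs).mono fun r hr => (hw r hr).2.1.symm)
  have hder : deriv x =ᶠ[𝓝 t] fun s => (w s).2 :=
    (hJ.eventually_mem ht).mono fun r hr => (hwJ r hr).deriv
  obtain ⟨h1, h2, X, hX, hd⟩ := hw t ht
  obtain ⟨-, -, hEL⟩ := (isDynamicalVector_reducedSystem_iff hI hU hSU hW h1.1 h1.2).1 hX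
  have hd2 : HasDerivAt (deriv x) X.2 t :=
    (hasFDerivAt_snd.comp_hasDerivAt t hd).congr_of_eventuallyEq hder
  refine ⟨fun s hs => (hw s hs).2.1 ▸ (hw s hs).1.1, ?_, fun s hs => (hwJ s hs).deriv.symm ▸ hwJ s hs,
    hd2.differentiableAt, ?_⟩
  · rw [(hwJ t ht).deriv, ← h2]
    exact h1.2
  · rw [(hwJ t ht).deriv, hd2.deriv, ← h2]
    exact hEL

/-- The Jacobi metric as a field of continuous bilinear forms. -/
noncomputable def jacobiForm (I : Fin 3 → ℝ) (W : (Fin 3 → ℝ) → ℝ) (k h : ℝ) (ν : Fin 3 → ℝ) :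
    NormedHom (Fin 3 → ℝ) (NormedHom (Fin 3 → ℝ) ℝ) :=
  (2 * (h - amendedPotential I W k ν)) • reducedForm I ν

theorem jacobiMetric_eq (hI : ∀ i, 0 < I i) (h : ℝ) (ν u v : Fin 3 → ℝ) :
    (reducedSystem I W k).jacobiMetric h ν u v = jacobiForm I W k h ν u v :=
  congrArg (2 * (h - amendedPotential I W k ν) * ·) (reducedMetric_eq hI ν u v)

theorem hasFDerivAt_smul_bilin {E : Type*} [NormedAddCommGroup E] [NormedSpace ℝ E] {f : E → ℝ}
    {B : E → NormedHom E (NormedHom E ℝ)} {y : E} (hf : DifferentiableAt ℝ f y)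
    (hB : DifferentiableAt ℝ B y) : DifferentiableAt ℝ (fun z => f z • B z) y ∧
      ∀ u v w, fderiv ℝ (fun z => f z • B z) y u v w =
        f y * fderiv ℝ B y u v w + fderiv ℝ f y u * B y v w := by
  have h := hf.hasFDerivAt.smul hB.hasFDerivAt
  refine ⟨h.differentiableAt, fun u v w => ?_⟩
  refine (congrArg (fun T => T u v w) h.fderiv).trans ?_
  simp

/-- Maupertuis' principle with gyroscopic forces: normal to the trajectory only the gyroscopic force
remains. The curve keeps its time parameter, since reparametrization alters the covariant
acceleration only along the velocity. -/
theorem sphereVolume_covAccel (hI : ∀ i, 0 < I i) (hU : IsOpen U) (hSU : poissonSphere ⊆ U)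
    (hW : ContDiffOn ℝ ∞ W U) {x : ℝ → Fin 3 → ℝ} {t h : ℝ} {a : Fin 3 → ℝ}
    (hν : x t ∈ poissonSphere) (hu : IsTangent poissonSphere (x t) (deriv x t))
    (hEL : ∀ b, IsTangent poissonSphere (x t) b → eulerLagrange (reducedForm I)
      (amendedPotential I W k) (gyroExt I k (x t)) (x t) (deriv x t) (deriv (deriv x) t) b = 0)
    (hE : reducedForm I (x t) (deriv x t) (deriv x t) = 2 * (h - amendedPotential I W k (x t)))
    (hh : amendedPotential I W k (x t) < h)
    (ha : IsCovAccel poissonSphere ((reducedSystem I W k).jacobiMetric h) x t a) :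
    IsTangent poissonSphere (x t) a ∧ I 0 * I 1 * I 2 * sphereVolume (x t) ![deriv x t, a] =
      -(k * gyroCoeff I (x t) * cofactorForm I (deriv x t) (deriv x t)) := by
  have hν0 := ne_zero_of_mem_poissonSphere hν
  have hD := inertiaForm_pos hI hν0
  have hr := poissonSphere_subset_regularSet hI hν
  have hV : DifferentiableAt ℝ (amendedPotential I W k) (x t) :=
    ((contDiffOn_amendedPotential hW).contDiffAt
      ((hU.inter (isOpen_regularSet I)).mem_nhds ⟨hSU hν, hr⟩)).differentiableAt (by simp)
  have hf : HasFDerivAt (fun y => 2 * (h - amendedPotential I W k y))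
      ((2 : ℝ) • -fderiv ℝ (amendedPotential I W k) (x t)) (x t) :=
    (hV.hasFDerivAt.const_sub h).const_mul 2
  have hfpos : 0 < 2 * (h - amendedPotential I W k (x t)) := by linarith
  obtain ⟨hJ, hJ'⟩ := hasFDerivAt_smul_bilin hf.differentiableAt
    ((isAmbientMetric_reduced hI).differentiableAt hν)
  have hs := (isAmbientMetric_reduced hI).symm
  obtain ⟨L, hLinj, hL0, ⟨c, hc⟩, hin⟩ := ha.inner_eq (f := sphereEq) (A := jacobiForm I W k h)
    hJ (jacobiMetric_eq hI h)
    (fun y u v => congrArg (2 * (h - amendedPotential I W k y) * ·) (hs y u v))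
    (fun u hu => mul_pos hfpos ((div_pos (cofactorForm_pos hI hu) hD).trans_eq
      (reducedForm_apply I (x t) u u).symm))
    (contDiff_sphereEq.differentiable (by simp) _)
    (fun y hy => by rw [sphereEq, mem_poissonSphere.1 hy, sub_self])
  have hdot : ∀ r, x t ⬝ᵥ L r = 0 := fun r => by
    have := hL0 r
    rw [fderiv_sphereEq] at this
    linarith
  have hta : IsTangent poissonSphere (x t) a := by
    rw [isTangent_poissonSphere_iff hν, ← dotProduct_fin_three, ← hc]
    exact hdot c
  refine ⟨hta, ?_⟩
  set u := deriv x t with hudef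
  set n := leftNormal I (x t) u with hn
  have htn : IsTangent poissonSphere (x t) n := isTangent_leftNormal hν
  obtain ⟨r, hrn⟩ := exists_eq_of_dotProduct_eq_zero hν0 hLinj hdot (n := n) (by
    rw [dotProduct_fin_three]; exact (isTangent_poissonSphere_iff hν).1 htn)
  have h1 := hin r
  rw [hrn] at h1
  have h2 := hEL n htn
  have hun : reducedForm I (x t) u n = 0 := by
    rw [reducedForm_apply, cofactorForm_leftNormal_self, zero_div]
  have hgy : gyroExt I k (x t) ![u, n] =
      k * gyroCoeff I (x t) * cofactorForm I u u := by
    rw [gyroExt_apply, gyroForm, sphereVolume_leftNormal hν hu, mul_assoc]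
  unfold eulerLagrange at h2
  have h3 : reducedForm I (x t) a n = -(k * gyroCoeff I (x t) * cofactorForm I u u) := by
    have e1 : ∀ p q s, fderiv ℝ (jacobiForm I W k h) (x t) p q s =
        2 * (h - amendedPotential I W k (x t)) * fderiv ℝ (reducedForm I) (x t) p q s +
        2 * -fderiv ℝ (amendedPotential I W k) (x t) p * reducedForm I (x t) q s := fun p q s => by
      refine (hJ' p q s).trans ?_
      rw [hf.fderiv]
      rfl
    have e2 : ∀ q s, jacobiForm I W k h (x t) q s =
        2 * (h - amendedPotential I W k (x t)) * reducedForm I (x t) q s := fun q s => rfl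
    -- By `hun` the derivative of the conformal factor along `u` drops out. By `hE` its derivative
    -- along `n` becomes the potential force times the conformal factor, so `h1` and `h2` differ
    -- only by the gyroscopic term.
    rw [e1, e1, e2, e2, hun, hE] at h1
    rw [hgy] at h2
    apply mul_left_cancel₀ hfpos.ne'
    linear_combination h1 + 2 * (h - amendedPotential I W k (x t)) * h2
  rw [← h3, reducedForm_apply, cofactorForm_leftNormal hν hu hta]
  field_simp

theorem geodesicCurvature_sign (hI : ∀ i, 0 < I i) {ν u a : Fin 3 → ℝ} {h : ℝ}
    (hν : ν ∈ poissonSphere) (hh : amendedPotential I W k ν < h)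
    (hu : IsTangent poissonSphere ν u) (ha : IsTangent poissonSphere ν a) (hu0 : u ≠ 0) :
    (0 < sphereVolume ν ![u, a] →
      0 < geodesicCurvature ((reducedSystem I W k).jacobiMetric h) ν u a) ∧
    (sphereVolume ν ![u, a] < 0 →
      geodesicCurvature ((reducedSystem I W k).jacobiMetric h) ν u a < 0) := by
  have hD := inertiaForm_pos hI (ne_zero_of_mem_poissonSphere hν)
  have hf : 0 < 2 * (h - amendedPotential I W k ν) := by linarith
  have hg : ∀ p q, (reducedSystem I W k).jacobiMetric h ν p q =
      2 * (h - amendedPotential I W k ν) / inertiaForm I ν * cofactorForm I p q := fun p q => by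
    rw [jacobiMetric_eq hI]
    refine (congrArg (2 * (h - amendedPotential I W k ν) * ·) (reducedForm_apply I ν p q)).trans ?_
    ring
  have hc := div_pos hf hD
  have hpos : sphereVolume ν ![u, a] ≠ 0 → 0 <
      √((reducedSystem I W k).jacobiMetric h ν u u * (reducedSystem I W k).jacobiMetric h ν a a -
        (reducedSystem I W k).jacobiMetric h ν u a ^ 2) /
      √((reducedSystem I W k).jacobiMetric h ν u u) ^ 3 := fun hv => by
    rw [hg, hg, hg]
    set c := 2 * (h - amendedPotential I W k ν) / inertiaForm I ν
    -- The Gram determinant is a positive multiple of the squared area, so the square root is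
    -- positive and the sign of the curvature is that of `sphereVolume`.
    have e : c * cofactorForm I u u * (c * cofactorForm I a a) - (c * cofactorForm I u a) ^ 2 =
        c ^ 2 * (I 0 * I 1 * I 2 * inertiaForm I ν * sphereVolume ν ![u, a] ^ 2) := by
      rw [← cofactorForm_gram hν hu ha]; ring
    rw [e]
    have h0 := hI 0
    have h1 := hI 1
    have h2 := hI 2
    have h3 := cofactorForm_pos hI hu0
    have h4 : 0 < sphereVolume ν ![u, a] ^ 2 := by positivity
    positivity
  constructor
  · intro hv
    rw [geodesicCurvature, mul_div_assoc, Real.sign_of_pos hv, one_mul]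
    exact hpos hv.ne'
  · intro hv
    rw [geodesicCurvature, mul_div_assoc, Real.sign_of_neg hv, neg_one_mul, neg_lt_zero]
    exact hpos hv.ne

theorem no_inflection (hI : ∀ i, 0 < I i) (hU : IsOpen U) (hSU : poissonSphere ⊆ U)
    (hW : ContDiffOn ℝ ∞ W U) (h0 : I 0 < I 1 + I 2) (h1 : I 1 < I 2 + I 0)
    (h2 : I 2 < I 0 + I 1) (hk : k ≠ 0) (h : ℝ) {J : Set ℝ} {x : ℝ → Fin 3 → ℝ} (hJ : IsOpen J)
    (hx : (reducedSystem I W k).IsMotionOn x J) {t : ℝ} (ht : t ∈ J)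
    (hE : (reducedSystem I W k).energy (x t, deriv x t) = h)
    (hh : amendedPotential I W k (x t) < h) :
    deriv x t ≠ 0 ∧
    (∃ a, IsCovAccel poissonSphere ((reducedSystem I W k).jacobiMetric h) x t a) ∧
    ∀ a, IsCovAccel poissonSphere ((reducedSystem I W k).jacobiMetric h) x t a →
      geodesicCurvature ((reducedSystem I W k).jacobiMetric h) (x t) (deriv x t) a ≠ 0 ∧
      (0 < k → geodesicCurvature ((reducedSystem I W k).jacobiMetric h) (x t) (deriv x t) a < 0) ∧
      (k < 0 → 0 < geodesicCurvature ((reducedSystem I W k).jacobiMetric h)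
        (x t) (deriv x t) a) := by
  obtain ⟨hxS, hu, hd, hd2, hEL⟩ := hx.equations hI hU hSU hW hJ ht
  have hmem : ∀ᶠ s in 𝓝 t, s ∈ J := hJ.mem_nhds ht
  have hE' : reducedForm I (x t) (deriv x t) (deriv x t) =
      2 * (h - amendedPotential I W k (x t)) := by
    have e : reducedMetric I (x t) (deriv x t) (deriv x t) / 2 + amendedPotential I W k (x t) = h :=
      hE
    rw [reducedMetric_eq hI] at e
    linarith
  -- The kinetic energy equals `h - Ṽ_k`, which is positive in the region.
  have hu0 : deriv x t ≠ 0 := fun hz => by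
    rw [hz, map_zero] at hE'
    linarith
  refine ⟨hu0, exists_isCovAccel_poissonSphere (hmem.mono hxS) (hmem.mono hd) hd2 _, fun a ha => ?_⟩
  obtain ⟨hta, hvol⟩ := sphereVolume_covAccel hI hU hSU hW (hxS t ht) hu hEL hE' hh ha
  obtain ⟨hpos, hneg⟩ := geodesicCurvature_sign hI (hxS t ht) hh hu hta hu0
  have hP := mul_pos (mul_pos (hI 0) (hI 1)) (hI 2)
  have hG := mul_pos (gyroCoeff_pos hI h0 h1 h2 (hxS t ht)) (cofactorForm_pos hI hu0)
  have hkpos : 0 < k → sphereVolume (x t) ![deriv x t, a] < 0 := fun hk => by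
    have := mul_pos hk hG
    by_contra hc
    nlinarith [mul_nonneg hP.le (not_lt.1 hc)]
  have hkneg : k < 0 → 0 < sphereVolume (x t) ![deriv x t, a] := fun hk => by
    have := mul_pos (neg_pos.2 hk) hG
    by_contra hc
    nlinarith [mul_nonneg hP.le (neg_nonneg.2 (not_lt.1 hc))]
  refine ⟨?_, fun hk => hneg (hkpos hk), fun hk => hpos (hkneg hk)⟩
  rcases hk.lt_or_gt with hk | hk
  · exact (hpos (hkneg hk)).ne'
  · exact (hneg (hkpos hk)).ne

end Trajectories

theorem mainTheorem3 (I : Fin 3 → ℝ) (hI : ∀ i, 0 < I i) (V : Mat3 → ℝ)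
    (hV : IsSmoothForm SO3 (fun Q (_ : Fin 0 → Mat3) => V Q))
    (hsymm : ∀ τ : ℝ, ∀ Q ∈ SO3, V (rot τ * Q) = V Q) :
    -- the Poisson sphere is the orbit space of the rotations about the vertical
    ((∀ Q ∈ SO3, spin Q (genField Q) = poissonMap Q) ∧ poissonMap '' SO3 = poissonSphere ∧
      ∀ Q ∈ SO3, ∀ Q' ∈ SO3, poissonMap Q = poissonMap Q' ↔ ∃ τ, Q' = rot τ * Q) ∧
    -- `m̃` is the metric carried over from the horizontal subspaces
    (∀ Q ∈ SO3,
      (∀ a, IsTangent poissonSphere (poissonMap Q) a →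
        ∃! w, IsTangent SO3 Q w ∧ momentum I (Q, w) = 0 ∧ poissonMap w = a) ∧
      (∀ w, IsTangent SO3 Q w → IsTangent poissonSphere (poissonMap Q) (poissonMap w)) ∧
      ∀ w₁ w₂, IsTangent SO3 Q w₁ → IsTangent SO3 Q w₂ →
        momentum I (Q, w₁) = 0 → momentum I (Q, w₂) = 0 →
        reducedMetric I (poissonMap Q) (poissonMap w₁) (poissonMap w₂) = bodyMetric I Q w₁ w₂) ∧
    -- `Φ̃` is induced by the curvature form `dħ` of the connection
    (∀ Q ∈ SO3, HasExtDerivAt SO3 (connectionForm I) Q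
      (fun v => gyroForm I (poissonMap Q) (fun i => poissonMap (v i)))) ∧
    -- the reduced system for each value `k` of the momentum
    (∃ W : (Fin 3 → ℝ) → ℝ,
      IsSmoothForm poissonSphere (fun ν (_ : Fin 0 → Fin 3 → ℝ) => W ν) ∧
      (∀ Q ∈ SO3, V Q = W (poissonMap Q)) ∧
      ∀ k : ℝ,
        (∀ Q ∈ SO3, amendedPotential I W k (poissonMap Q)
          = V Q + k ^ 2 / (2 * bodyMetric I Q (genField Q) (genField Q))) ∧
        (bodySystem I V).IsMechanical ∧ (reducedSystem I W k).IsMechanical ∧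
        (∀ p ∈ tangentBundle SO3, ∃! X, (bodySystem I V).IsDynamicalVector p X) ∧
        (∀ p ∈ tangentBundle poissonSphere,
          ∃! X, (reducedSystem I W k).IsDynamicalVector p X) ∧
        rho '' momentumLevel I k = tangentBundle poissonSphere ∧
        (∀ p ∈ momentumLevel I k, ∀ X, (bodySystem I V).IsDynamicalVector p X →
          (reducedSystem I W k).IsDynamicalVector (rho p) (rho X)) ∧
        -- trajectories have no inflection points in the metric `m̃_h`
        (I 0 < I 1 + I 2 → I 1 < I 2 + I 0 → I 2 < I 0 + I 1 → k ≠ 0 →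
          ∀ (h : ℝ) (J : Set ℝ) (x : ℝ → Fin 3 → ℝ), IsOpen J →
            (reducedSystem I W k).IsMotionOn x J →
            (∀ t ∈ J, (reducedSystem I W k).energy (x t, deriv x t) = h) →
            ∀ t ∈ J, amendedPotential I W k (x t) < h →
              deriv x t ≠ 0 ∧
              (∃ a, IsCovAccel poissonSphere ((reducedSystem I W k).jacobiMetric h) x t a) ∧
              ∀ a, IsCovAccel poissonSphere ((reducedSystem I W k).jacobiMetric h) x t a →
                geodesicCurvature ((reducedSystem I W k).jacobiMetric h)
                  (x t) (deriv x t) a ≠ 0 ∧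
                (0 < k → geodesicCurvature ((reducedSystem I W k).jacobiMetric h)
                  (x t) (deriv x t) a < 0) ∧
                (k < 0 → 0 < geodesicCurvature ((reducedSystem I W k).jacobiMetric h)
                  (x t) (deriv x t) a))) ∧
    -- the coefficient is everywhere positive in virtue of the triangle inequalities
    (I 0 < I 1 + I 2 → I 1 < I 2 + I 0 → I 2 < I 0 + I 1 →
      ∀ ν ∈ poissonSphere, 0 < gyroCoeff I ν) := by
  obtain ⟨W, U, hU, hSU, hW, hVW⟩ := exists_reducedPotential hV hsymm
  refine ⟨⟨fun Q hQ => spin_genField hQ, poissonMap_image, fun Q hQ Q' hQ' =>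
      poissonMap_eq_iff hQ hQ'⟩, fun Q hQ => ⟨fun a ha => ?_, fun w => isTangent_poissonMap,
      fun w₁ w₂ h₁ h₂ _ hm => reducedMetric_of_horizontal hI hQ h₁ h₂ hm⟩,
    fun Q hQ => hasExtDerivAt_connectionForm hI hQ,
    ⟨W, isSmoothForm_of_contDiffOn hU hSU hW, hVW, fun k => ⟨fun Q hQ => ?_,
      isMechanical_bodySystem hI hV, isMechanical_reducedSystem hI hU hSU hW, fun p hp => ?_,
      fun p hp => ?_, rho_image hI k, fun p hp X hX =>
        isDynamicalVector_rho hI hV hU hSU hW hVW hp hX, ?_⟩⟩,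
    fun h0 h1 h2 ν hν => gyroCoeff_pos hI h0 h1 h2 hν⟩
  · obtain ⟨b, hm, hb⟩ := exists_lift hI 0 hQ ha
    refine ⟨Q * hat b, ⟨(isTangent_SO3_iff hQ).2 ⟨b, rfl⟩, hm, hb⟩, ?_⟩
    rintro w ⟨hw, hwm, hwa⟩
    obtain ⟨c, rfl⟩ := (isTangent_SO3_iff hQ).1 hw
    rw [lift_unique hI hQ (hwm.trans hm.symm) (hwa.trans hb.symm)]
  · rw [bodyMetric_genField hQ, hVW Q hQ]
    rfl
  · exact GyroSystem.existsUnique_isDynamicalVector (S := bodySystem I V) (K := 0)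
      isRegularLevel_SO3 (isAmbientMetric_body hI) hp.1 hp.2 hV fun _ => rfl
  · exact GyroSystem.existsUnique_isDynamicalVector (S := reducedSystem I W k)
      isRegularLevel_poissonSphere (isAmbientMetric_reduced hI) hp.1 hp.2
      (isMechanical_reducedSystem hI hU hSU hW).2.1 fun v => (gyroExt_apply I k p.1 v).symm
  · exact fun h0 h1 h2 hk h J x hJ hx hE t ht hh =>
      no_inflection hI hU hSU hW h0 h1 h2 hk h hJ hx ht (hE t ht) hh
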